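/- **Conventions.** Let $K$ be a field. Closed subschemes of $\mathbb A^n=\mathbb A^n_K$ are given by ideals of $K[x_1,\dots,x_n]$. The *fundamental cycle* of a closed subscheme $X\subset\mathbb A^n$ is $\sum_i \operatorname{length}(\mathcal O_{X,\eta_i})\,[X_i]$, where $X_i$ runs over the irreducible components of $X$ (with reduced structure) and $\eta_i$ is the generic point of $X_i$; embedded components do not contribute. Let $Z=\sum a_i[Z_i]$ ($a_i>0$) be an effective cycle on $\mathbb A^n$, purely of dimension $d$. A surjective linear map $\pi:\mathbb A^n\to\mathbb A^{d+1}$ is called *allowable* for $Z$ if $\pi|_{Z_i}$ is finite for every $i$. For such $\pi$, the push-forward $\pi_*Z=\sum_i a_i\,[\kappa(Z_i):\kappa(\pi(Z_i))]\,[\pi(Z_i)]$ is an effective divisor on $\mathbb A^{d+1}$; let $f(\pi,Z)\in K[x_1,\dots,x_n]$ be the pull-back by $\pi$ of an equation of $\pi_*Z$ (it is unique up to a unit). If $K$ is infinite, the *ideal of Chow equations* of $Z$ is $$I^{ch}(Z):=\bigl(f(\pi,Z) : \pi \text{ allowable, defined over } K\bigr)\subset K[x_1,\dots,x_n].$$ If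 $K$ is finite, $I^{ch}(Z)$ is the ideal with $I^{ch}(Z)\otimes_K L=I^{ch}(Z_L)$ for an infinite field extension $L\supset K$, that is, $I^{ch}(Z)=I^{ch}(Z_L)\cap K[x_1,\dots,x_n]$; we take $L=K(t)$. **Proposition.** Let $n,d\ge 0$ and let $Y\subset\mathbb A^n\times\mathbb A^1$ be a closed subscheme of pure dimension $d+1$ without embedded points such that the second projection $\pi:Y\to\mathbb A^1$ is flat. Let $Y_0=\pi^{-1}(0)\subset\mathbb A^n$ be the central fiber, with ideal $I(Y_0)\subset K[x_1,\dots,x_n]$, and let $W$ be a purely $d$-dimensional cycle on $\mathbb A^n$ which is the fundamental cycle of $Y_0$. Then $$I^{ch}(W)\subset I(Y_0).$$ -/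

import Mathlib

open MvPolynomial

noncomputable section

namespace ChowEquations

/-- Closed subschemes of `Spec R` are given by ideals of `R`, reduced and irreducible ones by primes.
An effective algebraic cycle on `Spec R` is a formal finite sum of reduced and irreducible closed
subschemes with coefficients in `ℕ`. -/
abbrev EffCycle (R : Type*) [CommRing R] : Type _ := PrimeSpectrum R →₀ ℕ

section Cycles

variable {R S : Type*} [CommRing R] [CommRing S]

/-- All components of the cycle `Z` have dimension `d`, that is, `Z ∈ Z_d (Spec R)`. -/
def EffCycle.IsPure (Z : EffCycle R) (d : ℕ) : Prop :=
  ∀ p ∈ Z.support, ringKrullDim (R ⧸ p.asIdeal) = d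

/-- The ideal `∏ I(Z_i) ^ a_i` of the effective cycle `∑ a_i [Z_i]`. For an effective divisor
on an affine space it is the principal ideal generated by an equation of the divisor. -/
def EffCycle.ideal (Z : EffCycle R) : Ideal R :=
  Z.prod fun p a => p.asIdeal ^ a

/-- Multiplicity of the subscheme defined by `J` along a component `V(p)` of it: the length of the
local ring of `R ⧸ J` at the generic point of `V(p)`. It is `0` if `V(p)` is not an irreducible
component. -/
def compMultiplicity (J : Ideal R) (p : PrimeSpectrum R) : ℕ :=
  open Classical in
  if p.asIdeal ∈ J.minimalPrimes then
    (Module.length (Localization.AtPrime p.asIdeal)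
      (Localization.AtPrime p.asIdeal ⧸
        J.map (algebraMap R (Localization.AtPrime p.asIdeal)))).toNat
  else 0

theorem finite_support_compMultiplicity [IsNoetherianRing R] (J : Ideal R) :
    (Function.support (compMultiplicity J)).Finite := by
  have h : (PrimeSpectrum.asIdeal ⁻¹' J.minimalPrimes : Set (PrimeSpectrum R)).Finite :=
    (J.finite_minimalPrimes_of_isNoetherianRing).preimage
      (fun a _ b _ hab => PrimeSpectrum.ext hab)
  refine h.subset fun p hp => ?_
  by_contra hn
  exact hp (if_neg hn)

/-- The fundamental cycle of the subscheme defined by `J`: the sum of its irreducible components,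
with multiplicities. -/
def fundamentalCycle [IsNoetherianRing R] (J : Ideal R) : EffCycle R :=
  Finsupp.ofSupportFinite (compMultiplicity J) (finite_support_compMultiplicity J)

/-- For `φ : R → S` and a prime `p` of `S` over the prime `q` of `R`, the degree `[κ(p) : κ(q)]`,
that is, the degree of `V(p)` over its image. -/
def residueDegree (φ : R →+* S) (p : PrimeSpectrum S) : ℕ :=
  letI := (Ideal.ResidueField.map (p.comap φ).asIdeal p.asIdeal φ rfl).toAlgebra
  Module.finrank (p.comap φ).asIdeal.ResidueField p.asIdeal.ResidueField

/-- Push-forward of cycles along `Spec S → Spec R`, for cycles whose components are finite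
over `Spec R`. -/
def EffCycle.pushforward (φ : R →+* S) (Z : EffCycle S) : EffCycle R :=
  Z.sum fun p a => Finsupp.single (p.comap φ) (a * residueDegree φ p)

end Cycles

section Affine

variable {K : Type*} [Field K] {n : ℕ}

/-- The map of coordinate rings `K[y_0, …, y_{m-1}] → K[x_0, …, x_{n-1}]` given by the linear map
`𝔸ⁿ → 𝔸ᵐ` with matrix `M`. -/
def linearPullback {m : ℕ} (M : Matrix (Fin m) (Fin n) K) :
    MvPolynomial (Fin m) K →ₐ[K] MvPolynomial (Fin n) K :=
  aeval fun i => ∑ j, C (M i j) * X j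

/-- The linear map with matrix `M` is a projection `𝔸ⁿ → 𝔸^{d+1}` (that is, it is surjective) whose
restriction to every component of the cycle `Z` is finite. -/
structure IsAllowable {d : ℕ} (Z : EffCycle (MvPolynomial (Fin n) K))
    (M : Matrix (Fin (d + 1)) (Fin n) K) : Prop where
  surjective : Function.Surjective M.mulVec
  finite : ∀ p ∈ Z.support,
    ((Ideal.Quotient.mk p.asIdeal).comp (linearPullback M).toRingHom).Finite

/-- `f` is the pull-back by the projection `π` with matrix `M` of an equation `g` of the
hypersurface `π_* Z`. -/
def IsChowEquation {d : ℕ} (Z : EffCycle (MvPolynomial (Fin n) K))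
    (M : Matrix (Fin (d + 1)) (Fin n) K) (f : MvPolynomial (Fin n) K) : Prop :=
  ∃ g : MvPolynomial (Fin (d + 1)) K,
    Ideal.span {g} = (Z.pushforward (linearPullback M).toRingHom).ideal ∧ linearPullback M g = f

/-- The ideal generated by the Chow equations of a purely `d`-dimensional cycle for all allowable
projections that are defined over `K`. -/
def chowSpan (d : ℕ) (Z : EffCycle (MvPolynomial (Fin n) K)) : Ideal (MvPolynomial (Fin n) K) :=
  Ideal.span {f | ∃ M : Matrix (Fin (d + 1)) (Fin n) K, IsAllowable Z M ∧ IsChowEquation Z M f}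

/-- The base change of a cycle on `𝔸ⁿ` to a field extension `L` of `K`. -/
def EffCycle.baseChange (L : Type*) [Field L] [Algebra K L]
    (Z : EffCycle (MvPolynomial (Fin n) K)) : EffCycle (MvPolynomial (Fin n) L) :=
  Z.sum fun p a =>
    a • fundamentalCycle (p.asIdeal.map (MvPolynomial.map (σ := Fin n) (algebraMap K L)))

/-- The ideal of Chow equations of a purely `d`-dimensional effective cycle on `𝔸ⁿ`. If `K` is
infinite, it is generated by the Chow equations for all allowable projections. If `K` is finite, it
is obtained from that of the base change to an infinite field `L ⊇ K`, here `L = K(t)`, as the ideal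
`I` with `I ⊗ L = I^{ch}(Z_L)`, which is `I^{ch}(Z_L) ∩ K[x]`. -/
def chowIdeal (d : ℕ) (Z : EffCycle (MvPolynomial (Fin n) K)) :
    Ideal (MvPolynomial (Fin n) K) :=
  open Classical in
  if Infinite K then chowSpan d Z
  else (chowSpan d (Z.baseChange (RatFunc K))).comap
    (MvPolynomial.map (algebraMap K (RatFunc K)))

/-- The closed subscheme of `𝔸ⁿ` defined by `I` has pure dimension `d`: all of its irreducible
components have dimension `d`. -/
def IsPureDimensional (I : Ideal (MvPolynomial (Fin n) K)) (d : ℕ) : Prop :=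
  ∀ p ∈ I.minimalPrimes, ringKrullDim (MvPolynomial (Fin n) K ⧸ p) = d

/-- The closed subscheme of `𝔸ⁿ` defined by `I` has no embedded points: its associated points
are generic points of irreducible components. -/
def NoEmbeddedPoints (I : Ideal (MvPolynomial (Fin n) K)) : Prop :=
  associatedPrimes (MvPolynomial (Fin n) K) (MvPolynomial (Fin n) K ⧸ I) ⊆ I.minimalPrimes

/-- On `𝔸ⁿ × 𝔸¹ = 𝔸ⁿ⁺¹` the last coordinate is that of `𝔸¹`. The closed subscheme defined by `I` is
flat over `𝔸¹` by the second projection. -/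
def IsFlatOverLine (I : Ideal (MvPolynomial (Fin (n + 1)) K)) : Prop :=
  ((Ideal.Quotient.mk I).comp
    (Polynomial.aeval (R := K) (X (Fin.last n) : MvPolynomial (Fin (n + 1)) K)).toRingHom).Flat

/-- The ideal in `K[𝔸ⁿ]` of the fiber over `0` of the closed subscheme of `𝔸ⁿ × 𝔸¹` defined by `I`:
the image of `I` under setting the last coordinate equal to `0`. -/
def centralFiber (I : Ideal (MvPolynomial (Fin (n + 1)) K)) : Ideal (MvPolynomial (Fin n) K) :=
  I.map (aeval (R := K)
    (Fin.snoc (α := fun _ => MvPolynomial (Fin n) K) X 0) :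
      MvPolynomial (Fin (n + 1)) K →ₐ[K] MvPolynomial (Fin n) K).toRingHom

end Affine

end ChowEquations

end

namespace ChowEquations

/-! ### Power series in `t`, evaluated modulo powers of `t` -/

section EvalTrunc

variable {R A : Type*} [CommRing R] [CommRing A] [Algebra R A]

/-! Write `B = K[x]`, let `J` be the ideal of the central fiber, `A` the coordinate ring of the
family and `t` the coordinate of the base line, so that `A / tA = B / J`. For an allowable
projection, the components of the central fiber are finite over `𝔸^{d+1}`. In suitable coordinates
`𝔸^{d+1} = Spec R[X]` with `R` a polynomial ring in `d` variables over which `B / J` is finite. Let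
`F = Frac R` and let `y` be the image of `X` in `B / J`.

Characteristic polynomials of `y` over `F` are multiplicative in exact sequences and trivial on
modules killed by a nonzero element of `R`. Hence the characteristic polynomial `χ` of `y` on `F ⊗ B
/ J` is the product over the components of the cycle, with multiplicities
(`charpolyOn_quotient_eq_prod`), and this product is the equation of the push-forward
(`exists_equation_pushforward`). The claim becomes `χ(y) = 0` in `B / J`. Cayley–Hamilton gives this
only up to `R`-torsion, which is present when the central fiber has embedded points; the family is
what removes the torsion.

Lift `y` to `A`. Over `F`, multiplication by `y` on the family has a matrix over `F⟦t⟧`, whose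
characteristic polynomial reduces to `χ` modulo `t`. Its coefficients are integral over `R⟦t⟧` and
have bounded denominators, so they lie in `R⟦t⟧`, since `R` is noetherian and normal
(`exists_formal_charpoly`). Evaluated at `y`, the lifted polynomial is therefore an element of `A /
t^k` that vanishes over `F`, for every `k`.

Purity and the absence of embedded points now enter through Noether normalization. The
`R[t]`-torsion of `A` lies in `tA` (`mem_span_of_smul_eq_zero`) and may be divided out. After that,
near `t = 0`, `A` is locally a finite torsion-free `R[t]`-module by Zariski's main theorem, and
Artin–Rees yields one `k` such that `R`-torsion modulo `t^k` is divisible by `t`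
(`exists_pow_dvd_of_torsionFree`). Reduction modulo `t` gives `χ(y) = 0`
(`aeval_charpoly_eq_zero_of_deformation`).

For finite `K` the same argument runs over `K(t)`. What is carried along the field extension is a
polynomial subring of regular elements and the product formula for characteristic polynomials. -/

theorem X_pow_dvd_sub_trunc (p : Polynomial R) (k : ℕ) :
    Polynomial.X ^ k ∣ p - PowerSeries.trunc k (p : PowerSeries R) := by
  rw [Polynomial.X_pow_dvd_iff]
  intro m hm
  simp [PowerSeries.coeff_trunc, hm]

theorem mk_aeval_trunc (t : A) (k : ℕ) (p : Polynomial R) :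
    Ideal.Quotient.mk (Ideal.span {t ^ k})
      (Polynomial.aeval t (PowerSeries.trunc k (p : PowerSeries R))) =
      Ideal.Quotient.mk (Ideal.span {t ^ k}) (Polynomial.aeval t p) := by
  symm
  rw [Ideal.Quotient.mk_eq_mk_iff_sub_mem, Ideal.mem_span_singleton, ← map_sub]
  simpa using map_dvd (Polynomial.aeval t) (X_pow_dvd_sub_trunc p k)

/-- Evaluation of a power series at `t`, modulo `t ^ k`. -/
noncomputable def evalTrunc (t : A) (k : ℕ) : PowerSeries R →+* A ⧸ Ideal.span {t ^ k} where
  toFun f := Ideal.Quotient.mk _ (Polynomial.aeval t (PowerSeries.trunc k f))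
  map_zero' := by simp
  map_add' f g := by simp
  map_one' := by
    have := mk_aeval_trunc t k (1 : Polynomial R)
    simpa using this
  map_mul' f g := by
    have := mk_aeval_trunc t k (PowerSeries.trunc k f * PowerSeries.trunc k g)
    rw [Polynomial.coe_mul, PowerSeries.trunc_trunc_mul_trunc] at this
    simpa using this

theorem evalTrunc_apply (t : A) (k : ℕ) (f : PowerSeries R) :
    evalTrunc t k f = Ideal.Quotient.mk _ (Polynomial.aeval t (PowerSeries.trunc k f)) := rfl

theorem evalTrunc_coe (t : A) (k : ℕ) (p : Polynomial R) :
    evalTrunc t k (p : PowerSeries R) = Ideal.Quotient.mk _ (Polynomial.aeval t p) :=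
  mk_aeval_trunc t k p

theorem evalTrunc_C (t : A) (k : ℕ) (r : R) :
    evalTrunc t k (PowerSeries.C r) = Ideal.Quotient.mk _ (algebraMap R A r) := by
  rw [← Polynomial.coe_C, evalTrunc_coe, Polynomial.aeval_C]

theorem evalTrunc_X (t : A) (k : ℕ) :
    evalTrunc t k (PowerSeries.X : PowerSeries R) = Ideal.Quotient.mk _ t := by
  rw [← Polynomial.coe_X, evalTrunc_coe, Polynomial.aeval_X]

theorem mk_evalTrunc_map {R' A' : Type*} [CommRing R'] [CommRing A'] [Algebra R' A']
    (φ : R →+* R') (ψ : A →+* A') (h : ψ.comp (algebraMap R A) = (algebraMap R' A').comp φ)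
    (t : A) (k : ℕ) (f : PowerSeries R) :
    evalTrunc (ψ t) k (PowerSeries.map φ f) =
      Ideal.Quotient.mk _ (ψ (Polynomial.aeval t (PowerSeries.trunc k f))) := by
  rw [evalTrunc_apply, Polynomial.aeval_def, Polynomial.aeval_def, Polynomial.hom_eval₂ _ _ ψ, h,
    ← Polynomial.eval₂_map]
  congr 2
  ext i
  simp only [PowerSeries.coeff_trunc, Polynomial.coeff_map, PowerSeries.coeff_map]
  split_ifs <;> simp

theorem evalTrunc_one (t : A) (f : PowerSeries R) :
    evalTrunc t 1 f = Ideal.Quotient.mk _ (algebraMap R A (PowerSeries.constantCoeff f)) := by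
  rw [evalTrunc_apply, PowerSeries.trunc_succ, PowerSeries.trunc_zero']
  simp

theorem dvd_of_expansion_one {ι : Type*} [Fintype ι] (t : A) (e : ι → A) (a : A)
    (c : ι → PowerSeries R) (h : Ideal.Quotient.mk (Ideal.span {t ^ 1}) a =
      ∑ i, evalTrunc t 1 (c i) * Ideal.Quotient.mk _ (e i)) :
    t ∣ a - ∑ i, PowerSeries.constantCoeff (c i) • e i := by
  have : t ^ 1 ∣ a - ∑ i, PowerSeries.constantCoeff (c i) • e i := by
    rw [← Ideal.mem_span_singleton, ← Ideal.Quotient.eq_zero_iff_mem, map_sub, sub_eq_zero, h,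
      map_sum]
    exact Finset.sum_congr rfl fun i _ => by rw [evalTrunc_one, Algebra.smul_def, map_mul]
  simpa using this

/-- If `e` generates `A / t A` over `R`, then every element of `A` is a combination of the `e i`
with power series in `t` as coefficients, up to any power of `t`. -/
theorem exists_powerSeries_expansion {ι : Type*} [Fintype ι] (t : A) (e : ι → A)
    (h : ∀ a, ∃ (r : ι → R) (a' : A), a = ∑ i, r i • e i + t * a') (a : A) :
    ∃ c : ι → PowerSeries R, ∀ k, Ideal.Quotient.mk (Ideal.span {t ^ k}) a =
      ∑ i, evalTrunc t k (c i) * Ideal.Quotient.mk _ (e i) := by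
  choose r q hq using h
  -- The coefficients come from repeated division by `t`: `q^[j] a` is the `j`-th quotient and `r`
  -- reads off its residue; `t ^ k * q^[k] a` is the remainder after `k` steps.
  refine ⟨fun i => PowerSeries.mk fun j => r (q^[j] a) i, fun k => ?_⟩
  have key : ∀ k, a = ∑ i, Polynomial.aeval t
      (PowerSeries.trunc k (PowerSeries.mk fun j => r (q^[j] a) i)) * e i + t ^ k * q^[k] a := by
    intro k
    induction k with
    | zero => simp [PowerSeries.trunc_zero']
    | succ k ih =>
      conv_lhs => rw [ih, hq (q^[k] a)]
      simp only [PowerSeries.trunc_succ, map_add, Function.iterate_succ_apply',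
        Polynomial.aeval_monomial, PowerSeries.coeff_mk, add_mul, Finset.sum_add_distrib, mul_add,
        Finset.mul_sum, Algebra.smul_def]
      rw [add_assoc]
      congr 1
      congr 1
      · exact Finset.sum_congr rfl fun i _ => by ring
      · ring
  conv_lhs => rw [key k]
  simp only [evalTrunc_apply, map_add, map_sum, map_mul]
  rw [add_eq_left, ← map_mul, Ideal.Quotient.eq_zero_iff_mem]
  exact Ideal.mul_mem_right _ _ (Ideal.mem_span_singleton_self _)

/-- Power series expansions are unique if the `e i` are independent modulo `t`. -/
theorem powerSeries_expansion_unique {ι : Type*} [Fintype ι] (t : A) (e : ι → A)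
    (ht : ∀ a, t * a = 0 → a = 0)
    (h : ∀ r : ι → R, t ∣ ∑ i, r i • e i → r = 0) (c : ι → PowerSeries R)
    (hc : ∀ k, ∑ i, evalTrunc t k (c i) * Ideal.Quotient.mk _ (e i) = 0) : c = 0 := by
  have htk : ∀ k a, t ^ k * a = 0 → a = 0 := by
    intro k
    induction k with
    | zero => simp
    | succ k ih => exact fun a ha => ht a (ih _ (by rw [← mul_assoc, ← pow_succ, ha]))
  have key : ∀ j i, PowerSeries.coeff j (c i) = 0 := by
    intro j
    induction j using Nat.strong_induction_on with
    | _ j ih =>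
      -- Coefficients below `j` vanish by induction, so modulo `t ^ (j + 1)` only the terms in `t ^
      -- j` are left; cancelling `t ^ j` gives a relation among the `e i` modulo `t`.
      have h1 := hc (j + 1)
      have h2 : ∀ i, evalTrunc t (j + 1) (c i) =
          Ideal.Quotient.mk _ (t ^ j * algebraMap R A (PowerSeries.coeff j (c i))) := by
        intro i
        have : PowerSeries.trunc (j + 1) (c i) =
            Polynomial.monomial j (PowerSeries.coeff j (c i)) := by
          ext m
          rw [PowerSeries.coeff_trunc, Polynomial.coeff_monomial]
          split_ifs with h1 h2 h2
          · rw [h2]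
          · exact ih m (by omega) i
          · omega
          · rfl
        rw [evalTrunc_apply, this, Polynomial.aeval_monomial, mul_comm]
      simp only [h2, ← map_mul, ← map_sum] at h1
      rw [Ideal.Quotient.eq_zero_iff_mem, Ideal.mem_span_singleton] at h1
      obtain ⟨b, hb⟩ := h1
      have h3 : ∑ i, PowerSeries.coeff j (c i) • e i = t * b := by
        rw [← sub_eq_zero]
        refine htk j _ ?_
        rw [mul_sub, sub_eq_zero, ← mul_assoc, ← pow_succ, ← hb, Finset.mul_sum]
        exact Finset.sum_congr rfl fun i _ => by rw [Algebra.smul_def, mul_assoc]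
      exact congrFun (h _ ⟨b, h3⟩)
  ext i j
  exact key j i

end EvalTrunc

/-! ### Cayley–Hamilton for generating families -/

section Matrices

variable {ι S Q : Type*} [Fintype ι] [DecidableEq ι] [CommRing S] [CommRing Q]

/-- The determinant trick: `y - c` kills the vector `e`, hence so does its determinant. The `e i`
need not be independent, so mere generators of `A / tA` are allowed. -/
theorem eval₂_charpoly_mul_eq_zero (φ : S →+* Q) (c : Matrix ι ι S) (e : ι → Q) (y : Q)
    (h : ∀ i, y * e i = ∑ j, φ (c i j) * e j) (i : ι) :
    c.charpoly.eval₂ φ y * e i = 0 := by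
  have h0 : (Matrix.scalar ι y - c.map φ).mulVec e = 0 := by
    ext i
    rw [Matrix.sub_mulVec, Pi.sub_apply, Matrix.scalar_apply, Matrix.mulVec_diagonal, h i]
    exact sub_self _
  have h1 : c.charpoly.eval₂ φ y = (Matrix.scalar ι y - c.map φ).det := by
    rw [← Matrix.eval_charpoly, Polynomial.eval₂_eq_eval_map, Matrix.charpoly_map]
  have h2 := congrArg (Matrix.scalar ι y - c.map φ).adjugate.mulVec h0
  rw [Matrix.mulVec_mulVec, Matrix.adjugate_mul, Matrix.mulVec_zero, Matrix.smul_mulVec,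
    Matrix.one_mulVec] at h2
  rw [h1]
  simpa using congrFun h2 i

/-- Combined with uniqueness of expansions, this turns a polynomial equation for `y` into the same
equation for its matrix. -/
theorem eval₂_mul_eq_sum_aeval (φ : S →+* Q) (c : Matrix ι ι S) (e : ι → Q) (y : Q)
    (h : ∀ i, y * e i = ∑ j, φ (c i j) * e j) (P : Polynomial S) (i : ι) :
    P.eval₂ φ y * e i = ∑ j, φ ((Polynomial.aeval c P) i j) * e j := by
  have hm : ∀ n i, y ^ n * e i = ∑ j, φ ((c ^ n) i j) * e j := by
    intro n
    induction n with
    | zero => intro i; simp [Matrix.one_apply, ite_mul, apply_ite φ]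
    | succ n ih =>
      intro i
      rw [pow_succ', pow_succ', mul_assoc, ih, Finset.mul_sum]
      simp_rw [mul_left_comm y, h, (pow_mul_comm' c n).symm, Matrix.mul_apply, map_sum, map_mul,
        Finset.sum_mul, Finset.mul_sum]
      rw [Finset.sum_comm]
      exact Finset.sum_congr rfl fun _ _ => Finset.sum_congr rfl fun _ _ => (mul_assoc _ _ _).symm
  induction P using Polynomial.induction_on' with
  | add p q hp hq => simp [Polynomial.eval₂_add, add_mul, hp, hq, Finset.sum_add_distrib]
  | monomial n a =>
    rw [Polynomial.eval₂_monomial, mul_assoc, hm, Polynomial.aeval_monomial, Finset.mul_sum]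
    refine Finset.sum_congr rfl fun j _ => ?_
    rw [Algebra.algebraMap_eq_smul_one, smul_mul_assoc, one_mul, Matrix.smul_apply, smul_eq_mul,
      map_mul, mul_assoc]

/-- The scalar matrix `X` commutes with `c`, so `X - c` divides `P(X) - P(c) = P(X)` among matrices
over `S[X]`; take determinants. -/
theorem charpoly_dvd_pow_of_aeval_eq_zero (c : Matrix ι ι S) (P : Polynomial S)
    (hP : Polynomial.aeval c P = 0) : c.charpoly ∣ P ^ Fintype.card ι := by
  set C' : Matrix ι ι (Polynomial S) := c.map Polynomial.C with hC'
  set Y : Matrix ι ι (Polynomial S) := Matrix.scalar ι Polynomial.X with hY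
  have hcomm : Commute Y C' := Matrix.scalar_commute _ (fun r => Commute.all _ _) _
  have h1 : ∀ n, (Y - C') ∣ Y ^ n - C' ^ n := fun n => hcomm.sub_dvd_pow_sub_pow n
  have h2 : (Y - C') ∣ ∑ n ∈ P.support, (Polynomial.C (P.coeff n)) • (Y ^ n - C' ^ n) := by
    refine Finset.dvd_sum fun n _ => ?_
    obtain ⟨D, hD⟩ := h1 n
    exact ⟨Polynomial.C (P.coeff n) • D, by rw [hD, Matrix.mul_smul]⟩
  have h3 : ∑ n ∈ P.support, (Polynomial.C (P.coeff n)) • (Y ^ n - C' ^ n) =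
      Matrix.scalar ι P := by
    simp only [smul_sub, Finset.sum_sub_distrib]
    have h4 : ∑ n ∈ P.support, (Polynomial.C (P.coeff n)) • C' ^ n =
        (Polynomial.aeval c P).map Polynomial.C := by
      rw [Polynomial.aeval_def, Polynomial.eval₂_eq_sum, Polynomial.sum_def]
      change _ = (Polynomial.C : S →+* Polynomial S).mapMatrix _
      rw [map_sum]
      refine Finset.sum_congr rfl fun n _ => ?_
      rw [Algebra.algebraMap_eq_smul_one, smul_mul_assoc, one_mul]
      ext1 i j
      rw [RingHom.mapMatrix_apply, Matrix.map_apply, Matrix.smul_apply, Matrix.smul_apply, hC',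
        ← RingHom.mapMatrix_apply, ← map_pow]
      simp
    rw [h4, hP]
    conv_rhs => rw [P.as_sum_support_C_mul_X_pow]
    simp [hY, Matrix.smul_eq_diagonal_mul, Matrix.diagonal_pow, Pi.pow_def]
  obtain ⟨D, hD⟩ := h2
  rw [h3] at hD
  refine ⟨D.det, ?_⟩
  have := congrArg Matrix.det hD
  rw [Matrix.det_mul] at this
  simpa [Matrix.charpoly, Matrix.charmatrix, hY, hC', Matrix.det_diagonal] using this

end Matrices

/-! ### Complete integral closedness of `R⟦X⟧` in `F⟦X⟧` -/

section AlmostIntegral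

variable {R F : Type*} [CommRing R] [IsDomain R] [IsNoetherianRing R] [IsIntegrallyClosed R]
  [Field F] [Algebra R F] [IsFractionRing R F]

/-- In the degree equal to the order of `r`, the coefficient of `r * f ^ n` is the leading
coefficient of `r` times the `n`-th power of the constant term of `f`. So this constant term is
almost integral over `R`, hence integral because `R` is noetherian. -/
theorem constantCoeff_mem_range_of_almostIntegral (f r : PowerSeries F) (hr : r ≠ 0)
    (h : ∀ n, r * f ^ n ∈ (PowerSeries.map (algebraMap R F)).range)  :
    PowerSeries.constantCoeff f ∈ (algebraMap R F).range := by
  have hr0 : PowerSeries.coeff r.order.toNat r ≠ 0 := PowerSeries.coeff_order hr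
  set a := r.order.toNat
  have h1 : ∀ n, PowerSeries.coeff a r * PowerSeries.constantCoeff f ^ n ∈
      (algebraMap R F).range := by
    intro n
    obtain ⟨g, hg⟩ := h n
    refine ⟨PowerSeries.coeff a g, ?_⟩
    rw [← PowerSeries.coeff_map, hg, PowerSeries.coeff_mul,
      Finset.sum_eq_single (a, 0) _ (by simp)]
    · simp
    · rintro ⟨i, j⟩ hij hne
      rw [Finset.HasAntidiagonal.mem_antidiagonal] at hij
      have : i < a := by
        rcases Nat.lt_or_ge i a with h | h
        · exact h
        · exact absurd (Prod.ext (by simp at hij ⊢; omega) (by simp at hij ⊢; omega)) hne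
      rw [PowerSeries.coeff_of_lt_order_toNat i this, zero_mul]
  obtain ⟨b, hb⟩ := h1 0
  have hb0 : b ≠ 0 := by
    rintro rfl
    simp at hb
    exact hr0 hb.symm
  have : IsAlmostIntegral R (PowerSeries.constantCoeff f) := by
    refine ⟨b, by simpa using hb0, fun n => ?_⟩
    obtain ⟨g, hg⟩ := h1 n
    refine ⟨g, ?_⟩
    rw [hg, Algebra.smul_def, hb]; simp
  exact IsIntegrallyClosed.algebraMap_eq_of_integral this.isIntegral

omit [IsDomain R] [IsNoetherianRing R] [IsIntegrallyClosed R] [IsFractionRing R F] in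
theorem mem_range_map_of_X_pow_mul_mem (n : ℕ) (f : PowerSeries F)
    (h : PowerSeries.X ^ n * f ∈ (PowerSeries.map (algebraMap R F)).range) :
    f ∈ (PowerSeries.map (algebraMap R F)).range := by
  obtain ⟨g, hg⟩ := h
  refine ⟨PowerSeries.mk fun j => PowerSeries.coeff (j + n) g, ?_⟩
  ext j
  rw [PowerSeries.coeff_map, PowerSeries.coeff_mk, ← PowerSeries.coeff_map, hg,
    PowerSeries.coeff_X_pow_mul]

/-- The ring of power series over a noetherian normal domain is completely integrally closed in
that over the field of fractions. -/
theorem mem_range_map_of_almostIntegral (f r : PowerSeries F) (hr : r ≠ 0)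
    (h : ∀ n, r * f ^ n ∈ (PowerSeries.map (algebraMap R F)).range) :
    f ∈ (PowerSeries.map (algebraMap R F)).range := by
  have key : ∀ j, ∀ f : PowerSeries F,
      (∀ n, r * f ^ n ∈ (PowerSeries.map (algebraMap R F)).range) →
      PowerSeries.coeff j f ∈ (algebraMap R F).range := by
    intro j
    induction j with
    | zero =>
      intro f h
      rw [PowerSeries.coeff_zero_eq_constantCoeff_apply]
      exact constantCoeff_mem_range_of_almostIntegral f r hr h
    | succ j ih =>
      intro f h
      obtain ⟨a, ha⟩ := constantCoeff_mem_range_of_almostIntegral f r hr h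
      have hf := PowerSeries.eq_X_mul_shift_add_const f
      set f' := PowerSeries.mk fun p => PowerSeries.coeff (p + 1) f
      -- As `a` lies in `R`, the series `r (X f')^n = r (f - a)^n` has coefficients in `R`; dividing
      -- by `X ^ n` shows that the shift `f'` inherits the hypothesis on `f`.
      have h1 := ih f' fun n => by
        refine mem_range_map_of_X_pow_mul_mem n _ ?_
        have h2 : PowerSeries.X * f' = f + PowerSeries.map (algebraMap R F)
            (PowerSeries.C (-a)) := by
          rw [PowerSeries.map_C, map_neg, ha, map_neg]
          conv_rhs => rw [hf]
          simp
        rw [mul_left_comm, ← mul_pow, h2, add_pow, Finset.mul_sum]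
        refine Subring.sum_mem _ fun m _ => ?_
        rw [← mul_assoc, ← mul_assoc]
        refine Subring.mul_mem _ (Subring.mul_mem _ (h m) ?_) (natCast_mem _ _)
        exact ⟨_, map_pow _ _ _⟩
      rwa [PowerSeries.coeff_mk] at h1
  choose g hg using fun j => key j f h
  refine ⟨PowerSeries.mk g, ?_⟩
  ext j
  rw [PowerSeries.coeff_map, PowerSeries.coeff_mk, hg]

end AlmostIntegral

/-! ### The matrix of multiplication over `F⟦t⟧` -/

section FormalCharpoly

variable {F B B₀ : Type*} [Field F] [CommRing B] [Algebra F B] [CommRing B₀] [Algebra F B₀]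

theorem exists_lift_expansion (t : B) (π : B →ₐ[F] B₀) (hker : RingHom.ker π = Ideal.span {t})
    {ι : Type*} [Fintype ι] (e : ι → B) (b : Module.Basis ι F B₀)
    (hb : ∀ i, π (e i) = b i) (a : B) : ∃ (r : ι → F) (a' : B), a = ∑ i, r i • e i + t * a' := by
  have : a - ∑ i, b.repr (π a) i • e i ∈ RingHom.ker π := by
    rw [RingHom.mem_ker, map_sub, map_sum]
    simp only [map_smul, hb, b.sum_repr, sub_self]
  rw [hker, Ideal.mem_span_singleton] at this
  obtain ⟨a', ha'⟩ := this
  exact ⟨_, a', by rw [← ha']; ring⟩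

theorem lift_independent (t : B) (π : B →ₐ[F] B₀) (hker : RingHom.ker π = Ideal.span {t})
    {ι : Type*} [Fintype ι] (e : ι → B) (b : Module.Basis ι F B₀)
    (hb : ∀ i, π (e i) = b i) (r : ι → F) (h : t ∣ ∑ i, r i • e i) : r = 0 := by
  rw [← Ideal.mem_span_singleton, ← hker, RingHom.mem_ker, map_sum] at h
  simp only [map_smul, hb] at h
  exact funext (Fintype.linearIndependent_iff.mp b.linearIndependent r h)

/-- The matrix of the multiplication by `y` on the completion of a one parameter deformation `B`
of a finite dimensional algebra `B₀`. -/
theorem exists_formal_matrix (t : B) (π : B →ₐ[F] B₀) (hker : RingHom.ker π = Ideal.span {t})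
    {ι : Type*} [Fintype ι] [DecidableEq ι] (e : ι → B) (b : Module.Basis ι F B₀)
    (hb : ∀ i, π (e i) = b i) (y : B) [Module.Finite F B₀] :
    ∃ c : Matrix ι ι (PowerSeries F),
      c.charpoly.map PowerSeries.constantCoeff = (Algebra.lmul F B₀ (π y)).charpoly ∧
      (∀ k i, Ideal.Quotient.mk (Ideal.span {t ^ k}) (y * e i) =
        ∑ j, evalTrunc t k (c i j) * Ideal.Quotient.mk _ (e j)) := by
  choose c hc using fun i =>
    exists_powerSeries_expansion t e (exists_lift_expansion t π hker e b hb) (y * e i)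
  refine ⟨Matrix.of c, ?_, fun k i => hc i k⟩
  -- The coordinates of `y * e i` form the rows of `c` but the columns of `LinearMap.toMatrix`,
  -- hence the transpose.
  rw [← Matrix.charpoly_map, ← LinearMap.charpoly_toMatrix _ b, ← Matrix.charpoly_transpose]
  congr 1
  ext i j
  rw [Matrix.transpose_apply, LinearMap.toMatrix_apply]
  have h2 := dvd_of_expansion_one t e _ _ (hc j 1)
  rw [← Ideal.mem_span_singleton, ← hker, RingHom.mem_ker, map_sub, map_sum, sub_eq_zero] at h2
  simp only [map_mul, hb, map_smul] at h2
  change _ = b.repr (π y * b j) i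
  rw [h2]
  simp [Finsupp.single_apply]

end FormalCharpoly

/-! ### Descent of power series from `F` to `R` -/

section Descent

variable {R F A B A₀ : Type*} [CommRing R] [Field F] [Algebra R F] [CommRing A] [Algebra R A]
  [CommRing B] [Algebra F B] (ψ : A →+* B)

/-- The map `A / t ^ k → B / t ^ k`. -/
noncomputable def quotPowMap (t : A) (k : ℕ) :
    A ⧸ Ideal.span {t ^ k} →+* B ⧸ Ideal.span {ψ t ^ k} :=
  Ideal.quotientMap _ ψ (by
    rw [Ideal.span_singleton_le_iff_mem, Ideal.mem_comap, map_pow]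
    exact Ideal.mem_span_singleton_self _)

theorem quotPowMap_mk (t : A) (k : ℕ) (a : A) :
    quotPowMap ψ t k (Ideal.Quotient.mk _ a) = Ideal.Quotient.mk _ (ψ a) := rfl

theorem quotPowMap_comp_evalTrunc
    (h : ψ.comp (algebraMap R A) = (algebraMap F B).comp (algebraMap R F)) (t : A) (k : ℕ)
    (f : PowerSeries R) : quotPowMap ψ t k (evalTrunc t k f) =
      evalTrunc (ψ t) k (PowerSeries.map (algebraMap R F) f) := by
  rw [mk_evalTrunc_map (algebraMap R F) ψ h]; rfl

/-- Power series over `F` with bounded denominators in `R⟦X⟧`. -/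
def boundedDenominators (R F : Type*) [CommRing R] [IsDomain R] [Field F] [Algebra R F]
    [IsFractionRing R F] : Subring (PowerSeries F) where
  carrier := {f | ∃ δ : PowerSeries R, δ ≠ 0 ∧
    PowerSeries.map (algebraMap R F) δ * f ∈ (PowerSeries.map (algebraMap R F)).range}
  mul_mem' := by
    rintro a b ⟨δ, hδ, ha⟩ ⟨δ', hδ', hb⟩
    exact ⟨δ * δ', mul_ne_zero hδ hδ', by
      rw [map_mul, mul_mul_mul_comm]; exact Subring.mul_mem _ ha hb⟩
  add_mem' := by
    rintro a b ⟨δ, hδ, ha⟩ ⟨δ', hδ', hb⟩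
    refine ⟨δ * δ', mul_ne_zero hδ hδ', ?_⟩
    rw [map_mul, mul_add, mul_right_comm, mul_assoc _ _ b]
    exact Subring.add_mem _ (Subring.mul_mem _ ha ⟨_, rfl⟩) (Subring.mul_mem _ ⟨_, rfl⟩ hb)
  one_mem' := ⟨1, one_ne_zero, 1, by simp⟩
  zero_mem' := ⟨1, one_ne_zero, 0, by simp⟩
  neg_mem' := by
    rintro a ⟨δ, hδ, ha⟩
    exact ⟨δ, hδ, by rw [mul_neg]; exact Subring.neg_mem _ ha⟩

/-- Integrality puts all powers of `f` in a finite module, so one denominator for `f` yields a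
common denominator for all its powers, and `f` is almost integral. The denominator must be assumed:
`F⟦X⟧` need not lie in the fraction field of `R⟦X⟧`. -/
theorem mem_range_map_of_isIntegral [IsDomain R] [IsNoetherianRing R] [IsIntegrallyClosed R]
    [IsFractionRing R F] (f : PowerSeries F) (h : IsIntegral (PowerSeries R) f)
    (hf : f ∈ boundedDenominators R F) : f ∈ (PowerSeries.map (algebraMap R F)).range := by
  have hinj : Function.Injective (PowerSeries.map (algebraMap R F)) :=
    PowerSeries.map_injective _ (IsFractionRing.injective R F)
  have halg : algebraMap (PowerSeries R) (PowerSeries F) = PowerSeries.map (algebraMap R F) := rfl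
  obtain ⟨δ, hδ, g, hg⟩ := hf
  obtain ⟨r, hr, hr'⟩ := h.isAlmostIntegral_of_exists_smul_mem_range
    ⟨δ, by simpa using hδ, g, by rw [Algebra.smul_def, halg, hg]⟩
  refine mem_range_map_of_almostIntegral f (PowerSeries.map (algebraMap R F) r) ?_ fun n => ?_
  · rw [Ne, map_eq_zero_iff _ hinj]
    exact nonZeroDivisors.ne_zero hr
  · obtain ⟨g, hg⟩ := hr' n
    exact ⟨g, by rw [← halg, hg, Algebra.smul_def]⟩

end Descent

/-! ### Integral equations and common denominators for expansions -/

section Core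

variable {R F A B A₀ B₀ : Type*} [CommRing R] [IsDomain R] [Field F] [Algebra R F]
  [IsFractionRing R F] [CommRing A] [Algebra R A] [CommRing B] [Algebra F B]
  [CommRing A₀] [Algebra R A₀] [CommRing B₀] [Algebra F B₀]

omit [IsDomain R] [Algebra R F] [IsFractionRing R F] [Field F] in
theorem exists_generators_mod (t : A) (π : A →ₐ[R] A₀) (hπ : Function.Surjective π)
    (hker : RingHom.ker π = Ideal.span {t}) [Module.Finite R A₀] :
    ∃ (s : ℕ) (e : Fin s → A), ∀ a, ∃ (r : Fin s → R) (a' : A), a = ∑ i, r i • e i + t * a' := by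
  obtain ⟨s, v, hv⟩ := Module.Finite.exists_fin (R := R) (M := A₀)
  choose e he using fun i => hπ (v i)
  refine ⟨s, e, fun a => ?_⟩
  have : π a ∈ Submodule.span R (Set.range v) := by rw [hv]; trivial
  obtain ⟨r, hr⟩ := (Submodule.mem_span_range_iff_exists_fun R).mp this
  have h : a - ∑ i, r i • e i ∈ RingHom.ker π := by
    rw [RingHom.mem_ker, map_sub, map_sum]
    simp only [map_smul, he, hr, sub_self]
  rw [hker, Ideal.mem_span_singleton] at h
  obtain ⟨a', ha'⟩ := h
  exact ⟨_, a', by rw [← ha']; ring⟩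

omit [IsDomain R] in
/-- A formally integral equation for `y`. -/
theorem exists_formal_integral_equation (t : A) {s : ℕ} (e : Fin s → A)
    (he : ∀ a, ∃ (r : Fin s → R) (a' : A), a = ∑ i, r i • e i + t * a') (y : A) :
    ∃ P : Polynomial (PowerSeries R), P.Monic ∧
      ∀ k, P.eval₂ (evalTrunc t k) (Ideal.Quotient.mk _ y) = 0 := by
  classical
  choose c hc using exists_powerSeries_expansion t e he
  refine ⟨(Matrix.of fun i j => c (y * e i) j).charpoly, Matrix.charpoly_monic _, fun k => ?_⟩
  have h1 := eval₂_charpoly_mul_eq_zero (evalTrunc t k) (Matrix.of fun i j => c (y * e i) j)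
    (fun i => Ideal.Quotient.mk _ (e i)) (Ideal.Quotient.mk _ y)
    (fun i => by rw [← map_mul, hc (y * e i) k]; rfl)
  -- The characteristic polynomial kills every `e i`, and `1` is a combination of them.
  rw [← mul_one (Polynomial.eval₂ _ _ _), ← map_one (Ideal.Quotient.mk _), hc 1 k, Finset.mul_sum]
  refine Finset.sum_eq_zero fun i _ => ?_
  rw [mul_left_comm, h1, mul_zero]

variable (ψ : A →+* B) (hψ : ψ.comp (algebraMap R A) = (algebraMap F B).comp (algebraMap R F))
  (hden : ∀ b : B, ∃ (r : R) (a : A), r ≠ 0 ∧ algebraMap F B (algebraMap R F r) * b = ψ a)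

include hψ hden in
omit [IsFractionRing R F] in
theorem exists_common_den {ι : Type*} [Fintype ι] (b : ι → B) :
    ∃ (r : R) (a : ι → A), r ≠ 0 ∧ ∀ i, algebraMap F B (algebraMap R F r) * b i = ψ (a i) := by
  classical
  choose r a hr ha using fun i => hden (b i)
  refine ⟨∏ i, r i, fun i => algebraMap R A (∏ j ∈ Finset.univ.erase i, r j) * a i,
    Finset.prod_ne_zero_iff.mpr fun i _ => hr i, fun i => ?_⟩
  rw [← Finset.prod_erase_mul _ _ (Finset.mem_univ i), map_mul, map_mul, mul_assoc, ha, map_mul]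
  congr 1
  exact (RingHom.congr_fun hψ _).symm

include hψ hden in
/-- Expansions with respect to a basis have bounded denominators. -/
theorem exists_expansion_den (t : A) {s : ℕ} (e : Fin s → A)
    (he : ∀ a, ∃ (r : Fin s → R) (a' : A), a = ∑ i, r i • e i + t * a')
    {ι : Type*} [Fintype ι] (ε : ι → A)
    (hε : ∀ b, ∃ (r : ι → F) (b' : B), b = ∑ i, r i • ψ (ε i) + ψ t * b') :
    ∃ δ : PowerSeries R, δ ≠ 0 ∧ ∀ a, ∃ w : ι → PowerSeries R, ∀ k,
      Ideal.Quotient.mk (Ideal.span {ψ t ^ k}) (ψ a) *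
        evalTrunc (ψ t) k (PowerSeries.map (algebraMap R F) δ) =
      ∑ i, evalTrunc (ψ t) k (PowerSeries.map (algebraMap R F) (w i)) *
        Ideal.Quotient.mk _ (ψ (ε i)) := by
  classical
  have h1 : ∃ (r : R) (ρ : Fin s → ι → R) (a : Fin s → A), r ≠ 0 ∧ ∀ j,
      ψ (algebraMap R A r * e j) = ψ (∑ i, algebraMap R A (ρ j i) * ε i + t * a j) := by
    choose q b hq using fun j => hε (ψ (e j))
    obtain ⟨r₁, a, hr₁, ha⟩ := exists_common_den ψ hψ hden b
    obtain ⟨⟨r₂, hr₂⟩, hr₂'⟩ := IsLocalization.exist_integer_multiples_of_finite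
      (nonZeroDivisors R) (fun x : Fin s × ι => q x.1 x.2)
    choose ρ hρ using hr₂'
    refine ⟨r₁ * r₂, fun j i => r₁ * ρ (j, i), fun j => algebraMap R A r₂ * a j,
      mul_ne_zero hr₁ (nonZeroDivisors.ne_zero hr₂), fun j => ?_⟩
    have hψ' : ∀ x, ψ (algebraMap R A x) = algebraMap F B (algebraMap R F x) :=
      RingHom.congr_fun hψ
    simp only [map_mul, map_add, map_sum, hψ', hρ, hq j, ← ha, mul_add, Finset.mul_sum,
      Algebra.smul_def]
    congr 1
    · exact Finset.sum_congr rfl fun i _ => by ring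
    · ring
  obtain ⟨r, ρ, a, hr, hra⟩ := h1
  choose w hw using exists_powerSeries_expansion t e he
  -- Inserting the expansions of the `a j` turns `r e_j = ∑ ρ_ji ε_i + t a_j` into `N e = ρ ε`. By
  -- Cramer's rule `δ = det N` is a common denominator; it is nonzero because its constant term is a
  -- power of `r`.
  set N : Matrix (Fin s) (Fin s) (PowerSeries R) :=
    Matrix.scalar _ (PowerSeries.C r) - (PowerSeries.X : PowerSeries R) • Matrix.of fun j => w (a j)
    with hN
  set ρ' : Matrix (Fin s) ι (PowerSeries R) := Matrix.of fun j i => PowerSeries.C (ρ j i) with hρ'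
  set φ : ∀ k, PowerSeries R →+* B ⧸ Ideal.span {ψ t ^ k} :=
    fun k => (quotPowMap ψ t k).comp (evalTrunc t k) with hφ
  have hφ' : ∀ k x, evalTrunc (ψ t) k (PowerSeries.map (algebraMap R F) x) = φ k x :=
    fun k x => (quotPowMap_comp_evalTrunc ψ hψ t k x).symm
  have key : ∀ k, (N.map (φ k)).mulVec (fun j => Ideal.Quotient.mk _ (ψ (e j))) =
      (ρ'.map (φ k)).mulVec (fun i => Ideal.Quotient.mk _ (ψ (ε i))) := by
    intro k
    ext j
    have h2 := congrArg (quotPowMap ψ t k) (hw (a j) k)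
    simp only [map_sum, map_mul, quotPowMap_mk] at h2
    have h3 := congrArg (Ideal.Quotient.mk (Ideal.span {ψ t ^ k})) (hra j)
    have hC : ∀ x, φ k (PowerSeries.C x) = Ideal.Quotient.mk _ (ψ (algebraMap R A x)) := by
      intro x
      simp only [hφ, RingHom.comp_apply, evalTrunc_C, quotPowMap_mk]
    have hX : φ k PowerSeries.X = Ideal.Quotient.mk _ (ψ t) := by
      simp only [hφ, RingHom.comp_apply, evalTrunc_X, quotPowMap_mk]
    simp only [map_add, map_mul, map_sum] at h3
    rw [h2, Finset.mul_sum, ← sub_eq_iff_eq_add] at h3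
    have h4 : (N.map (φ k)) = Matrix.scalar _ (φ k (PowerSeries.C r)) -
        (φ k PowerSeries.X) • (Matrix.of fun j => w (a j)).map (φ k) := by
      rw [hN]
      ext i j
      simp [Matrix.diagonal_apply, apply_ite (φ k)]
    rw [h4, Matrix.sub_mulVec, Matrix.smul_mulVec, Pi.sub_apply, Matrix.scalar_apply,
      Matrix.mulVec_diagonal, Pi.smul_apply, smul_eq_mul, hC, hX]
    simp only [Matrix.mulVec, dotProduct, Matrix.map_apply, Matrix.of_apply, Finset.mul_sum,
      hρ', hC]
    exact h3
  refine ⟨N.det, fun h => ?_, fun a' => ?_⟩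
  · have h5 := congrArg PowerSeries.constantCoeff h
    rw [RingHom.map_det, map_zero] at h5
    have h6 : PowerSeries.constantCoeff.mapMatrix N = Matrix.scalar _ r := by
      rw [hN]
      ext i j
      simp [Matrix.diagonal_apply, apply_ite PowerSeries.constantCoeff]
    rw [h6] at h5
    simp at h5
    exact hr h5.1
  · refine ⟨Matrix.vecMul (w a') (N.adjugate * ρ'), fun k => ?_⟩
    simp only [hφ']
    have h7 := congrArg ((N.map (φ k)).adjugate).mulVec (key k)
    rw [Matrix.mulVec_mulVec, Matrix.adjugate_mul, Matrix.smul_mulVec, Matrix.one_mulVec,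
      Matrix.mulVec_mulVec, ← RingHom.mapMatrix_apply, ← RingHom.map_adjugate, ← RingHom.map_det,
      RingHom.mapMatrix_apply, ← Matrix.map_mul] at h7
    have h2 := congrArg (quotPowMap ψ t k) (hw a' k)
    simp only [map_sum, map_mul, quotPowMap_mk] at h2
    rw [h2]
    calc _ = dotProduct (fun j => φ k (w a' j))
          (φ k N.det • fun j => Ideal.Quotient.mk _ (ψ (e j))) := by
          rw [dotProduct_smul, smul_eq_mul, mul_comm]; rfl
      _ = _ := by
          rw [h7, Matrix.dotProduct_mulVec]
          refine Finset.sum_congr rfl fun i _ => ?_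
          congr 1
          exact (RingHom.map_vecMul (φ k) (N.adjugate * ρ') (w a') i).symm

end Core

/-! ### Cayley–Hamilton for a one-parameter deformation -/

section Core

variable {R F A B A₀ B₀ : Type*} [CommRing R] [IsDomain R] [Field F] [Algebra R F]
  [IsFractionRing R F] [CommRing A] [Algebra R A] [CommRing B] [Algebra F B]
  [CommRing A₀] [Algebra R A₀] [CommRing B₀] [Algebra F B₀]

/-- The formal characteristic polynomial of `y` has coefficients in `R⟦X⟧`. -/
theorem exists_formal_charpoly [IsNoetherianRing R] [IsIntegrallyClosed R]
    (ψ : A →+* B) (hψ : ψ.comp (algebraMap R A) = (algebraMap F B).comp (algebraMap R F))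
    (hden : ∀ b : B, ∃ (r : R) (a : A), r ≠ 0 ∧ algebraMap F B (algebraMap R F r) * b = ψ a)
    (t : A) (ht : ∀ b, ψ t * b = 0 → b = 0)
    (π : A →ₐ[R] A₀) (hπ : Function.Surjective π) (hker : RingHom.ker π = Ideal.span {t})
    [Module.Finite R A₀] (π' : B →ₐ[F] B₀) (hπ' : Function.Surjective π')
    (hker' : RingHom.ker π' = Ideal.span {ψ t}) [Module.Finite F B₀] (y : A) :
    ∃ χ : Polynomial (PowerSeries R), χ.Monic ∧
      (χ.map (PowerSeries.constantCoeff (R := R))).map (algebraMap R F) =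
        (Algebra.lmul F B₀ (π' (ψ y))).charpoly ∧
      ∀ k, quotPowMap ψ t k (χ.eval₂ (evalTrunc t k) (Ideal.Quotient.mk _ y)) = 0 := by
  classical
  obtain ⟨s, e, he⟩ := exists_generators_mod t π hπ hker
  obtain ⟨ι, _, ε, b, hb⟩ : ∃ (ι : Type) (_ : Fintype ι) (ε : ι → A)
      (b : Module.Basis ι F B₀), ∀ i, π' (ψ (ε i)) = b i := by
    -- A basis of `B₀` with lifts in `A`: the denominators of lifts to `B` become units in `F`, so
    -- clearing them only rescales the basis vectors.
    let b₀ := Module.finBasis F B₀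
    choose l hl using fun i => hπ' (b₀ i)
    choose r ε hr hε using fun i => hden (l i)
    have hr' : ∀ i, IsUnit (algebraMap R F (r i)) := fun i =>
      (IsUnit.mk0 _ ((map_ne_zero_iff _ (IsFractionRing.injective R F)).mpr (hr i)))
    refine ⟨_, inferInstance, ε, b₀.isUnitSMul hr', fun i => ?_⟩
    rw [Module.Basis.isUnitSMul_apply, ← hε, ← Algebra.smul_def, map_smul, hl]
  obtain ⟨c, hc, hcy⟩ := exists_formal_matrix (ψ t) π' hker' (fun i => ψ (ε i)) b hb (ψ y)
  have hexp := exists_lift_expansion (ψ t) π' hker' (fun i => ψ (ε i)) b hb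
  have hind := lift_independent (ψ t) π' hker' (fun i => ψ (ε i)) b hb
  have huniq := powerSeries_expansion_unique (R := F) (ψ t) (fun i => ψ (ε i)) ht hind
  have hmapinj : Function.Injective (PowerSeries.map (algebraMap R F)) :=
    PowerSeries.map_injective _ (IsFractionRing.injective R F)
  have hcy' : ∀ k i, Ideal.Quotient.mk (Ideal.span {ψ t ^ k}) (ψ y) * Ideal.Quotient.mk _ (ψ (ε i))
      = ∑ j, evalTrunc (ψ t) k (c i j) * Ideal.Quotient.mk _ (ψ (ε j)) :=
    fun k i => by rw [← map_mul, hcy k i]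
  -- integrality
  have hint : ∀ j, IsIntegral (PowerSeries R) (c.charpoly.coeff j) := by
    obtain ⟨P, hP, hPy⟩ := exists_formal_integral_equation t e he y
    -- By uniqueness of expansions the monic equation `P` of `y` holds for the matrix `c`. Then
    -- `c.charpoly` divides a power of `P`, and a monic divisor of a monic polynomial over `R⟦X⟧`
    -- has integral coefficients.
    have h0 : Polynomial.aeval c (P.map (PowerSeries.map (algebraMap R F))) = 0 := by
      ext1 i j
      refine congrFun (huniq ((Polynomial.aeval c
        (P.map (PowerSeries.map (algebraMap R F)))) i) fun k => ?_) j
      rw [← eval₂_mul_eq_sum_aeval (evalTrunc (ψ t) k) c _ _ (hcy' k)]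
      have h1 := congrArg (quotPowMap ψ t k) (hPy k)
      rw [Polynomial.hom_eval₂, map_zero, quotPowMap_mk] at h1
      rw [Polynomial.eval₂_map]
      have h2 : (evalTrunc (ψ t) k).comp (PowerSeries.map (algebraMap R F)) =
          (quotPowMap ψ t k).comp (evalTrunc t k) :=
        RingHom.ext fun x => (quotPowMap_comp_evalTrunc ψ hψ t k x).symm
      rw [h2, h1, zero_mul]
    have h3 := charpoly_dvd_pow_of_aeval_eq_zero _ _ h0
    rw [← Polynomial.map_pow] at h3
    exact Polynomial.isIntegral_coeff_of_dvd _ _ (hP.pow _) (Matrix.charpoly_monic _) h3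
  -- bounded denominators
  have hbd : ∀ j, c.charpoly.coeff j ∈ boundedDenominators R F := by
    obtain ⟨δ, hδ, hδ'⟩ := exists_expansion_den ψ hψ hden t e he ε hexp
    have h1 : ∀ i j, c i j ∈ boundedDenominators R F := by
      intro i j
      refine ⟨δ, hδ, ?_⟩
      obtain ⟨w, hw⟩ := hδ' (y * ε i)
      have h2 := huniq (fun l => PowerSeries.map (algebraMap R F) δ * c i l -
        PowerSeries.map (algebraMap R F) (w l)) fun k => by
          simp only [map_sub, map_mul, sub_mul, Finset.sum_sub_distrib, mul_assoc]
          rw [← Finset.mul_sum, ← hcy' k i, ← map_mul, ← map_mul, ← hw k, mul_comm, sub_self]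
      have h3 := congrFun h2 j
      rw [Pi.zero_apply, sub_eq_zero] at h3
      exact ⟨w j, h3.symm⟩
    -- Bounded denominators form a subring, so they pass from the entries of `c` to the coefficients
    -- of its characteristic polynomial.
    let c' : Matrix ι ι (boundedDenominators R F) := fun i j => ⟨c i j, h1 i j⟩
    have h2 : c = c'.map (boundedDenominators R F).subtype := rfl
    intro j
    rw [h2, Matrix.charpoly_map, Polynomial.coeff_map]
    exact (c'.charpoly.coeff j).2
  have hlift : c.charpoly ∈ Polynomial.lifts (PowerSeries.map (algebraMap R F)) := by
    rw [Polynomial.lifts_iff_coeff_lifts]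
    exact fun j => mem_range_map_of_isIntegral _ (hint j) (hbd j)
  obtain ⟨χ, hχ⟩ := (Polynomial.mem_lifts _).mp hlift
  refine ⟨χ, Polynomial.monic_of_injective hmapinj (hχ ▸ Matrix.charpoly_monic _), ?_, fun k => ?_⟩
  · rw [← hc, ← hχ, Polynomial.map_map, Polynomial.map_map]
    congr 1
  · rw [Polynomial.hom_eval₂, quotPowMap_mk]
    have h2 : (quotPowMap ψ t k).comp (evalTrunc t k) =
        (evalTrunc (ψ t) k).comp (PowerSeries.map (algebraMap R F)) :=
      RingHom.ext fun x => quotPowMap_comp_evalTrunc ψ hψ t k x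
    rw [h2, ← Polynomial.eval₂_map, hχ]
    obtain ⟨v, hv⟩ := exists_powerSeries_expansion (ψ t) _ hexp 1
    rw [← mul_one (Polynomial.eval₂ _ _ _), ← map_one (Ideal.Quotient.mk _), hv k, Finset.mul_sum]
    refine Finset.sum_eq_zero fun i _ => ?_
    rw [mul_left_comm, eval₂_charpoly_mul_eq_zero _ c _ _ (hcy' k), mul_zero]

open TensorProduct in
/-- Let `A` be a one parameter deformation of a finite algebra `A₀` over a normal domain `R`. If
`R`-torsion modulo high powers of the parameter `t` vanishes modulo `t`, then multiplication by an
element of `A₀` satisfies its own generic characteristic polynomial. -/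
theorem aeval_charpoly_eq_zero_of_deformation [IsNoetherianRing R] [IsIntegrallyClosed R]
    (t : A) (ht : ∀ a, t * a = 0 → a = 0)
    (htor : ∃ k, ∀ r : R, r ≠ 0 → ∀ a, t ^ k ∣ algebraMap R A r * a → t ∣ a)
    (π : A →ₐ[R] A₀) (hπ : Function.Surjective π) (hker : RingHom.ker π = Ideal.span {t})
    [Module.Finite R A₀] (y : A₀) :
    ∃ χ : Polynomial R, χ.Monic ∧
      χ.map (algebraMap R F) = ((Algebra.lmul R A₀ y).baseChange F).charpoly ∧
      Polynomial.aeval y χ = 0 := by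
  obtain ⟨y, rfl⟩ := hπ y
  let ψ : A →+* F ⊗[R] A := (Algebra.TensorProduct.includeRight : A →ₐ[R] F ⊗[R] A).toRingHom
  have hψ1 : ∀ a, ψ a = 1 ⊗ₜ a := fun a => rfl
  have hψ : ψ.comp (algebraMap R A) = (algebraMap F (F ⊗[R] A)).comp (algebraMap R F) := by
    ext r
    simp [hψ1, Algebra.algebraMap_eq_smul_one, Algebra.TensorProduct.one_def]
  have hden : ∀ b : F ⊗[R] A, ∃ (r : R) (a : A), r ≠ 0 ∧
      algebraMap F (F ⊗[R] A) (algebraMap R F r) * b = ψ a := by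
    intro b
    obtain ⟨⟨a, r⟩, h⟩ := IsLocalizedModule.surj (nonZeroDivisors R) (TensorProduct.mk R F A 1) b
    refine ⟨r, a, nonZeroDivisors.ne_zero r.2, ?_⟩
    rw [← Algebra.smul_def, algebraMap_smul]
    exact h
  have : Module.Flat R F := IsLocalization.flat F (nonZeroDivisors R)
  have htψ : ∀ b, ψ t * b = 0 → b = 0 := by
    have h1 : Function.Injective (LinearMap.lTensor F (LinearMap.mulLeft R t)) :=
      Module.Flat.lTensor_preserves_injective_linearMap _
        ((injective_iff_map_eq_zero _).mpr ht)
    intro b hb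
    refine (injective_iff_map_eq_zero _).mp h1 b ?_
    rw [← hb]
    clear hb
    induction b using TensorProduct.induction_on with
    | zero => simp
    | tmul f a => simp [hψ1]
    | add x y hx hy => rw [map_add, hx, hy, mul_add]
  obtain ⟨χ, hχ, hχ1, hχ2⟩ := exists_formal_charpoly ψ hψ hden t htψ π hπ hker
    (Algebra.TensorProduct.map (AlgHom.id F F) π)
    (by
      have := LinearMap.lTensor_surjective F (g := π.toLinearMap) hπ
      exact this)
    (by
      have := Algebra.TensorProduct.lTensor_ker (A := F) π hπ
      rw [hker, Ideal.map_span, Set.image_singleton] at this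
      exact this) y
  refine ⟨χ.map PowerSeries.constantCoeff, hχ.map _, ?_, ?_⟩
  · rw [hχ1]
    congr 1
    ext a
    simp [hψ1]
  · obtain ⟨k, hk⟩ := htor
    -- `u` represents the lifted polynomial at `y`. It vanishes over `F`, so some nonzero element of
    -- `R` multiplies it into `t ^ (k + 1) A`, and `htor` gives `t ∣ u`. The exponent `k + 1` is
    -- positive even if `k = 0`, so reduction to `A₀` factors through the quotient.
    obtain ⟨u, hu⟩ := Ideal.Quotient.mk_surjective
      (χ.eval₂ (evalTrunc t (k + 1)) (Ideal.Quotient.mk _ y))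
    have h1 := hχ2 (k + 1)
    rw [← hu, quotPowMap_mk, Ideal.Quotient.eq_zero_iff_mem, Ideal.mem_span_singleton] at h1
    obtain ⟨b, hb⟩ := h1
    obtain ⟨r, a, hr, ha⟩ := hden b
    have h2 : ψ (algebraMap R A r * u - t ^ (k + 1) * a) = 0 := by
      rw [map_sub, map_mul, map_mul, map_pow, hb, ← ha]
      have := RingHom.congr_fun hψ r
      simp only [RingHom.comp_apply] at this
      rw [this]
      ring
    obtain ⟨r', hr'⟩ := IsLocalizedModule.exists_of_eq (S := nonZeroDivisors R)
      (f := TensorProduct.mk R F A 1) (h2.trans (map_zero ψ).symm)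
    have h3 : t ∣ u := by
      refine hk (r' * r) (mul_ne_zero (nonZeroDivisors.ne_zero r'.2) hr) u ?_
      change (r' : R) • _ = (r' : R) • (0 : A) at hr'
      rw [smul_zero, Algebra.smul_def, mul_sub, sub_eq_zero, ← mul_assoc, ← map_mul] at hr'
      rw [hr']
      exact Dvd.intro_left (algebraMap R A r' * t * a) (by ring)
    have hπt : π t = 0 := by
      rw [← RingHom.mem_ker, hker]; exact Ideal.mem_span_singleton_self t
    let θ : A ⧸ Ideal.span {t ^ (k + 1)} →+* A₀ := Ideal.Quotient.lift _ π.toRingHom (by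
      intro a ha
      obtain ⟨a', rfl⟩ := Ideal.mem_span_singleton.mp ha
      simp [hπt])
    have h4 : θ (Ideal.Quotient.mk _ u) = 0 := by
      obtain ⟨a', rfl⟩ := h3
      change π (t * a') = 0
      rw [map_mul, hπt, zero_mul]
    rw [hu, Polynomial.hom_eval₂] at h4
    rw [Polynomial.aeval_def, Polynomial.eval₂_map, ← h4]
    congr 1
    ext f
    change _ = π (Polynomial.aeval t (PowerSeries.trunc (k + 1) f))
    rw [← Polynomial.aeval_algHom_apply, hπt]
    simp [Polynomial.aeval_def, Polynomial.eval₂_at_zero, PowerSeries.coeff_trunc]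

end Core

/-! ### Torsion-free modules inside free modules -/

section TorsionFree

/-- A finite torsion free module over a domain embeds in a free module of finite rank. -/
theorem exists_injective_pi_of_torsionFree (S M : Type*) [CommRing S] [IsDomain S]
    [AddCommGroup M] [Module S M] [Module.Finite S M]
    (h : ∀ (s : S) (m : M), s • m = 0 → s = 0 ∨ m = 0) :
    ∃ (n : ℕ) (f : M →ₗ[S] (Fin n → S)), Function.Injective f := by
  classical
  let K := FractionRing S
  let g : M →ₗ[S] LocalizedModule (nonZeroDivisors S) M := LocalizedModule.mkLinearMap _ _
  have hg : Function.Injective g := by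
    refine (injective_iff_map_eq_zero _).mpr fun m hm => ?_
    obtain ⟨s, hs⟩ := IsLocalizedModule.exists_of_eq (S := nonZeroDivisors S)
      (hm.trans (map_zero g).symm)
    rw [smul_zero] at hs
    exact (h _ _ hs).resolve_left (nonZeroDivisors.ne_zero s.2)
  have : Module.Finite K (LocalizedModule (nonZeroDivisors S) M) :=
    Module.Finite.of_isLocalizedModule (nonZeroDivisors S) g
  let b := Module.finBasis K (LocalizedModule (nonZeroDivisors S) M)
  obtain ⟨s, v, hv⟩ := Module.Finite.exists_fin (R := S) (M := M)
  obtain ⟨⟨r, hr⟩, hr'⟩ := IsLocalization.exist_integer_multiples_of_finite (S := K)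
      (nonZeroDivisors S) (fun x : Fin s × Fin _ => b.repr (g (v x.1)) x.2)
  have hinj : Function.Injective (Algebra.linearMap S K) := IsFractionRing.injective S K
  -- Multiplying the coordinates over `K` by a common denominator `r` of the generators makes them
  -- land in `S`.
  let f₀ : ∀ i, M →ₗ[S] K := fun i =>
    r • ((Finsupp.lapply i ∘ₗ b.repr.toLinearMap).restrictScalars S ∘ₗ g)
  have hf₀ : ∀ i m, f₀ i m ∈ LinearMap.range (Algebra.linearMap S K) := by
    intro i m
    have hm : m ∈ Submodule.span S (Set.range v) := by rw [hv]; trivial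
    have : Submodule.span S (Set.range v) ≤
        (LinearMap.range (Algebra.linearMap S K)).comap (f₀ i) := by
      rw [Submodule.span_le]
      rintro _ ⟨j, rfl⟩
      obtain ⟨x, hx⟩ := hr' (j, i)
      exact ⟨x, hx⟩
    exact this hm
  let f : M →ₗ[S] (Fin _ → S) := LinearMap.pi fun i =>
    (LinearEquiv.ofInjective _ hinj).symm.toLinearMap ∘ₗ (f₀ i).codRestrict _ (hf₀ i)
  refine ⟨_, f, (injective_iff_map_eq_zero _).mpr fun m hm => ?_⟩
  have h1 : ∀ i, f₀ i m = 0 := by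
    intro i
    have := congrFun hm i
    simp only [f, LinearMap.pi_apply, LinearMap.comp_apply, LinearEquiv.coe_coe, Pi.zero_apply,
      LinearEquiv.map_eq_zero_iff] at this
    exact congrArg Subtype.val this
  have h2 : g m = 0 := by
    rw [← b.repr.map_eq_zero_iff]
    ext i
    have := h1 i
    change r • b.repr (g m) i = 0 at this
    rw [Algebra.smul_def, mul_eq_zero] at this
    exact this.resolve_left ((map_ne_zero_iff _ (IsFractionRing.injective S K)).mpr
      (nonZeroDivisors.ne_zero hr))
  exact (map_eq_zero_iff _ hg).mp h2

end TorsionFree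

/-! ### Artin–Rees bound for `R`-torsion modulo powers of `X` -/

section Artin

variable {R : Type*} [CommRing R] [IsDomain R] [IsNoetherianRing R]

/-- In a free `R[X]`-module, `X ^ n ∣ r v` with a nonzero constant `r` forces `X ^ n ∣ v`,
coefficient by coefficient. Embed `M` in a free module; Artin–Rees converts divisibility by a high
power of `X` there into divisibility by `X` within `M`. -/
theorem exists_pow_dvd_of_finite (M : Type*) [AddCommGroup M] [Module (Polynomial R) M]
    [Module.Finite (Polynomial R) M]
    (h : ∀ (s : Polynomial R) (m : M), s • m = 0 → s = 0 ∨ m = 0) :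
    ∃ k, ∀ r : R, r ≠ 0 → ∀ m m' : M, Polynomial.C r • m = (Polynomial.X ^ k : Polynomial R) • m' →
      ∃ m'', m = (Polynomial.X : Polynomial R) • m'' := by
  obtain ⟨n, f, hf⟩ := exists_injective_pi_of_torsionFree (Polynomial R) M h
  obtain ⟨k, hk⟩ := (Ideal.span {(Polynomial.X : Polynomial R)}).exists_pow_inf_eq_pow_smul
    (LinearMap.range f)
  refine ⟨k + 1, fun r hr m m' hm => ?_⟩
  have h1 : ∀ i, (Polynomial.X : Polynomial R) ^ (k + 1) ∣ f m i := by
    intro i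
    have h2 := congrFun (congrArg f hm) i
    rw [map_smul, map_smul, Pi.smul_apply, Pi.smul_apply, smul_eq_mul, smul_eq_mul] at h2
    rw [Polynomial.X_pow_dvd_iff]
    intro d hd
    have h3 := congrArg (fun p => Polynomial.coeff p d) h2
    simp only [Polynomial.coeff_C_mul] at h3
    rw [Polynomial.coeff_X_pow_mul', if_neg (by omega)] at h3
    exact (mul_eq_zero.mp h3).resolve_left hr
  choose q hq using h1
  have h4 : f m ∈ Ideal.span {(Polynomial.X : Polynomial R)} ^ (k + 1) •
      (⊤ : Submodule (Polynomial R) (Fin n → Polynomial R)) ⊓ LinearMap.range f := by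
    refine ⟨?_, ⟨m, rfl⟩⟩
    have : f m = (Polynomial.X : Polynomial R) ^ (k + 1) • q := funext hq
    rw [this]
    exact Submodule.smul_mem_smul (Ideal.pow_mem_pow (Ideal.mem_span_singleton_self _) _) trivial
  rw [hk (k + 1) (by omega), Nat.add_sub_cancel_left, pow_one,
    Submodule.ideal_span_singleton_smul] at h4
  obtain ⟨_, ⟨_, ⟨m'', rfl⟩⟩, h5⟩ := h4
  refine ⟨m'', hf ?_⟩
  rw [map_smul]
  exact h5.symm

end Artin

/-! ### The same bound near `t = 0`, by Zariski's main theorem -/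

section QuasiFinite

variable {R A A₀ : Type*} [CommRing R] [CommRing A] [Algebra R A] [Algebra (Polynomial R) A]
  [IsScalarTower R (Polynomial R) A] [Algebra.FiniteType (Polynomial R) A]

/-- Over a prime containing `X` the terms `X * a'` die in the fiber, which is therefore spanned by
the images of the `e i`. -/
theorem quasiFiniteAt_of_finite_mod
    {s : ℕ} (e : Fin s → A) (he : ∀ a, ∃ (r : Fin s → R) (a' : A),
      a = ∑ i, r i • e i + algebraMap (Polynomial R) A Polynomial.X * a')
    (p : Ideal A) [p.IsPrime] (hp : algebraMap (Polynomial R) A Polynomial.X ∈ p) :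
    Algebra.QuasiFiniteAt (Polynomial R) p := by
  let q : PrimeSpectrum A := ⟨p, inferInstance⟩
  let P := q.comap (algebraMap (Polynomial R) A)
  let e' := PrimeSpectrum.preimageHomeomorphFiber (Polynomial R) A P
  have hfin : Module.Finite P.asIdeal.ResidueField (P.asIdeal.Fiber A) := by
    classical
    refine ⟨⟨Finset.univ.image fun i => (1 : P.asIdeal.ResidueField) ⊗ₜ[Polynomial R] e i, ?_⟩⟩
    rw [eq_top_iff]
    rintro x -
    induction x using TensorProduct.induction_on with
    | zero => exact Submodule.zero_mem _
    | add x y hx hy => exact Submodule.add_mem _ hx hy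
    | tmul c a =>
      obtain ⟨r, a', rfl⟩ := he a
      have h0 : c ⊗ₜ[Polynomial R] (algebraMap (Polynomial R) A Polynomial.X * a') = 0 := by
        rw [← Algebra.smul_def, ← TensorProduct.smul_tmul, Algebra.smul_def]
        have : algebraMap (Polynomial R) P.asIdeal.ResidueField Polynomial.X = 0 := by
          rw [Ideal.algebraMap_residueField_eq_zero]
          exact hp
        rw [this, zero_mul, TensorProduct.zero_tmul]
      rw [TensorProduct.tmul_add, h0, add_zero, TensorProduct.tmul_sum]
      refine Submodule.sum_mem _ fun i _ => ?_
      have h1 : c ⊗ₜ[Polynomial R] (r i • e i) =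
          (c * algebraMap _ _ (Polynomial.C (r i))) •
            ((1 : P.asIdeal.ResidueField) ⊗ₜ[Polynomial R] e i) := by
        rw [TensorProduct.smul_tmul', smul_eq_mul, mul_one, mul_comm, ← Algebra.smul_def,
          TensorProduct.smul_tmul]
        congr 1
        rw [← Polynomial.algebraMap_eq, algebraMap_smul]
      rw [h1]
      exact Submodule.smul_mem _ _ (Submodule.subset_span (by simp))
  have : Algebra.QuasiFiniteAt P.asIdeal.ResidueField (e' ⟨q, rfl⟩).asIdeal := inferInstance
  have : q.asIdeal.LiesOver P.asIdeal := ⟨rfl⟩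
  exact .of_quasiFiniteAt_residueField P.asIdeal q.asIdeal (e' ⟨q, rfl⟩).asIdeal
      congr($(e'.symm_apply_apply ⟨q, rfl⟩).1.asIdeal)

/-- `A` need not be finite over `R[X]`. It is quasi-finite at every prime containing `t`, so by
Zariski's main theorem it agrees, after inverting some `x` outside the prime, with a finite
subalgebra, where Artin–Rees applies. Finitely many such `x` cover `t = 0`, and the largest of their
exponents works. -/
theorem exists_pow_dvd_of_torsionFree [IsDomain R] [IsNoetherianRing R]
    (htf : ∀ (s : Polynomial R) (a : A), s • a = 0 → s = 0 ∨ a = 0)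
    {s : ℕ} (e : Fin s → A) (he : ∀ a, ∃ (r : Fin s → R) (a' : A),
      a = ∑ i, r i • e i + algebraMap (Polynomial R) A Polynomial.X * a') :
    ∃ k, ∀ r : R, r ≠ 0 → ∀ a : A,
      algebraMap (Polynomial R) A Polynomial.X ^ k ∣ algebraMap R A r * a →
        algebraMap (Polynomial R) A Polynomial.X ∣ a := by
  set t := algebraMap (Polynomial R) A Polynomial.X with ht
  -- `Good x k`: the exponent `k` works after inverting `x`.
  let Good : A → ℕ → Prop := fun x k => ∀ r : R, r ≠ 0 → ∀ a : A,
    t ^ k ∣ algebraMap R A r * a → ∃ N, t ∣ x ^ N * a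
  have hlocal : ∀ p : Ideal A, p.IsPrime → t ∈ p → ∃ x ∉ p, ∃ k, Good x k := by
    intro p hp htp
    have := quasiFiniteAt_of_finite_mod e he p htp
    obtain ⟨S', hS', x, hx, hbij⟩ :=
      Algebra.QuasiFiniteAt.exists_fg_and_exists_notMem_and_awayMap_bijective
        (R := Polynomial R) p
    have : Module.Finite (Polynomial R) S' := ⟨(Submodule.fg_top _).mpr hS'⟩
    obtain ⟨k, hk⟩ := exists_pow_dvd_of_finite S' fun s m hsm => by
      have := htf s m (congrArg Subtype.val hsm)
      simpa using this
    have hsurj : ∀ a : A, ∃ n, ∀ m ≥ n, x.1 ^ m * a ∈ S' := by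
      intro a
      obtain ⟨b, n, hn⟩ := (Localization.awayMap_surjective_iff).mp hbij.2 a
      refine ⟨n, fun m hm => ?_⟩
      obtain ⟨l, rfl⟩ := Nat.exists_eq_add_of_le hm
      have hn' : b.1 = x.1 ^ n * a := hn
      rw [add_comm, pow_add, mul_assoc, ← hn']
      exact S'.mul_mem (S'.pow_mem x.2 l) b.2
    refine ⟨x, hx, k, fun r hr a ⟨b, hb⟩ => ?_⟩
    obtain ⟨n₁, h₁⟩ := hsurj a
    obtain ⟨n₂, h₂⟩ := hsurj b
    obtain ⟨c, hc⟩ := hk r hr ⟨_, h₁ (n₁ + n₂) (by omega)⟩ ⟨_, h₂ (n₁ + n₂) (by omega)⟩ (by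
      apply Subtype.ext
      change Polynomial.C r • (_ * a) = (Polynomial.X ^ k : Polynomial R) • (_ * b)
      rw [← Polynomial.algebraMap_eq, algebraMap_smul, Algebra.smul_def, Algebra.smul_def,
        mul_left_comm, hb, map_pow]
      ring)
    refine ⟨n₁ + n₂, c, ?_⟩
    have := congrArg Subtype.val hc
    change _ = (Polynomial.X : Polynomial R) • (c : A) at this
    rw [Algebra.smul_def] at this
    exact this
  have htop : Ideal.span {x | ∃ k, Good x k} ⊔ Ideal.span {t} = ⊤ := by
    by_contra hne
    obtain ⟨m, hm, hle⟩ := Ideal.exists_le_maximal _ hne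
    obtain ⟨x, hx, k, hk⟩ := hlocal m hm.isPrime
      (hle (Ideal.mem_sup_right (Ideal.mem_span_singleton_self t)))
    exact hx (hle (Ideal.mem_sup_left (Ideal.subset_span ⟨k, hk⟩)))
  obtain ⟨T, hT, hT'⟩ : ∃ T : Finset A, (∀ x ∈ T, ∃ k, Good x k) ∧
      Ideal.span (T : Set A) ⊔ Ideal.span {t} = ⊤ := by
    rw [Ideal.eq_top_iff_one, Submodule.mem_sup] at htop
    obtain ⟨y, hy, z, hz, hyz⟩ := htop
    obtain ⟨T, hT, hyT⟩ := Submodule.mem_span_finite_of_mem_span hy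
    exact ⟨T, hT, (Ideal.eq_top_iff_one _).mpr (hyz ▸ Submodule.add_mem_sup hyT hz)⟩
  choose! κ hκ using hT
  refine ⟨T.sup κ, fun r hr a ha => ?_⟩
  -- The ideal `(t : a)` contains `t` and a power of each `x` in `T`, so its radical is the unit
  -- ideal, and then so is the ideal itself.
  let 𝔞 : Ideal A := (Ideal.span {t}).colon {a}
  have h1 : Ideal.span (T : Set A) ⊔ Ideal.span {t} ≤ 𝔞.radical := by
    refine sup_le (Ideal.span_le.mpr fun x hx => ?_) ?_
    · obtain ⟨N, hN⟩ := hκ x hx r hr a ((pow_dvd_pow t (Finset.le_sup hx)).trans ha)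
      exact ⟨N, by simpa [𝔞, Submodule.mem_colon_singleton, Ideal.mem_span_singleton] using hN⟩
    · rw [Ideal.span_singleton_le_iff_mem]
      exact ⟨1, by simp [𝔞, Submodule.mem_colon_singleton, Ideal.mem_span_singleton]⟩
  rw [hT', top_le_iff, Ideal.radical_eq_top, Ideal.eq_top_iff_one] at h1
  simpa [𝔞, Submodule.mem_colon_singleton, Ideal.mem_span_singleton] using h1

end QuasiFinite

/-! ### `R[t]`-torsion in the family, and its special fiber -/

section Torsion

/-- `A` contains a polynomial ring in `m` variables whose nonzero elements are nonzerodivisors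
on `A`. For an algebra of finite type of dimension `m` this means that all of its associated primes
have dimension `m`. -/
def HasRegularPolynomialSubring (L : Type*) [Field L] (m : ℕ) (A : Type*) [CommRing A]
    [Algebra L A] : Prop :=
  ∃ φ : MvPolynomial (Fin m) L →ₐ[L] A, ∀ s, s ≠ 0 → ∀ a, φ s * a = 0 → a = 0

universe u

variable {L : Type*} {A : Type u} [Field L] {d : ℕ} [CommRing A] [Algebra L A]
  [Algebra (MvPolynomial (Fin d) L) A] [IsScalarTower L (MvPolynomial (Fin d) L) A]
  [Algebra (Polynomial (MvPolynomial (Fin d) L)) A]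
  [IsScalarTower (MvPolynomial (Fin d) L) (Polynomial (MvPolynomial (Fin d) L)) A]
  [Algebra.FiniteType (Polynomial (MvPolynomial (Fin d) L)) A]

/-- A component of the support of `τ` has dimension at least `d + 1` by regularity. If it met `t =
0`, it would be generically algebraic over `Spec R[t]`, by Zariski's main theorem, and so dominate
it; but `u` vanishes on it. Hence the annihilator of `τ` and `t` generate the unit ideal, and `τ` is
a multiple of `t * τ`. -/
theorem mem_span_of_smul_eq_zero (hreg : HasRegularPolynomialSubring L (d + 1) A)
    {s : ℕ} (e : Fin s → A) (he : ∀ a, ∃ (r : Fin s → MvPolynomial (Fin d) L) (a' : A),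
      a = ∑ i, r i • e i +
        algebraMap (Polynomial (MvPolynomial (Fin d) L)) A Polynomial.X * a')
    (u : Polynomial (MvPolynomial (Fin d) L)) (hu : u ≠ 0) (τ : A) (hτ : u • τ = 0) :
    algebraMap (Polynomial (MvPolynomial (Fin d) L)) A Polynomial.X ∣ τ := by
  let S := Polynomial (MvPolynomial (Fin d) L)
  set t := algebraMap S A Polynomial.X with ht
  let 𝔞 : Ideal A := Ideal.span {0} |>.colon {τ}
  have h𝔞 : ∀ x, x ∈ 𝔞 ↔ x * τ = 0 := by
    intro x
    simp [𝔞, Submodule.mem_colon_singleton]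
  by_contra hdvd
  have hne : 𝔞 ⊔ Ideal.span {t} ≠ ⊤ := by
    intro h
    rw [Ideal.eq_top_iff_one, Submodule.mem_sup] at h
    obtain ⟨y, hy, z, hz, hyz⟩ := h
    obtain ⟨b, rfl⟩ := Ideal.mem_span_singleton.mp hz
    refine hdvd ⟨b * τ, ?_⟩
    calc τ = (y + t * b) * τ := by rw [hyz, one_mul]
      _ = _ := by rw [add_mul, (h𝔞 y).mp hy]; ring
  obtain ⟨m, hm, hle⟩ := Ideal.exists_le_maximal _ hne
  have := hm.isPrime
  obtain ⟨q, hq, hqm⟩ := Ideal.exists_minimalPrimes_le (le_sup_left.trans hle)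
  have hqp : q.IsPrime := hq.1.1
  have htm : t ∈ m := hle (Ideal.mem_sup_right (Ideal.mem_span_singleton_self t))
  have := quasiFiniteAt_of_finite_mod e he m htm
  obtain ⟨x, hx, hxint, hxx⟩ := Algebra.zariskisMainProperty_iff.mp
    (Algebra.ZariskisMainProperty.of_finiteType (R := S) m)
  -- the transcendence degree of `A ⧸ q`
  obtain ⟨φ, hφ⟩ := hreg
  -- An element of a minimal prime over the annihilator of `τ` kills some `y * τ ≠ 0`, whereas `φ v`
  -- is regular for `v ≠ 0`.
  have hφq : ∀ v, φ v ∈ q → v = 0 := by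
    intro v hv
    by_contra hv0
    obtain ⟨y, hy, hvy⟩ := Ideal.exists_mul_mem_of_mem_minimalPrimes hq hv
    rw [h𝔞, mul_assoc] at hvy
    exact hy ((h𝔞 y).mpr (hφ v hv0 _ hvy))
  let D := A ⧸ q
  let x' : Option (Fin d) → D := fun o =>
    Ideal.Quotient.mk q (algebraMap S A (optionEquivLeft L (Fin d) (X o)))
  have hx' : ∀ p, aeval x' p =
      Ideal.Quotient.mk q (algebraMap S A (optionEquivLeft L (Fin d) p)) := by
    intro p
    have : IsScalarTower L S A := IsScalarTower.of_algebraMap_eq' (by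
      rw [IsScalarTower.algebraMap_eq L (MvPolynomial (Fin d) L) A,
        IsScalarTower.algebraMap_eq (MvPolynomial (Fin d) L) S A, RingHom.comp_assoc,
        ← IsScalarTower.algebraMap_eq])
    have h : aeval x' = ((Ideal.Quotient.mkₐ L q).comp (IsScalarTower.toAlgHom L S A)).comp
        (optionEquivLeft L (Fin d)).toAlgHom := by
      ext o
      simp [x']
    rw [h]
    rfl
  have htr : Cardinal.lift.{u} (Cardinal.mk (Fin (d + 1))) ≤
      Cardinal.lift.{0} (Algebra.trdeg L D) := by
    have h : AlgebraicIndependent L (fun i => Ideal.Quotient.mk q (φ (X i))) := by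
      rw [algebraicIndependent_iff_injective_aeval, injective_iff_map_eq_zero]
      intro p hp
      have h1 : aeval (fun i => Ideal.Quotient.mk q (φ (X i))) =
          (Ideal.Quotient.mkₐ L q).comp φ := by
        ext i
        simp
      rw [h1] at hp
      exact hφq p (Ideal.Quotient.eq_zero_iff_mem.mp hp)
    exact h.lift_cardinalMk_le_trdeg
  have halg : Algebra.IsAlgebraic (Algebra.adjoin L (Set.range x')) D := by
    let g : S →+* Algebra.adjoin L (Set.range x') :=
      ((Ideal.Quotient.mk q).comp (algebraMap S A)).codRestrict _ (fun v => by
        rw [Algebra.adjoin_range_eq_range_aeval]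
        refine ⟨(optionEquivLeft L (Fin d)).symm v, ?_⟩
        change aeval x' _ = _
        rw [hx', AlgEquiv.apply_symm_apply]
        rfl)
    have hg : (algebraMap (Algebra.adjoin L (Set.range x')) D).comp g =
      (Ideal.Quotient.mk q).comp (algebraMap S A) := rfl
    refine ⟨fun y => ?_⟩
    obtain ⟨a, rfl⟩ := Ideal.Quotient.mk_surjective y
    obtain ⟨n, hn⟩ := hxx a
    have h1 := (hn.map_of_comp_eq g (Ideal.Quotient.mk q) hg).isAlgebraic
    have h2 := (hxint.map_of_comp_eq g (Ideal.Quotient.mk q) hg).isAlgebraic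
    rw [map_mul, map_pow] at h1
    have hx0 : Ideal.Quotient.mk q x ≠ 0 := by
      rw [Ne, Ideal.Quotient.eq_zero_iff_mem]
      exact fun h => hx (hqm h)
    exact IsAlgebraic.of_mul (mem_nonZeroDivisors_of_ne_zero (pow_ne_zero n hx0)) (h2.pow n) h1
  -- `D` is algebraic over `d + 1` elements and has transcendence degree at least `d + 1`, so they
  -- are independent: `S` embeds in `D`, although `u ≠ 0` maps to `0`.
  have hbasis := Algebra.IsAlgebraic.isTranscendenceBasis_of_lift_le_trdeg_of_finite L x' (by
    simpa using htr)
  have hinj := hbasis.1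
  rw [algebraicIndependent_iff_injective_aeval, injective_iff_map_eq_zero] at hinj
  have h1 := hinj ((optionEquivLeft L (Fin d)).symm u) (by
    rw [hx', AlgEquiv.apply_symm_apply, Ideal.Quotient.eq_zero_iff_mem]
    refine hq.1.2 ?_
    rw [h𝔞, ← Algebra.smul_def]
    exact hτ)
  exact hu (by simpa using h1)

/-- The generic characteristic polynomial of the special fiber of a family `A` over the affine line
annihilates the special fiber. -/
theorem aeval_charpoly_eq_zero_of_family (F : Type*) [Field F]
    [Algebra (MvPolynomial (Fin d) L) F] [IsFractionRing (MvPolynomial (Fin d) L) F]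
    (hreg : HasRegularPolynomialSubring L (d + 1) A) {A₀ : Type*} [CommRing A₀]
    [Algebra (MvPolynomial (Fin d) L) A₀] [Module.Finite (MvPolynomial (Fin d) L) A₀]
    (π : A →ₐ[MvPolynomial (Fin d) L] A₀) (hπ : Function.Surjective π)
    (hker : RingHom.ker π =
      Ideal.span {algebraMap (Polynomial (MvPolynomial (Fin d) L)) A Polynomial.X}) (y : A₀) :
    ∃ χ : Polynomial (MvPolynomial (Fin d) L), χ.Monic ∧
      χ.map (algebraMap _ F) =
        ((Algebra.lmul (MvPolynomial (Fin d) L) A₀ y).baseChange F).charpoly ∧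
      Polynomial.aeval y χ = 0 := by
  set t := algebraMap (Polynomial (MvPolynomial (Fin d) L)) A Polynomial.X with ht
  obtain ⟨s, e, he⟩ := exists_generators_mod t π hπ hker
  -- The `R[t]`-torsion of `A`. As it lies in `tA`, dividing it out keeps the special fiber and
  -- makes `t` a nonzerodivisor.
  let 𝔗 : Ideal A :=
    { carrier := {a | ∃ u : Polynomial (MvPolynomial (Fin d) L), u ≠ 0 ∧
        algebraMap (Polynomial (MvPolynomial (Fin d) L)) A u * a = 0}
      add_mem' := by
        rintro a b ⟨u, hu, ha⟩ ⟨v, hv, hb⟩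
        refine ⟨u * v, mul_ne_zero hu hv, ?_⟩
        rw [map_mul, mul_add, mul_right_comm, ha, zero_mul, mul_assoc, hb, mul_zero, add_zero]
      zero_mem' := ⟨1, one_ne_zero, mul_zero _⟩
      smul_mem' := by
        rintro c a ⟨u, hu, ha⟩
        exact ⟨u, hu, by rw [smul_eq_mul, mul_left_comm, ha, mul_zero]⟩ }
  have h𝔗 : 𝔗 ≤ RingHom.ker π := by
    rintro a ⟨u, hu, ha⟩
    rw [hker, Ideal.mem_span_singleton]
    exact mem_span_of_smul_eq_zero hreg e he u hu a (by rw [Algebra.smul_def, ha])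
  let π' : A ⧸ 𝔗 →ₐ[MvPolynomial (Fin d) L] A₀ := Ideal.Quotient.liftₐ 𝔗 π h𝔗
  have htA : algebraMap (Polynomial (MvPolynomial (Fin d) L)) (A ⧸ 𝔗) Polynomial.X =
      Ideal.Quotient.mk 𝔗 t := rfl
  have htf : ∀ (v : Polynomial (MvPolynomial (Fin d) L)) (a : A ⧸ 𝔗),
      v • a = 0 → v = 0 ∨ a = 0 := by
    intro v a hva
    rw [or_iff_not_imp_left]
    intro hv
    obtain ⟨a, rfl⟩ := Ideal.Quotient.mk_surjective a
    have h1 : Ideal.Quotient.mk 𝔗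
        (algebraMap (Polynomial (MvPolynomial (Fin d) L)) A v * a) = 0 := by
      rw [map_mul]; exact (Algebra.smul_def v (Ideal.Quotient.mk 𝔗 a)).symm.trans hva
    obtain ⟨u, hu, hua⟩ := Ideal.Quotient.eq_zero_iff_mem.mp h1
    rw [Ideal.Quotient.eq_zero_iff_mem]
    exact ⟨u * v, mul_ne_zero hu hv, by rw [map_mul, mul_assoc]; exact hua⟩
  have he' : ∀ a : A ⧸ 𝔗, ∃ (r : Fin s → MvPolynomial (Fin d) L) (a' : A ⧸ 𝔗),
      a = ∑ i, r i • Ideal.Quotient.mk 𝔗 (e i) +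
        algebraMap (Polynomial (MvPolynomial (Fin d) L)) (A ⧸ 𝔗) Polynomial.X * a' := by
    intro a
    obtain ⟨a, rfl⟩ := Ideal.Quotient.mk_surjective a
    obtain ⟨r, a', h⟩ := he a
    refine ⟨r, Ideal.Quotient.mk 𝔗 a', ?_⟩
    conv_lhs => rw [h]
    rw [map_add, map_sum, map_mul, htA]
    rfl
  have : Algebra.FiniteType (Polynomial (MvPolynomial (Fin d) L)) (A ⧸ 𝔗) :=
    Algebra.FiniteType.of_surjective (Ideal.Quotient.mkₐ (Polynomial (MvPolynomial (Fin d) L)) 𝔗)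
      Ideal.Quotient.mk_surjective
  refine aeval_charpoly_eq_zero_of_deformation (A := A ⧸ 𝔗)
    (algebraMap (Polynomial (MvPolynomial (Fin d) L)) (A ⧸ 𝔗) Polynomial.X)
    (fun a ha => ?_) (exists_pow_dvd_of_torsionFree htf _ he') π' ?_ ?_ y
  · rw [← Algebra.smul_def] at ha
    exact (htf _ _ ha).resolve_left Polynomial.X_ne_zero
  · intro b
    obtain ⟨a, rfl⟩ := hπ b
    exact ⟨Ideal.Quotient.mk 𝔗 a, rfl⟩
  · ext a
    obtain ⟨a, rfl⟩ := Ideal.Quotient.mk_surjective a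
    have h1 : π' (Ideal.Quotient.mk 𝔗 a) = π a := rfl
    rw [RingHom.mem_ker, h1, htA, ← Set.image_singleton, ← Ideal.map_span, ← hker,
      Ideal.mem_map_iff_of_surjective _ Ideal.Quotient.mk_surjective]
    constructor
    · exact fun h => ⟨a, h, rfl⟩
    · rintro ⟨b, hb, hba⟩
      rw [Ideal.Quotient.mk_eq_mk_iff_sub_mem] at hba
      have := h𝔗 hba
      rw [RingHom.mem_ker, map_sub, hb, zero_sub, neg_eq_zero] at this
      exact this

end Torsion

/-! ### Dimension and Noether normalization -/

section Dimension

theorem ringKrullDim_le_of_isIntegral {A B : Type*} [CommRing A] [CommRing B] (f : A →+* B)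
    (hf : f.IsIntegral) : ringKrullDim B ≤ ringKrullDim A := by
  algebraize [f]
  have : Algebra.IsIntegral A B := ⟨hf⟩
  refine Order.krullDim_le_of_strictMono (PrimeSpectrum.comap f) fun p q hpq => ?_
  exact Ideal.IsIntegral.comap_lt_comap (R := A) hpq

theorem ringKrullDim_eq_of_isIntegral_of_injective {A B : Type*} [CommRing A] [CommRing B]
    (f : A →+* B) (hf : f.IsIntegral) (hinj : Function.Injective f) :
    ringKrullDim B = ringKrullDim A := by
  refine le_antisymm (ringKrullDim_le_of_isIntegral f hf) ?_
  algebraize [f]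
  have : Algebra.IsIntegral A B := ⟨hf⟩
  refine iSup_le fun l => ?_
  obtain ⟨Q, hQ, hQl⟩ := Ideal.exists_ideal_over_prime_of_isIntegral (S := B) l.head.asIdeal ⊥
    (by
      intro x hx
      rw [Ideal.mem_comap, Ideal.mem_bot] at hx
      rw [(map_eq_zero_iff f hinj).mp hx]
      exact Ideal.zero_mem _)
  have : Q.LiesOver l.head.asIdeal := ⟨hQl.2.symm⟩
  have := hQl.1
  obtain ⟨l', hl', -⟩ := Ideal.exists_ltSeries_of_hasGoingUp l Q
  rw [← hl']
  exact le_iSup (fun l : LTSeries (PrimeSpectrum B) => (l.length : WithBot ℕ∞)) l'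

variable {K : Type*} [Field K]

theorem ringKrullDim_mvPolynomial_fin (m : ℕ) : ringKrullDim (MvPolynomial (Fin m) K) = m := by
  rw [MvPolynomial.ringKrullDim_of_isNoetherianRing, ringKrullDim_eq_zero_of_field]
  simp

/-- If `s ≠ 0` were in the kernel, `B` would be integral over the quotient by `s`, which has
dimension less than `m`. -/
theorem injective_of_isIntegral_of_ringKrullDim {m : ℕ} {B : Type*} [CommRing B]
    (f : MvPolynomial (Fin m) K →+* B) (hf : f.IsIntegral) (hB : ringKrullDim B = m) :
    Function.Injective f := by
  rw [injective_iff_map_eq_zero]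
  intro s hs
  by_contra hs0
  let g : MvPolynomial (Fin m) K ⧸ Ideal.span {s} →+* B := Ideal.Quotient.lift _ f (by
    intro a ha
    obtain ⟨b, rfl⟩ := Ideal.mem_span_singleton.mp ha
    rw [map_mul, hs, zero_mul])
  have hg : g.IsIntegral := by
    have : (g.comp (Ideal.Quotient.mk (Ideal.span {s}))).IsIntegral := hf
    exact this.tower_top
  have h1 := ringKrullDim_le_of_isIntegral g hg
  have h2 := ringKrullDim_quotient_succ_le_of_nonZeroDivisor (mem_nonZeroDivisors_of_ne_zero hs0)
  rw [ringKrullDim_mvPolynomial_fin] at h2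
  rw [hB] at h1
  have h3 := (add_le_add_left h1 1).trans h2
  have : m + 1 ≤ m := by exact_mod_cast h3
  omega

/-- Noether normalization of a pure dimensional scheme without embedded points. -/
theorem exists_finite_regular_of_pure {N m : ℕ} (I : Ideal (MvPolynomial (Fin N) K))
    (hpure : IsPureDimensional I m) (hemb : NoEmbeddedPoints I) :
    ∃ φ : MvPolynomial (Fin m) K →ₐ[K] MvPolynomial (Fin N) K ⧸ I, φ.Finite ∧
      ∀ s, s ≠ 0 → ∀ a, φ s * a = 0 → a = 0 := by
  by_cases hI : I = ⊤
  · have : Subsingleton (MvPolynomial (Fin N) K ⧸ I) := Ideal.Quotient.subsingleton_iff.mpr hI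
    exact ⟨aeval 0, RingHom.Finite.of_surjective _ (fun a => ⟨0, Subsingleton.elim _ _⟩),
      fun _ _ a _ => Subsingleton.elim _ _⟩
  have : Nontrivial (MvPolynomial (Fin N) K ⧸ I) := Ideal.Quotient.nontrivial_iff.mpr hI
  obtain ⟨s, φ, hφ, hfin⟩ := exists_finite_inj_algHom_of_fg K (MvPolynomial (Fin N) K ⧸ I)
  have hint : ∀ p (hp : p ∈ I.minimalPrimes),
      ((Ideal.Quotient.factor hp.1.2).comp φ.toRingHom).IsIntegral := fun p hp =>
    (hfin.to_isIntegral).trans _ _ (RingHom.isIntegral_of_surjective _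
      (Ideal.Quotient.factor_surjective _))
  -- A prime over `0` contains a minimal prime of `I`, whose quotient is then an integral extension
  -- of the polynomial ring in `s` variables; purity says that its dimension is `m`.
  obtain rfl : s = m := by
    let _ : Algebra (MvPolynomial (Fin s) K) (MvPolynomial (Fin N) K ⧸ I) :=
      φ.toRingHom.toAlgebra
    have : Algebra.IsIntegral (MvPolynomial (Fin s) K) (MvPolynomial (Fin N) K ⧸ I) :=
      ⟨hfin.to_isIntegral⟩
    obtain ⟨Q, -, hQ, hQl⟩ := Ideal.exists_ideal_over_prime_of_isIntegral
      (S := MvPolynomial (Fin N) K ⧸ I) (⊥ : Ideal (MvPolynomial (Fin s) K)) ⊥ (by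
        intro x hx
        exact hφ ((Ideal.mem_bot.mp hx).trans (map_zero φ).symm))
    obtain ⟨p, hp, hpQ⟩ := Ideal.exists_minimalPrimes_le
      (I := I) (J := Q.comap (Ideal.Quotient.mk I)) (fun x hx => by
        rw [Ideal.mem_comap, Ideal.Quotient.eq_zero_iff_mem.mpr hx]
        exact Q.zero_mem)
    have h1 := ringKrullDim_eq_of_isIntegral_of_injective _ (hint p hp) (by
      rw [injective_iff_map_eq_zero]
      intro v hv
      obtain ⟨r, hr⟩ := Ideal.Quotient.mk_surjective (φ v)
      change Ideal.Quotient.factor hp.1.2 (φ v) = 0 at hv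
      rw [← hr, Ideal.Quotient.factor_mk, Ideal.Quotient.eq_zero_iff_mem] at hv
      have h2 := hpQ hv
      rw [Ideal.mem_comap, hr] at h2
      have h3 : v ∈ Q.comap (algebraMap (MvPolynomial (Fin s) K) _) := h2
      rwa [hQl, Ideal.mem_bot] at h3)
    rw [hpure p hp, ringKrullDim_mvPolynomial_fin] at h1
    exact_mod_cast h1.symm
  refine ⟨φ, hfin, fun v hv a ha => ?_⟩
  by_contra ha0
  obtain ⟨r, hr⟩ := Ideal.Quotient.mk_surjective (φ v)
  have h1 : r ∈ {r : MvPolynomial (Fin N) K |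
      ∃ x : MvPolynomial (Fin N) K ⧸ I, x ≠ 0 ∧ r • x = 0} :=
    ⟨a, ha0, by
      obtain ⟨b, rfl⟩ := Ideal.Quotient.mk_surjective a
      change Ideal.Quotient.mk I (r * b) = 0
      rw [map_mul, hr, ha]⟩
  -- A zero divisor lies in an associated prime, which is minimal by `hemb`, so of dimension `m`;
  -- the polynomial ring injects into its quotient.
  rw [← biUnion_associatedPrimes_eq_zero_divisors] at h1
  simp only [Set.mem_iUnion] at h1
  obtain ⟨p, hp, hrp⟩ := h1
  have hp' := hemb hp
  refine hv ((injective_iff_map_eq_zero _).mp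
    (injective_of_isIntegral_of_ringKrullDim _ (hint p hp') (hpure p hp')) v ?_)
  change Ideal.Quotient.factor hp'.1.2 (φ v) = 0
  rw [← hr, Ideal.Quotient.factor_mk, Ideal.Quotient.eq_zero_iff_mem]
  exact hrp

end Dimension

/-! ### Extension of the ground field -/

section BaseChange

variable {K : Type*} [Field K] (L : Type*) [Field L] [Algebra K L] {N m : ℕ}

open TensorProduct in
/-- The coordinate ring of the base change of a closed subscheme of affine space. -/
theorem exists_baseChange_quotient (I : Ideal (MvPolynomial (Fin N) K)) :
    ∃ θ : MvPolynomial (Fin N) L →ₐ[L] L ⊗[K] (MvPolynomial (Fin N) K ⧸ I),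
      Function.Surjective θ ∧
      RingHom.ker θ = I.map (MvPolynomial.map (algebraMap K L)) ∧
      ∀ p, θ (MvPolynomial.map (algebraMap K L) p) = 1 ⊗ₜ Ideal.Quotient.mk I p := by
  let e := MvPolynomial.algebraTensorAlgEquiv (σ := Fin N) K L
  let μ : L ⊗[K] MvPolynomial (Fin N) K →ₐ[L] L ⊗[K] (MvPolynomial (Fin N) K ⧸ I) :=
    Algebra.TensorProduct.map (AlgHom.id L L) (Ideal.Quotient.mkₐ K I)
  have he : ∀ p, e.symm (MvPolynomial.map (algebraMap K L) p) = 1 ⊗ₜ p := by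
    intro p
    rw [AlgEquiv.symm_apply_eq]
    simp [e]
  refine ⟨μ.comp e.symm.toAlgHom, ?_, ?_, ?_⟩
  · have : Function.Surjective μ :=
      LinearMap.lTensor_surjective L (g := (Ideal.Quotient.mkₐ K I).toLinearMap)
        Ideal.Quotient.mk_surjective
    exact this.comp e.symm.surjective
  · have h1 := Algebra.TensorProduct.lTensor_ker (A := L) (Ideal.Quotient.mkₐ K I)
      Ideal.Quotient.mk_surjective
    have h2 : RingHom.ker μ = I.map (Algebra.TensorProduct.includeRight :
        MvPolynomial (Fin N) K →ₐ[K] L ⊗[K] MvPolynomial (Fin N) K).toRingHom :=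
      h1.trans (congrArg (Ideal.map _) (Ideal.Quotient.mkₐ_ker K I))
    have h4 : (e : L ⊗[K] MvPolynomial (Fin N) K →+* MvPolynomial (Fin N) L).comp
        (Algebra.TensorProduct.includeRight :
          MvPolynomial (Fin N) K →ₐ[K] L ⊗[K] MvPolynomial (Fin N) K).toRingHom =
        MvPolynomial.map (algebraMap K L) :=
      RingHom.ext fun p => (e.symm_apply_eq.mp (he p)).symm
    rw [← h4, ← Ideal.map_map, ← h2]
    ext x
    have h5 : x ∈ RingHom.ker (μ.comp e.symm.toAlgHom) ↔ e.symm x ∈ RingHom.ker μ := Iff.rfl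
    rw [h5]
    constructor
    · intro h
      have := Ideal.mem_map_of_mem
        (e : L ⊗[K] MvPolynomial (Fin N) K →+* MvPolynomial (Fin N) L) h
      have h6 : (e : L ⊗[K] MvPolynomial (Fin N) K →+* MvPolynomial (Fin N) L) (e.symm x) = x :=
        e.apply_symm_apply x
      rwa [h6] at this
    · intro h
      obtain ⟨y, hy, rfl⟩ := (Ideal.mem_map_iff_of_surjective
        (e : L ⊗[K] MvPolynomial (Fin N) K →+* MvPolynomial (Fin N) L) e.surjective).mp h
      have h6 : e.symm ((e : L ⊗[K] MvPolynomial (Fin N) K →+* MvPolynomial (Fin N) L) y) = y :=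
        e.symm_apply_apply y
      rwa [h6]
  · intro p
    change μ (e.symm _) = _
    rw [he]
    simp [μ]

-- `A` embeds in a free module over the polynomial ring, and this survives tensoring over the field
-- `K`; regularity then follows because `L ⊗ K[y] = L[y]` is a domain. No associated primes have to
-- be followed through the extension.
open TensorProduct in
theorem regular_tensorProduct {A : Type*} [CommRing A] [Algebra K A]
    (φ : MvPolynomial (Fin m) K →ₐ[K] A) (hφ : φ.Finite)
    (hreg : ∀ s, s ≠ 0 → ∀ a, φ s * a = 0 → a = 0) (s : L ⊗[K] MvPolynomial (Fin m) K)
    (hs : s ≠ 0) (a : L ⊗[K] A)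
    (ha : Algebra.TensorProduct.map (AlgHom.id L L) φ s * a = 0) : a = 0 := by
  let _ : Algebra (MvPolynomial (Fin m) K) A := φ.toRingHom.toAlgebra
  have : Module.Finite (MvPolynomial (Fin m) K) A := hφ
  have : IsScalarTower K (MvPolynomial (Fin m) K) A :=
    IsScalarTower.of_algebraMap_eq' φ.comp_algebraMap.symm
  obtain ⟨n, f, hf⟩ := exists_injective_pi_of_torsionFree (MvPolynomial (Fin m) K) A
    (fun s a h => or_iff_not_imp_left.mpr fun hs => hreg s hs a h)
  let g : L ⊗[K] A →ₗ[K] L ⊗[K] (Fin n → MvPolynomial (Fin m) K) :=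
    (f.restrictScalars K).lTensor L
  have hg : Function.Injective g :=
    Module.Flat.lTensor_preserves_injective_linearMap (f.restrictScalars K) hf
  let q (i : Fin n) : L ⊗[K] A →ₗ[K] L ⊗[K] MvPolynomial (Fin m) K :=
    ((LinearMap.proj i ∘ₗ f).restrictScalars K).lTensor L
  have hq : ∀ i s a, q i (Algebra.TensorProduct.map (AlgHom.id L L) φ s * a) = s * q i a := by
    intro i s a
    induction s with
    | zero => simp
    | add s s' h h' => rw [map_add, add_mul, map_add, h, h', add_mul]
    | tmul l s =>
      induction a with
      | zero => simp
      | add s s' h h' => rw [mul_add, map_add, h, h', map_add, mul_add]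
      | tmul l' a =>
        have h1 : f (φ s * a) = s • f a := f.map_smul s a
        simp [q, h1]
  have hq1 : ∀ a i, TensorProduct.piRight K K L (fun _ : Fin n => MvPolynomial (Fin m) K) (g a) i
      = q i a := by
    intro a i
    induction a with
    | zero => simp
    | add a a' h h' => rw [map_add, map_add, Pi.add_apply, h, h', map_add]
    | tmul l a => rfl
  have hdom : IsDomain (L ⊗[K] MvPolynomial (Fin m) K) :=
    (MvPolynomial.algebraTensorAlgEquiv (σ := Fin m) K L).toMulEquiv.isDomain
  have h0 : ∀ i, q i a = 0 := by
    intro i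
    have := hq i s a
    rw [ha, map_zero] at this
    exact (mul_eq_zero.mp this.symm).resolve_left hs
  refine (injective_iff_map_eq_zero g).mp hg a
    ((TensorProduct.piRight K K L (fun _ : Fin n => MvPolynomial (Fin m) K)).injective ?_)
  rw [map_zero]
  ext1 i
  rw [hq1, h0, Pi.zero_apply]

open TensorProduct in
theorem isIntegral_tensorProduct_map {R A : Type*} [CommRing R] [Algebra K R] [CommRing A]
    [Algebra K A] (φ : R →ₐ[K] A) (hφ : φ.toRingHom.IsIntegral) :
    (Algebra.TensorProduct.map (AlgHom.id L L) φ).toRingHom.IsIntegral := by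
  intro a
  induction a with
  | zero => exact RingHom.isIntegralElem_zero _
  | add a a' h h' => exact h.add _ h'
  | tmul l a =>
    have h1 : l ⊗ₜ[K] a = Algebra.TensorProduct.map (AlgHom.id L L) φ (l ⊗ₜ 1) * (1 ⊗ₜ a) := by
      simp
    rw [h1]
    refine RingHom.IsIntegralElem.mul _ (RingHom.isIntegralElem_map _) ?_
    obtain ⟨p, hp, hpa⟩ := hφ a
    refine ⟨p.map (Algebra.TensorProduct.includeRight : R →ₐ[K] L ⊗[K] R).toRingHom, hp.map _, ?_⟩
    have h2 := congrArg (Algebra.TensorProduct.includeRight : A →ₐ[K] L ⊗[K] A).toRingHom hpa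
    rw [Polynomial.hom_eval₂, map_zero] at h2
    rw [Polynomial.eval₂_map, ← h2]
    congr 1

theorem exists_integral_regular_baseChange (I : Ideal (MvPolynomial (Fin N) K))
    (φ : MvPolynomial (Fin m) K →ₐ[K] MvPolynomial (Fin N) K ⧸ I) (hφ : φ.Finite)
    (hreg : ∀ s, s ≠ 0 → ∀ a, φ s * a = 0 → a = 0) :
    ∃ φ' : MvPolynomial (Fin m) L →ₐ[L]
        MvPolynomial (Fin N) L ⧸ I.map (MvPolynomial.map (algebraMap K L)),
      φ'.toRingHom.IsIntegral ∧ ∀ s, s ≠ 0 → ∀ a, φ' s * a = 0 → a = 0 := by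
  obtain ⟨θ, hθ, hker, -⟩ := exists_baseChange_quotient L I
  let ε := (Ideal.quotientEquivAlgOfEq L hker.symm).trans
    (Ideal.quotientKerAlgEquivOfSurjective hθ)
  let e := MvPolynomial.algebraTensorAlgEquiv (σ := Fin m) K L
  let Φ := Algebra.TensorProduct.map (AlgHom.id L L) φ
  refine ⟨(ε.symm.toAlgHom.comp Φ).comp e.symm.toAlgHom, ?_, fun s hs a ha => ?_⟩
  · have h1 : e.symm.toAlgHom.toRingHom.IsIntegral :=
      RingHom.isIntegral_of_surjective _ e.symm.surjective
    have h2 : Φ.toRingHom.IsIntegral := isIntegral_tensorProduct_map L φ hφ.to_isIntegral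
    have h3 : ε.symm.toAlgHom.toRingHom.IsIntegral :=
      RingHom.isIntegral_of_surjective _ fun x => ⟨ε x, ε.symm_apply_apply x⟩
    exact (h1.trans _ _ h2).trans _ _ h3
  · have h1 : Φ (e.symm s) * ε a = 0 := by
      have := congrArg ε ha
      rw [map_mul, map_zero] at this
      exact (congrArg (· * ε a) (ε.apply_symm_apply (Φ (e.symm s))).symm).trans this
    have := regular_tensorProduct L φ hφ hreg (e.symm s) (by simpa using hs) _ h1
    simpa using this

theorem hasRegularPolynomialSubring_baseChange (I : Ideal (MvPolynomial (Fin N) K))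
    (hpure : IsPureDimensional I m) (hemb : NoEmbeddedPoints I) :
    HasRegularPolynomialSubring L m
      (MvPolynomial (Fin N) L ⧸ I.map (MvPolynomial.map (algebraMap K L))) := by
  obtain ⟨φ, hφ, hreg⟩ := exists_finite_regular_of_pure I hpure hemb
  obtain ⟨φ', -, hreg'⟩ := exists_integral_regular_baseChange L I φ hφ hreg
  exact ⟨φ', hreg'⟩

theorem noEmbeddedPoints_of_isPrime (p : Ideal (MvPolynomial (Fin N) K)) [hp : p.IsPrime] :
    NoEmbeddedPoints p := by
  intro q hq
  rw [associatedPrimes.eq_singleton_of_isPrimary hp.isPrimary, hp.radical] at hq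
  rw [Ideal.minimalPrimes_eq_subsingleton_self]
  exact hq

theorem isPureDimensional_of_isPrime (p : Ideal (MvPolynomial (Fin N) K)) [hp : p.IsPrime]
    (hdim : ringKrullDim (MvPolynomial (Fin N) K ⧸ p) = m) : IsPureDimensional p m := by
  intro q hq
  rw [Ideal.minimalPrimes_eq_subsingleton_self] at hq
  rwa [Set.mem_singleton_iff.mp hq]

/-- Nonzero elements of `L[y]` are regular modulo the extension of `p`, so they avoid its minimal
primes. Each component is thus an integral extension of a polynomial ring in `m` variables. -/
theorem ringKrullDim_baseChange (p : Ideal (MvPolynomial (Fin N) K)) [hp : p.IsPrime]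
    (hdim : ringKrullDim (MvPolynomial (Fin N) K ⧸ p) = m) (P : Ideal (MvPolynomial (Fin N) L))
    (hP : P ∈ (p.map (MvPolynomial.map (algebraMap K L))).minimalPrimes) :
    ringKrullDim (MvPolynomial (Fin N) L ⧸ P) = m := by
  obtain ⟨φ, hφ, hreg⟩ := exists_finite_regular_of_pure p
    (isPureDimensional_of_isPrime p hdim) (noEmbeddedPoints_of_isPrime p)
  obtain ⟨φ', hint, hreg'⟩ := exists_integral_regular_baseChange L p φ hφ hreg
  rw [← ringKrullDim_mvPolynomial_fin (K := L) m]
  refine ringKrullDim_eq_of_isIntegral_of_injective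
    ((Ideal.Quotient.factor hP.1.2).comp φ'.toRingHom) (hint.trans _ _
      (RingHom.isIntegral_of_surjective _ (Ideal.Quotient.factor_surjective _))) ?_
  rw [injective_iff_map_eq_zero]
  intro v hv
  by_contra hv0
  obtain ⟨x, hx⟩ := Ideal.Quotient.mk_surjective (φ' v)
  change Ideal.Quotient.factor hP.1.2 (φ' v) = 0 at hv
  rw [← hx, Ideal.Quotient.factor_mk, Ideal.Quotient.eq_zero_iff_mem] at hv
  obtain ⟨y, hy, hxy⟩ := Ideal.exists_mul_mem_of_mem_minimalPrimes hP hv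
  rw [← Ideal.Quotient.eq_zero_iff_mem] at hy hxy
  rw [map_mul, hx] at hxy
  exact hy (hreg' v hv0 _ hxy)

open TensorProduct in
theorem comap_map_baseChange (I : Ideal (MvPolynomial (Fin N) K)) :
    (I.map (MvPolynomial.map (algebraMap K L))).comap (MvPolynomial.map (algebraMap K L)) = I := by
  refine le_antisymm (fun x hx => ?_) Ideal.le_comap_map
  obtain ⟨θ, hθ, hker, h1⟩ := exists_baseChange_quotient L I
  rw [Ideal.mem_comap, ← hker, RingHom.mem_ker] at hx
  have h2 := (h1 x).symm.trans hx
  rw [← Ideal.Quotient.eq_zero_iff_mem]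
  refine (Algebra.TensorProduct.includeRight_injective (R := K) (A := L)
    (algebraMap K L).injective) ?_
  simpa using h2

open TensorProduct in
theorem one_tmul_mul_eq_zero {A : Type*} [CommRing A] [IsDomain A] [Algebra K A] (a : A)
    (ha : a ≠ 0) (z : L ⊗[K] A) (hz : (1 ⊗ₜ a) * z = 0) : z = 0 := by
  let μ := LinearMap.mulLeft K a
  have hμ : Function.Injective (μ.lTensor L) :=
    Module.Flat.lTensor_preserves_injective_linearMap _ (mul_right_injective₀ ha)
  have h2 : ∀ z, μ.lTensor L z = (1 ⊗ₜ a) * z := by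
    intro z
    induction z with
    | zero => simp
    | add a a' h h' => rw [map_add, h, h', mul_add]
    | tmul l a => simp [μ]
  exact hμ (by rw [h2, hz, map_zero])

-- Elements outside `p` are regular modulo `p` and stay so over `L` by flatness, hence avoid every
-- minimal prime of the extended ideal.
open TensorProduct in
theorem comap_eq_of_mem_minimalPrimes_baseChange (p : Ideal (MvPolynomial (Fin N) K))
    [hp : p.IsPrime] (P : Ideal (MvPolynomial (Fin N) L))
    (hP : P ∈ (p.map (MvPolynomial.map (algebraMap K L))).minimalPrimes) :
    P.comap (MvPolynomial.map (algebraMap K L)) = p := by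
  refine le_antisymm (fun x hx => ?_) (Ideal.map_le_iff_le_comap.mp hP.1.2)
  obtain ⟨θ, hθ, hker, h1⟩ := exists_baseChange_quotient L p
  obtain ⟨y, hy, hxy⟩ := Ideal.exists_mul_mem_of_mem_minimalPrimes hP (Ideal.mem_comap.mp hx)
  rw [← hker, RingHom.mem_ker] at hy hxy
  rw [map_mul, h1] at hxy
  by_contra hxp
  exact hy (one_tmul_mul_eq_zero L (Ideal.Quotient.mk p x)
    (fun h => hxp (Ideal.Quotient.eq_zero_iff_mem.mp h)) (θ y) hxy)

theorem map_centralFiber (I : Ideal (MvPolynomial (Fin (N + 1)) K)) :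
    (centralFiber I).map (MvPolynomial.map (algebraMap K L)) =
      centralFiber (I.map (MvPolynomial.map (algebraMap K L))) := by
  rw [centralFiber, centralFiber, Ideal.map_map, Ideal.map_map]
  congr 1
  refine MvPolynomial.ringHom_ext (fun r => ?_) (fun i => ?_)
  · simp [MvPolynomial.algebraMap_eq]
  · refine Fin.lastCases ?_ (fun i => ?_) i <;> simp

end BaseChange

/-! ### Nagata's change of coordinates -/

section Nagata

variable {k : Type*} [Field k] {n : ℕ}

/-- Nagata's change of coordinates `X_i ↦ X_i + c X_0 ^ (b ^ i)` for `i ≠ 0`. -/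
noncomputable def nagataHom (b : ℕ) (c : k) :
    MvPolynomial (Fin (n + 1)) k →ₐ[k] MvPolynomial (Fin (n + 1)) k :=
  aeval fun i => if i = 0 then X 0 else X i + c • X 0 ^ b ^ i.1

theorem nagataHom_comp_neg (b : ℕ) (c : k) :
    (nagataHom b c).comp (nagataHom b (-c)) = AlgHom.id k (MvPolynomial (Fin (n + 1)) k) := by
  rw [nagataHom, nagataHom, comp_aeval, ← MvPolynomial.aeval_X_left]
  ext i v
  cases i using Fin.cases <;> simp

/-- Nagata's automorphism of a polynomial ring. -/
noncomputable def nagataEquiv (b : ℕ) :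
    MvPolynomial (Fin (n + 1)) k ≃ₐ[k] MvPolynomial (Fin (n + 1)) k :=
  AlgEquiv.ofAlgHom (nagataHom b 1) (nagataHom b (-1)) (nagataHom_comp_neg b 1)
    (by simpa using nagataHom_comp_neg b (-1 : k))

/-- The exponents of a monomial are the base `b` digits of the sum, so distinct monomials get
distinct degrees in `X 0`. -/
theorem sum_pow_mul_ne {b : ℕ} (hb : 1 < b) (v w : Fin (n + 1) →₀ ℕ) (hv : ∀ i, v i < b)
    (hw : ∀ i, w i < b) (hne : v ≠ w) :
    ∑ x : Fin (n + 1), b ^ x.1 * v x ≠ ∑ x : Fin (n + 1), b ^ x.1 * w x := by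
  intro h
  refine hne <| Finsupp.ext <| congrFun <| List.ofFn_inj.mp ?_
  apply Nat.ofDigits_inj_of_len_eq hb (by simp) (by grind) (by grind)
  simpa only [Nat.ofDigits_eq_sum_mapIdx, List.mapIdx_eq_ofFn, List.get_ofFn, List.length_ofFn,
    Fin.val_cast, mul_comm, List.sum_ofFn] using! h

theorem degreeOf_zero_nagataEquiv {b : ℕ} (hb : 0 < b) (v : Fin (n + 1) →₀ ℕ) {a : k} (ha : a ≠ 0) :
    (nagataEquiv b (monomial v a)).degreeOf 0 = ∑ i : Fin (n + 1), b ^ i.1 * v i := by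
  rw [← natDegree_finSuccEquiv, monomial_eq, Finsupp.prod_pow v fun a ↦ X a]
  simp only [Fin.prod_univ_succ, Fin.sum_univ_succ, map_mul, map_prod, map_pow, nagataEquiv,
    nagataHom, AlgEquiv.ofAlgHom_apply, MvPolynomial.aeval_C, MvPolynomial.aeval_X, if_pos,
    Fin.succ_ne_zero, ite_false, one_smul, map_add, finSuccEquiv_X_zero, finSuccEquiv_X_succ,
    algebraMap_eq]
  have h (i : Fin n) : (Polynomial.C (X (R := k) i) + Polynomial.X ^ b ^ (i.succ).1) ^ v i.succ
      ≠ 0 :=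
    pow_ne_zero (v i.succ) (Polynomial.leadingCoeff_ne_zero.mp <| by
      rw [add_comm, Polynomial.leadingCoeff_X_pow_add_C (pow_pos hb _)]; exact one_ne_zero)
  rw [Polynomial.natDegree_mul (by simp [ha]) (mul_ne_zero (by simp)
      (Finset.prod_ne_zero_iff.mpr (fun i _ ↦ h i))),
    Polynomial.natDegree_mul (by simp) (Finset.prod_ne_zero_iff.mpr (fun i _ ↦ h i)),
    Polynomial.natDegree_prod _ _ (fun i _ ↦ h i), natDegree_finSuccEquiv, degreeOf_C]
  simpa only [Polynomial.natDegree_pow, zero_add, Polynomial.natDegree_X, mul_one, Fin.val_zero,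
    pow_zero, one_mul, add_right_inj] using Finset.sum_congr rfl (fun i _ ↦ by
    rw [add_comm (Polynomial.C _), Polynomial.natDegree_X_pow_add_C, mul_comm])

theorem leadingCoeff_finSuccEquiv_nagataEquiv {b : ℕ} (hb : 0 < b) (v : Fin (n + 1) →₀ ℕ) (a : k) :
    (finSuccEquiv k n (nagataEquiv b (monomial v a))).leadingCoeff = C a := by
  rw [monomial_eq, Finsupp.prod_fintype _ _ fun i ↦ pow_zero _]
  have hC : finSuccEquiv k n (nagataEquiv b (C a)) = Polynomial.C (C a) := by
    simp [nagataEquiv, nagataHom, finSuccEquiv_apply]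
  have hX : ∀ j, (finSuccEquiv k n (nagataEquiv b (X j))).leadingCoeff = 1 := fun j ↦ by
    cases j using Fin.cases with
    | zero => simp [nagataEquiv, nagataHom, finSuccEquiv_X_zero]
    | succ i =>
      simpa [nagataEquiv, nagataHom, finSuccEquiv_X_succ, finSuccEquiv_X_zero, add_comm] using
        Polynomial.leadingCoeff_X_pow_add_C (pow_pos hb (i.1 + 1))
  simp only [map_mul, map_prod, Polynomial.leadingCoeff_mul, Polynomial.leadingCoeff_prod, map_pow,
    Polynomial.leadingCoeff_pow, hC, hX, one_pow, Finset.prod_const_one, mul_one,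
    Polynomial.leadingCoeff_C]

/-- After an automorphism, a nonzero polynomial is monic in the first variable, up to a unit. -/
theorem isUnit_leadingCoeff_nagataEquiv (f : MvPolynomial (Fin (n + 1)) k) (hf : f ≠ 0) :
    IsUnit (finSuccEquiv k n (nagataEquiv (2 + f.totalDegree) f)).leadingCoeff := by
  set T := nagataEquiv (k := k) (n := n) (2 + f.totalDegree)
  -- The base `2 + f.totalDegree` exceeds `1` and every exponent in `f`, so a single monomial
  -- attains the top degree and contributes a constant leading coefficient.
  obtain ⟨v, hv, hmax⟩ := Finset.exists_max_image f.support
    (fun v ↦ (T (monomial v (coeff v f))).degreeOf 0) (support_nonempty.mpr hf)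
  set h := fun w ↦ MvPolynomial.monomial w (coeff w f)
  simp only [← natDegree_finSuccEquiv] at hmax
  have hlt : ∀ x ∈ f.support \ {v}, (finSuccEquiv k n (T (h x))).degree <
      (finSuccEquiv k n (T (h v))).degree := by
    intro x hx
    obtain ⟨h1, h2⟩ := Finset.mem_sdiff.mp hx
    refine Polynomial.degree_lt_degree (lt_of_le_of_ne (hmax x h1) ?_)
    simp only [natDegree_finSuccEquiv]
    rw [degreeOf_zero_nagataEquiv (by lia) _ (mem_support_iff.mp hv),
      degreeOf_zero_nagataEquiv (by lia) _ (mem_support_iff.mp h1)]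
    refine sum_pow_mul_ne (by lia) _ _ (fun i ↦ ?_) (fun i ↦ ?_) (fun h ↦ h2 (by simp [h]))
    all_goals exact lt_of_le_of_lt ((monomial_le_degreeOf i ‹_›).trans
      (degreeOf_le_totalDegree f i)) (by lia)
  have hlead : (finSuccEquiv k n (T (h v + ∑ x ∈ f.support \ {v}, h x))).leadingCoeff =
      (finSuccEquiv k n (T (h v))).leadingCoeff := by
    simp only [map_add, map_sum]
    rw [add_comm]
    apply Polynomial.leadingCoeff_add_of_degree_lt <|
      (lt_of_le_of_lt <| Polynomial.degree_sum_le _ _) ?_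
    have h2 : h v ≠ 0 := by simpa [h] using mem_support_iff.mp hv
    replace h2 : (finSuccEquiv k n (T (h v))) ≠ 0 := fun eq ↦ h2 <|
      by simpa only [map_eq_zero_iff _ (AlgEquiv.injective _)] using eq
    exact (Finset.sup_lt_iff <| Ne.bot_lt (fun x ↦ h2 <| Polynomial.degree_eq_bot.mp x)).mpr hlt
  rw [← Finset.sum_eq_add_sum_sdiff_singleton_of_mem hv h, f.support_sum_monomial_coeff] at hlead
  rw [hlead, leadingCoeff_finSuccEquiv_nagataEquiv (by lia)]
  exact (mem_support_iff.mp hv).isUnit.map MvPolynomial.C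

end Nagata

/-- The coordinate ring of a hypersurface in affine space is finite over that of a hyperplane, in
suitable coordinates. -/
theorem exists_coordinates_finite {k : Type*} [Field k] {n : ℕ}
    (h : MvPolynomial (Fin (n + 1)) k) (hh : h ≠ 0) :
    ∃ e : MvPolynomial (Fin (n + 1)) k ≃ₐ[k] Polynomial (MvPolynomial (Fin n) k),
      ∃ p : Polynomial (MvPolynomial (Fin n) k), p.Monic ∧ p ∈ Ideal.span {e h} := by
  refine ⟨(nagataEquiv (2 + h.totalDegree)).trans (finSuccEquiv k n), ?_⟩
  obtain ⟨u, hu⟩ := isUnit_leadingCoeff_nagataEquiv h hh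
  refine ⟨Polynomial.C (↑u⁻¹ : MvPolynomial (Fin n) k) *
    finSuccEquiv k n (nagataEquiv (2 + h.totalDegree) h), ?_, ?_⟩
  · rw [Polynomial.Monic, Polynomial.leadingCoeff_mul, Polynomial.leadingCoeff_C, ← hu,
      Units.inv_mul]
  · exact Ideal.mul_mem_left _ _ (Ideal.mem_span_singleton_self _)

/-! ### Local lengths and dévissage along prime filtrations -/

section Filtration

open TensorProduct

universe u v

variable {B : Type u} [CommRing B]

/-- The length of the localization of a module at a prime. -/
noncomputable def localLength (p : Ideal B) [p.IsPrime] (N : Type v) [AddCommGroup N]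
    [Module B N] : ℕ∞ :=
  Module.length (Localization.AtPrime p) (Localization.AtPrime p ⊗[B] N)

section

variable (p : Ideal B) [p.IsPrime] {N N₁ N₂ N₃ : Type v} [AddCommGroup N] [Module B N]
  [AddCommGroup N₁] [Module B N₁] [AddCommGroup N₂] [Module B N₂] [AddCommGroup N₃] [Module B N₃]

theorem localLength_congr {N' : Type*} [AddCommGroup N'] [Module B N'] (e : N₁ ≃ₗ[B] N') :
    localLength p N₁ = localLength p N' :=
  (e.baseChange B (Localization.AtPrime p) N₁ N').length_eq

theorem localLength_eq_zero [Subsingleton N] : localLength p N = 0 :=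
  Module.length_eq_zero

theorem localLength_eq_add (f : N₁ →ₗ[B] N₂) (g : N₂ →ₗ[B] N₃) (hf : Function.Injective f)
    (hg : Function.Surjective g) (h : Function.Exact f g) :
    localLength p N₂ = localLength p N₁ + localLength p N₃ :=
  Module.length_eq_add_of_exact (f.baseChange (Localization.AtPrime p))
    (g.baseChange (Localization.AtPrime p))
    (Module.Flat.lTensor_preserves_injective_linearMap f hf)
    (LinearMap.lTensor_surjective _ hg) (lTensor_exact _ h hg)

theorem localLength_quotient (J : Ideal B) :
    localLength p (B ⧸ J) = Module.length (Localization.AtPrime p)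
      (Localization.AtPrime p ⧸ J.map (algebraMap B (Localization.AtPrime p))) :=
  (Ideal.qoutMapEquivTensorQout (Localization.AtPrime p)).length_eq.symm

theorem localLength_quotient_self : localLength p (B ⧸ p) = 1 := by
  rw [localLength_quotient, Localization.AtPrime.map_eq_maximalIdeal, Module.length_eq_one_iff,
    isSimpleModule_iff_isCoatom]
  exact (IsLocalRing.maximalIdeal.isMaximal _).out

theorem localLength_quotient_of_not_le (q : Ideal B) (hq : ¬ q ≤ p) :
    localLength p (B ⧸ q) = 0 := by
  obtain ⟨x, hx, hxp⟩ := Set.not_subset.mp hq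
  rw [localLength_quotient, Module.length_eq_zero_iff]
  refine Ideal.Quotient.subsingleton_iff.mpr (Ideal.eq_top_of_isUnit_mem _
    (Ideal.mem_map_of_mem _ hx) (IsLocalization.map_units _ (⟨x, hxp⟩ : p.primeCompl)))

end

variable {J : Ideal B}

open Classical in
theorem localLength_quotient_prime (p q : Ideal B) [p.IsPrime] [hq : q.IsPrime]
    (hp : p ∈ J.minimalPrimes) (hJq : J ≤ q) :
    localLength p (B ⧸ q) = if q = p then 1 else 0 := by
  split_ifs with h
  · subst h
    exact localLength_quotient_self q
  · exact localLength_quotient_of_not_le p q fun hle => h (le_antisymm hle (hp.2 ⟨hq, hJq⟩ hle))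

theorem compMultiplicity_eq (p : PrimeSpectrum B) (hp : p.asIdeal ∈ J.minimalPrimes) :
    compMultiplicity J p = (localLength p.asIdeal (B ⧸ J)).toNat := by
  rw [compMultiplicity, if_pos hp, localLength_quotient]

variable [IsNoetherianRing B]

/-- In a prime filtration each factor `B ⧸ q` has local length `0` or `1` at the minimal prime `p`.
-/
theorem localLength_ne_top (p : Ideal B) [p.IsPrime] (hp : p ∈ J.minimalPrimes) (N : Type v)
    [AddCommGroup N] [Module B N] [hN : Module.Finite B N] (hJN : J ≤ Module.annihilator B N) :
    localLength p N ≠ ⊤ := by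
  classical
  revert hJN
  refine IsNoetherianRing.induction_on_isQuotientEquivQuotientPrime B hN
    (motive := fun N _ _ _ => J ≤ Module.annihilator B N → localLength p N ≠ ⊤) ?_ ?_ ?_
  · intro N _ _ _ _ _
    rw [localLength_eq_zero]
    exact ENat.zero_ne_top
  · intro N _ _ _ q e hJN
    rw [e.annihilator_eq, Ideal.annihilator_quotient] at hJN
    rw [localLength_congr p e, localLength_quotient_prime p q.1 hp hJN]
    split_ifs <;> simp
  · intro N₁ _ _ _ N₂ _ _ _ N₃ _ _ _ f g hf hg h h1 h3 hJ
    rw [localLength_eq_add p f g hf hg h]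
    exact WithTop.add_ne_top.mpr ⟨h1 (hJ.trans (f.annihilator_le_of_injective hf)),
      h3 (hJ.trans (g.annihilator_le_of_surjective hg))⟩

theorem mem_support_fundamentalCycle (p : PrimeSpectrum B) :
    p ∈ (fundamentalCycle J).support ↔ p.asIdeal ∈ J.minimalPrimes := by
  rw [Finsupp.mem_support_iff]
  change compMultiplicity J p ≠ 0 ↔ _
  constructor
  · intro h
    by_contra hn
    exact h (if_neg hn)
  · intro h
    -- `B ⧸ p` is a quotient of `B ⧸ J` of local length `1`, so the length is positive; its
    -- finiteness matters because `toNat` sends `⊤` to `0`.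
    rw [compMultiplicity_eq p h, Ne, ENat.toNat_eq_zero, not_or]
    refine ⟨fun h0 => ?_, localLength_ne_top p.asIdeal h _ (Ideal.annihilator_quotient).ge⟩
    have h1 := localLength_eq_add p.asIdeal (LinearMap.ker (Submodule.factor h.1.2)).subtype
      (Submodule.factor h.1.2) (Submodule.subtype_injective _) (Submodule.factor_surjective _)
      (LinearMap.exact_subtype_ker_map _)
    have h2 : localLength p.asIdeal (B ⧸ p.asIdeal) = 1 := localLength_quotient_self _
    rw [h0] at h1
    have h3 := add_eq_zero.mp h1.symm
    exact one_ne_zero (h2.symm.trans h3.2)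

/-- A multiplicative function on the modules supported on `V(J)` that is trivial on the primes which
are not minimal is determined by the fundamental cycle. -/
theorem multiplicative_eq_prod_fundamentalCycle {Q : Type*} [CommMonoid Q]
    (lam : (N : Type u) → [AddCommGroup N] → [Module B N] → Q)
    (hsub : ∀ (N : Type u) [AddCommGroup N] [Module B N] [Subsingleton N], lam N = 1)
    (hses : ∀ (N₁ N₂ N₃ : Type u) [AddCommGroup N₁] [Module B N₁] [AddCommGroup N₂] [Module B N₂]
      [AddCommGroup N₃] [Module B N₃] (f : N₁ →ₗ[B] N₂) (g : N₂ →ₗ[B] N₃), Function.Injective f →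
      Function.Surjective g → Function.Exact f g → Module.Finite B N₂ →
      J ≤ Module.annihilator B N₂ → lam N₂ = lam N₁ * lam N₃)
    (hprime : ∀ p : PrimeSpectrum B, J ≤ p.asIdeal → p.asIdeal ∉ J.minimalPrimes →
      lam (B ⧸ p.asIdeal) = 1) :
    lam (B ⧸ J) = (fundamentalCycle J).prod fun p a => lam (B ⧸ p.asIdeal) ^ a := by
  classical
  have hiso : ∀ (N₁ N₂ : Type u) [AddCommGroup N₁] [Module B N₁] [AddCommGroup N₂] [Module B N₂]
      (e : N₁ ≃ₗ[B] N₂) (_ : Module.Finite B N₂) (_ : J ≤ Module.annihilator B N₂),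
      lam N₂ = lam N₁ := by
    intro N₁ N₂ _ _ _ _ e h1 h2
    rw [hses N₁ N₂ PUnit.{u + 1} e 0 e.injective (Function.surjective_to_subsingleton _)
      ((e.exact_zero_iff_surjective _).2 e.surjective) h1 h2, hsub PUnit, mul_one]
  -- The formula is proved for all finite modules killed by `J`, with local lengths as exponents,
  -- because a prime filtration leaves the quotients `B ⧸ J`.
  have key : J ≤ Module.annihilator B (B ⧸ J) → lam (B ⧸ J) =
      ∏ p ∈ (fundamentalCycle J).support,
        lam (B ⧸ p.asIdeal) ^ (localLength p.asIdeal (B ⧸ J)).toNat := by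
    refine IsNoetherianRing.induction_on_isQuotientEquivQuotientPrime B
      (inferInstance : Module.Finite B (B ⧸ J))
      (motive := fun N _ _ _ => J ≤ Module.annihilator B N → lam N =
        ∏ p ∈ (fundamentalCycle J).support,
          lam (B ⧸ p.asIdeal) ^ (localLength p.asIdeal N).toNat) ?_ ?_ ?_
    · intro N _ _ _ _ _
      rw [hsub N, Finset.prod_eq_one]
      intro p _
      rw [localLength_eq_zero, ENat.toNat_zero, pow_zero]
    · intro N _ _ _ q e hJN
      have hJq := hJN
      rw [e.annihilator_eq, Ideal.annihilator_quotient] at hJq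
      rw [hiso _ _ e.symm inferInstance hJN]
      have h1 : ∀ p ∈ (fundamentalCycle J).support,
          lam (B ⧸ p.asIdeal) ^ (localLength p.asIdeal N).toNat =
            if q = p then lam (B ⧸ q.asIdeal) else 1 := by
        intro p hp
        rw [localLength_congr p.asIdeal e, localLength_quotient_prime p.asIdeal q.1
          ((mem_support_fundamentalCycle p).mp hp) hJq]
        by_cases hqp : q = p
        · subst hqp; simp
        · have : q.1 ≠ p.1 := fun h => hqp (PrimeSpectrum.ext h)
          simp [hqp, this]
      rw [Finset.prod_congr rfl h1, Finset.prod_ite_eq]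
      split_ifs with h
      · rfl
      · exact hprime q hJq fun h' => h ((mem_support_fundamentalCycle q).mpr h')
    · intro N₁ _ _ _ N₂ _ _ _ N₃ _ _ _ f g hf hg h h1 h3 hJ
      have hJ1 := hJ.trans (f.annihilator_le_of_injective hf)
      have hJ3 := hJ.trans (g.annihilator_le_of_surjective hg)
      rw [hses N₁ N₂ N₃ f g hf hg h inferInstance hJ, h1 hJ1, h3 hJ3, ← Finset.prod_mul_distrib]
      refine Finset.prod_congr rfl fun p hp => ?_
      have hp' := (mem_support_fundamentalCycle p).mp hp
      rw [localLength_eq_add p.asIdeal f g hf hg h, ENat.toNat_add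
        (localLength_ne_top p.asIdeal hp' N₁ hJ1)
        (localLength_ne_top p.asIdeal hp' N₃ hJ3), pow_add]
  rw [key (Ideal.annihilator_quotient).ge, Finsupp.prod]
  refine Finset.prod_congr rfl fun p hp => ?_
  rw [← compMultiplicity_eq p ((mem_support_fundamentalCycle p).mp hp)]
  rfl

end Filtration

/-! ### Characteristic polynomials after tensoring with a field -/

section Charpoly

open TensorProduct

open Module.Basis in
theorem charpoly_eq_charpoly_mul_charpoly {R V : Type*} [CommRing R] [AddCommGroup V] [Module R V]
    [Module.Finite R V] [Module.Free R V] (W : Submodule R V) [Module.Free R W] [Module.Finite R W]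
    [Module.Free R (V ⧸ W)] (e : V →ₗ[R] V) (he : W ≤ W.comap e) :
    e.charpoly = (e.restrict he).charpoly * (W.mapQ W e he).charpoly := by
  nontriviality R
  let m := Module.Free.ChooseBasisIndex R W
  let bW : Module.Basis m R W := Module.Free.chooseBasis R W
  let n := Module.Free.ChooseBasisIndex R (V ⧸ W)
  let bQ : Module.Basis n R (V ⧸ W) := Module.Free.chooseBasis R (V ⧸ W)
  let b := sumQuot bW bQ
  let A : Matrix m m R := LinearMap.toMatrix bW bW (e.restrict he)
  let B : Matrix m n R := Matrix.of fun i l ↦ (b.repr (e (b (Sum.inr l)))) (Sum.inl i)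
  let D : Matrix n n R := LinearMap.toMatrix bQ bQ (W.mapQ W e he)
  suffices LinearMap.toMatrix b b e = Matrix.fromBlocks A B 0 D by
    rw [← LinearMap.charpoly_toMatrix e b, this, ← LinearMap.charpoly_toMatrix _ bW,
      ← LinearMap.charpoly_toMatrix _ bQ, Matrix.charpoly_fromBlocks_zero₂₁]
  ext u v
  cases u with
  | inl i =>
    cases v with
    | inl k =>
      simp only [b, sumQuot_inl, Matrix.fromBlocks_apply₁₁, A, LinearMap.toMatrix_apply]
      apply sumQuot_repr_inl_of_mem
    | inr l => simp [LinearMap.toMatrix_apply, Matrix.fromBlocks_apply₁₂, B]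
  | inr j =>
    cases v with
    | inl k =>
      suffices W.mkQ (e (bW k)) = 0 by simp [LinearMap.toMatrix_apply, b, this]
      rw [← LinearMap.mem_ker, Submodule.ker_mkQ]
      exact he (Submodule.coe_mem (bW k))
    | inr l =>
      simp only [LinearMap.toMatrix_apply, sumQuot_repr_inr, Matrix.fromBlocks_apply₂₂, b, D]
      rw [← sumQuot_inr bW bQ l, W.mapQ_apply]
      simp

theorem charpoly_eq_mul_of_exact {F V₁ V₂ V₃ : Type*} [Field F] [AddCommGroup V₁] [Module F V₁]
    [AddCommGroup V₂] [Module F V₂] [AddCommGroup V₃] [Module F V₃] [Module.Finite F V₁]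
    [Module.Finite F V₂] [Module.Finite F V₃] (f : V₁ →ₗ[F] V₂) (g : V₂ →ₗ[F] V₃)
    (hf : Function.Injective f) (hg : Function.Surjective g) (h : Function.Exact f g)
    (φ₁ : V₁ →ₗ[F] V₁) (φ₂ : V₂ →ₗ[F] V₂) (φ₃ : V₃ →ₗ[F] V₃) (h₁ : ∀ v, f (φ₁ v) = φ₂ (f v))
    (h₂ : ∀ v, g (φ₂ v) = φ₃ (g v)) : φ₂.charpoly = φ₁.charpoly * φ₃.charpoly := by
  have hW : LinearMap.range f ≤ (LinearMap.range f).comap φ₂ := by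
    rintro _ ⟨v, rfl⟩
    exact ⟨φ₁ v, h₁ v⟩
  rw [charpoly_eq_charpoly_mul_charpoly (LinearMap.range f) φ₂ hW]
  congr 1
  · rw [← LinearEquiv.charpoly_conj (LinearEquiv.ofInjective f hf) φ₁]
    congr 1
    refine LinearMap.ext fun w => ?_
    obtain ⟨v, rfl⟩ := (LinearEquiv.ofInjective f hf).surjective w
    rw [LinearEquiv.conj_apply_apply, LinearEquiv.symm_apply_apply]
    exact Subtype.ext (h₁ v).symm
  · let e := h.linearEquivOfSurjective hg
    rw [← LinearEquiv.charpoly_conj e]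
    congr 1
    refine LinearMap.ext fun w => ?_
    obtain ⟨v, rfl⟩ := hg w
    have h3 : ∀ v, e (Submodule.Quotient.mk v) = g v := fun v => rfl
    rw [LinearEquiv.conj_apply_apply, ← h3 v, LinearEquiv.symm_apply_apply]
    exact (h3 _).trans (h₂ v)

section

variable {R : Type*} (F : Type*) [CommRing R] [Field F] [Algebra R F] {N N₁ N₂ N₃ : Type*}
  [AddCommGroup N] [Module R N] [AddCommGroup N₁] [Module R N₁]
  [AddCommGroup N₂] [Module R N₂] [AddCommGroup N₃] [Module R N₃]

open Classical in
/-- The characteristic polynomial of an endomorphism of a module, after tensoring with a field. -/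
noncomputable def genericCharpoly (φ : N →ₗ[R] N) : Polynomial F :=
  if _ : Module.Finite F (F ⊗[R] N) then (φ.baseChange F).charpoly else 1

theorem genericCharpoly_eq [Module.Finite R N] (φ : N →ₗ[R] N) :
    genericCharpoly F φ = (φ.baseChange F).charpoly :=
  dif_pos (inferInstanceAs (Module.Finite F (F ⊗[R] N)))

theorem genericCharpoly_eq_one [Subsingleton (F ⊗[R] N)] (φ : N →ₗ[R] N) :
    genericCharpoly F φ = 1 := by
  have : Module.Finite F (F ⊗[R] N) := ⟨⟨∅, Subsingleton.elim _ _⟩⟩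
  refine (dif_pos this).trans ?_
  refine Polynomial.eq_one_of_monic_natDegree_zero (LinearMap.charpoly_monic _) ?_
  rw [LinearMap.charpoly_natDegree, Module.finrank_zero_of_subsingleton]

theorem genericCharpoly_eq_mul [Module.Flat R F] [IsNoetherianRing R] [Module.Finite R N₂]
    (f : N₁ →ₗ[R] N₂) (g : N₂ →ₗ[R] N₃) (hf : Function.Injective f) (hg : Function.Surjective g)
    (h : Function.Exact f g) (φ₁ : N₁ →ₗ[R] N₁) (φ₂ : N₂ →ₗ[R] N₂) (φ₃ : N₃ →ₗ[R] N₃)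
    (h₁ : f ∘ₗ φ₁ = φ₂ ∘ₗ f) (h₂ : g ∘ₗ φ₂ = φ₃ ∘ₗ g) :
    genericCharpoly F φ₂ = genericCharpoly F φ₁ * genericCharpoly F φ₃ := by
  have : Module.Finite R N₁ := Module.Finite.of_injective f hf
  have : Module.Finite R N₃ := Module.Finite.of_surjective g hg
  rw [genericCharpoly_eq, genericCharpoly_eq, genericCharpoly_eq]
  refine charpoly_eq_mul_of_exact (f.baseChange F) (g.baseChange F)
    (Module.Flat.lTensor_preserves_injective_linearMap f hf)
    (LinearMap.lTensor_surjective _ hg) (lTensor_exact _ h hg) _ _ _ ?_ ?_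
  · intro v
    rw [← LinearMap.comp_apply, ← LinearMap.baseChange_comp, h₁, LinearMap.baseChange_comp]
    rfl
  · intro v
    rw [← LinearMap.comp_apply, ← LinearMap.baseChange_comp, h₂, LinearMap.baseChange_comp]
    rfl

end

/-- The characteristic polynomial of an element of an integral extension domain. -/
theorem charpoly_lmul_eq_pow {R F D : Type*} [CommRing R] [IsDomain R] [IsIntegrallyClosed R]
    [Field F] [Algebra R F] [IsFractionRing R F] [CommRing D] [IsDomain D] [Algebra R D]
    [Module.Finite R D] [FaithfulSMul R D] (y : D) (k : ℕ)
    (hk : k * (minpoly R y).natDegree = Module.finrank R D) :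
    genericCharpoly F (Algebra.lmul R D y) = ((minpoly R y).map (algebraMap R F)) ^ k := by
  rw [genericCharpoly_eq]
  have hy : IsIntegral R y := Algebra.IsIntegral.isIntegral y
  have hirr : Irreducible ((minpoly R y).map (algebraMap R F)) :=
    ((minpoly.monic hy).irreducible_iff_irreducible_map_fraction_map).mp
      (minpoly.irreducible hy)
  have hmon : ((minpoly R y).map (algebraMap R F)).Monic := (minpoly.monic hy).map _
  let φ := (Algebra.lmul R D y).baseChange F
  have h0 : Polynomial.aeval φ ((minpoly R y).map (algebraMap R F)) = 0 := by
    have h1 : Polynomial.aeval (Algebra.lmul R D y) (minpoly R y) = 0 := by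
      rw [Polynomial.aeval_algHom_apply, minpoly.aeval, map_zero]
    have h3 := Polynomial.aeval_algHom_apply (Module.End.baseChangeHom R F D)
      (Algebra.lmul R D y) (minpoly R y)
    rw [h1, map_zero] at h3
    rw [Polynomial.aeval_map_algebraMap]
    exact h3
  let b := Module.Free.chooseBasis F (F ⊗[R] D)
  have h2 : φ.charpoly ∣ ((minpoly R y).map (algebraMap R F)) ^
      Fintype.card (Module.Free.ChooseBasisIndex F (F ⊗[R] D)) := by
    rw [← LinearMap.charpoly_toMatrix φ b]
    refine charpoly_dvd_pow_of_aeval_eq_zero _ _ ?_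
    have h3 := Polynomial.aeval_algHom_apply (LinearMap.toMatrixAlgEquiv b) φ
      ((minpoly R y).map (algebraMap R F))
    rw [h0, map_zero] at h3
    exact h3
  -- The minimal polynomial stays irreducible over `F` since `R` is integrally closed. So the
  -- characteristic polynomial is a power of it, and degrees fix the exponent.
  obtain ⟨j, -, hj⟩ := (dvd_prime_pow hirr.prime _).mp h2
  have h4 := Polynomial.eq_of_monic_of_associated φ.charpoly_monic (hmon.pow j) hj
  have h5 := congrArg Polynomial.natDegree h4
  rw [LinearMap.charpoly_natDegree, hmon.natDegree_pow, (minpoly.monic hy).natDegree_map,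
    (TensorProduct.isBaseChange R D F).finrank_eq, ← hk] at h5
  have h6 : k = j := Nat.eq_of_mul_eq_mul_right (minpoly.natDegree_pos hy) h5
  rw [h6]
  exact h4

end Charpoly

/-! ### Residue degrees and push-forward of a prime cycle -/

section Residue

open TensorProduct

/-- Ranks over `R` are degrees of residue fields over `F = Frac R`; this is the tower law for `F ⊆
κ(Q) ⊆ κ(P)`. -/
theorem residueDegree_mul_natDegree {R C B : Type*} [CommRing R] [IsDomain R] [CommRing C]
    [CommRing B] [Algebra R C] [Algebra R B] (ψ : C →ₐ[R] B) (P : PrimeSpectrum B)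
    (hinj : Function.Injective (algebraMap R (B ⧸ P.asIdeal))) :
    residueDegree ψ.toRingHom P *
      Module.finrank R (C ⧸ (P.comap ψ.toRingHom).asIdeal) =
    Module.finrank R (B ⧸ P.asIdeal) := by
  let F := FractionRing R
  let Q := P.comap ψ.toRingHom
  let _ : Algebra Q.asIdeal.ResidueField P.asIdeal.ResidueField :=
    (Ideal.ResidueField.map Q.asIdeal P.asIdeal ψ.toRingHom rfl).toAlgebra
  have hP : Function.Injective (algebraMap R P.asIdeal.ResidueField) := by
    rw [IsScalarTower.algebraMap_eq R (B ⧸ P.asIdeal)]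
    exact P.asIdeal.injective_algebraMap_quotient_residueField.comp hinj
  have h1 : ∀ r, algebraMap Q.asIdeal.ResidueField P.asIdeal.ResidueField
      (algebraMap R Q.asIdeal.ResidueField r) = algebraMap R P.asIdeal.ResidueField r := by
    intro r
    rw [IsScalarTower.algebraMap_apply R C Q.asIdeal.ResidueField,
      IsScalarTower.algebraMap_apply R B P.asIdeal.ResidueField, ← ψ.commutes r]
    exact Ideal.ResidueField.map_algebraMap Q.asIdeal P.asIdeal ψ.toRingHom rfl _
  have hQ : Function.Injective (algebraMap R Q.asIdeal.ResidueField) := by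
    refine Function.Injective.of_comp (f := algebraMap _ P.asIdeal.ResidueField) ?_
    convert hP using 1
    exact funext h1
  let _ : Algebra F Q.asIdeal.ResidueField := (IsFractionRing.lift hQ).toAlgebra
  let _ : Algebra F P.asIdeal.ResidueField :=
    ((algebraMap Q.asIdeal.ResidueField _).comp (IsFractionRing.lift hQ)).toAlgebra
  have : IsScalarTower F Q.asIdeal.ResidueField P.asIdeal.ResidueField :=
    IsScalarTower.of_algebraMap_eq' rfl
  have : IsScalarTower R F Q.asIdeal.ResidueField :=
    IsScalarTower.of_algebraMap_eq fun r => (IsFractionRing.lift_algebraMap hQ r).symm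
  have : IsScalarTower R F P.asIdeal.ResidueField :=
    IsScalarTower.of_algebraMap_eq fun r =>
      (h1 r).symm.trans (congrArg _ (IsFractionRing.lift_algebraMap hQ r).symm)
  rw [← IsFractionRing.finrank_eq R F (B ⧸ P.asIdeal) P.asIdeal.ResidueField,
    ← IsFractionRing.finrank_eq R F (C ⧸ Q.asIdeal) Q.asIdeal.ResidueField,
    ← Module.finrank_mul_finrank F Q.asIdeal.ResidueField P.asIdeal.ResidueField, mul_comm]
  rfl

/-- The generic characteristic polynomial of a prime cycle that is finite over `Spec R`, and the
equation of its push-forward to the affine line over `R`. -/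
theorem exists_equation_of_prime {R C B : Type*} (F : Type*) [CommRing R] [IsDomain R]
    [IsIntegrallyClosed R] [Field F] [Algebra R F] [IsFractionRing R F] [CommRing C]
    [CommRing B] [Algebra R C] [Algebra R B] (e : Polynomial R ≃ₐ[R] C) (ψ : C →ₐ[R] B)
    (P : PrimeSpectrum B) [Module.Finite R (B ⧸ P.asIdeal)]
    (hinj : Function.Injective (algebraMap R (B ⧸ P.asIdeal))) :
    ∃ p : Polynomial R, p.Monic ∧ (P.comap ψ.toRingHom).asIdeal = Ideal.span {e p} ∧
      genericCharpoly F
        (Algebra.lmul R (B ⧸ P.asIdeal) (Ideal.Quotient.mk P.asIdeal (ψ (e Polynomial.X)))) =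
          (p.map (algebraMap R F)) ^ residueDegree ψ.toRingHom P := by
  set y := Ideal.Quotient.mk P.asIdeal (ψ (e Polynomial.X)) with hy
  have hyint : IsIntegral R y := Algebra.IsIntegral.isIntegral y
  have : FaithfulSMul R (B ⧸ P.asIdeal) := (faithfulSMul_iff_algebraMap_injective R _).mpr hinj
  have hcomp : ∀ q, Ideal.Quotient.mk P.asIdeal (ψ (e q)) = Polynomial.aeval y q := by
    intro q
    have h : ((Ideal.Quotient.mkₐ R P.asIdeal).comp ψ).comp e.toAlgHom = Polynomial.aeval y :=
      Polynomial.algHom_ext (by simp [hy])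
    exact DFunLike.congr_fun h q
  have hmem : ∀ q, e q ∈ (P.comap ψ.toRingHom).asIdeal ↔ minpoly R y ∣ q := by
    intro q
    rw [← minpoly.isIntegrallyClosed_dvd_iff hyint, ← hcomp, Ideal.Quotient.eq_zero_iff_mem]
    rfl
  have hspan : (P.comap ψ.toRingHom).asIdeal = Ideal.span {e (minpoly R y)} := by
    ext c
    obtain ⟨q, rfl⟩ := e.surjective c
    rw [hmem, Ideal.mem_span_singleton]
    exact (map_dvd_iff e).symm
  refine ⟨minpoly R y, minpoly.monic hyint, hspan, charpoly_lmul_eq_pow y _ ?_⟩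
  rw [← residueDegree_mul_natDegree ψ P hinj]
  congr 1
  -- The image hypersurface has coordinate ring `R[X]` modulo the minimal polynomial, which is free
  -- of rank its degree.
  have hmap : (P.comap ψ.toRingHom).asIdeal = (Ideal.span {minpoly R y}).map (e : _ →+* C) := by
    rw [hspan, Ideal.map_span, Set.image_singleton]
    rfl
  let ε : AdjoinRoot (minpoly R y) ≃ₐ[R] C ⧸ (P.comap ψ.toRingHom).asIdeal :=
    Ideal.quotientEquivAlg _ _ e hmap
  rw [← ε.toLinearEquiv.finrank_eq, (AdjoinRoot.powerBasis' (minpoly.monic hyint)).finrank]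
  rfl

end Residue

/-! ### Characteristic polynomials on modules over an `R`-algebra -/

section Multiplicative

open TensorProduct

universe u

theorem genericCharpoly_congr {R : Type*} (F : Type*) [CommRing R] [Field F] [Algebra R F]
    {N N' : Type*} [AddCommGroup N] [Module R N] [AddCommGroup N'] [Module R N'] (e : N ≃ₗ[R] N')
    (φ : N →ₗ[R] N) (φ' : N' →ₗ[R] N') (h : ∀ v, e (φ v) = φ' (e v)) :
    genericCharpoly F φ = genericCharpoly F φ' := by
  let ε : F ⊗[R] N ≃ₗ[F] F ⊗[R] N' := e.baseChange R F N N'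
  have hε : ∀ v, ε (φ.baseChange F v) = φ'.baseChange F (ε v) := by
    intro v
    induction v with
    | zero => simp
    | add v w hv hw => simp only [map_add, hv, hw]
    | tmul x v => simp [ε, h]
  by_cases hf : Module.Finite F (F ⊗[R] N)
  · have hf' : Module.Finite F (F ⊗[R] N') := Module.Finite.equiv ε
    refine (dif_pos hf).trans (Eq.trans ?_ (dif_pos hf').symm)
    rw [← LinearEquiv.charpoly_conj ε]
    congr 1
    refine LinearMap.ext fun w => ?_
    rw [LinearEquiv.conj_apply_apply, hε, LinearEquiv.apply_symm_apply]
  · have hf' : ¬ Module.Finite F (F ⊗[R] N') := fun _ => hf (Module.Finite.equiv ε.symm)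
    rw [genericCharpoly, genericCharpoly, dif_neg hf, dif_neg hf']

/-- A module over an `R`-algebra `B`, considered as a module over `R` as well. -/
def ScalarRestriction (_R _B N : Type*) : Type _ := N

section

variable (R B N : Type*) [CommRing R] [CommRing B] [Algebra R B] [AddCommGroup N] [Module B N]

instance : AddCommGroup (ScalarRestriction R B N) := inferInstanceAs (AddCommGroup N)

instance : Module B (ScalarRestriction R B N) := inferInstanceAs (Module B N)

instance : Module R (ScalarRestriction R B N) :=
  Module.compHom (ScalarRestriction R B N) (algebraMap R B)

instance : IsScalarTower R B (ScalarRestriction R B N) where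
  smul_assoc r b v := by
    rw [Algebra.smul_def, mul_smul]
    rfl

/-- The identity map. -/
def ScalarRestriction.equiv : ScalarRestriction R B N ≃ₗ[B] N := LinearEquiv.refl B N

end

variable (R F : Type*) {B : Type u} [CommRing R] [Field F] [Algebra R F] [CommRing B] [Algebra R B]
  (y : B)

/-- The characteristic polynomial of an element `y` of an `R`-algebra on a module, after tensoring
with a field. -/
noncomputable def charpolyOn (N : Type*) [AddCommGroup N] [Module B N] : Polynomial F :=
  genericCharpoly F (Algebra.lsmul R R (ScalarRestriction R B N) y)

variable {N N' : Type*} [AddCommGroup N] [Module B N] [AddCommGroup N'] [Module B N']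

theorem charpolyOn_eq [Module R N] [IsScalarTower R B N] (φ : N →ₗ[R] N) (h : ∀ v, φ v = y • v) :
    charpolyOn R F y N = genericCharpoly F φ := by
  let e := (ScalarRestriction.equiv R B N).restrictScalars R
  exact genericCharpoly_congr F e _ φ fun v => (h (e v)).symm

theorem charpolyOn_congr (e : N ≃ₗ[B] N') : charpolyOn R F y N = charpolyOn R F y N' := by
  let ε : ScalarRestriction R B N ≃ₗ[B] ScalarRestriction R B N' := e
  exact genericCharpoly_congr F (ε.restrictScalars R) _ _ fun v => ε.map_smul y v

/-- `F ⊗ N = 0`, since `r` is invertible on it and kills it. This disposes of the modules that do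
not dominate `Spec R`. -/
theorem charpolyOn_eq_one (r : R) (hr : algebraMap R F r ≠ 0)
    (hrN : ∀ v : N, algebraMap R B r • v = 0) : charpolyOn R F y N = 1 := by
  have : Subsingleton (F ⊗[R] ScalarRestriction R B N) := by
    refine subsingleton_of_forall_eq 0 fun w => ?_
    induction w with
    | zero => rfl
    | add v w hv hw => rw [hv, hw, add_zero]
    | tmul x v =>
      have h1 : x = r • ((algebraMap R F r)⁻¹ * x) := by
        rw [Algebra.smul_def, mul_inv_cancel_left₀ hr]
      have h2 : r • v = 0 := hrN v
      rw [h1, TensorProduct.smul_tmul, h2, TensorProduct.tmul_zero]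
  exact genericCharpoly_eq_one F _

theorem charpolyOn_eq_one_of_subsingleton [Subsingleton N] : charpolyOn R F y N = 1 :=
  charpolyOn_eq_one R F y 1 (by simp) fun _ => Subsingleton.elim _ _

variable {N₁ N₂ N₃ : Type*} [AddCommGroup N₁] [Module B N₁] [AddCommGroup N₂] [Module B N₂]
  [AddCommGroup N₃] [Module B N₃]

theorem finite_of_annihilator {J : Ideal B} [Module.Finite R (B ⧸ J)] [Module R N]
    [IsScalarTower R B N] [Module.Finite B N] (hJ : J ≤ Module.annihilator B N) :
    Module.Finite R N := by
  have h : Module.IsTorsionBySet B N J := fun v a => Module.mem_annihilator.mp (hJ a.2) v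
  let _ : Module (B ⧸ J) N := h.module
  have : IsScalarTower R (B ⧸ J) N := h.isScalarTower
  have : IsScalarTower B (B ⧸ J) N := h.isScalarTower
  have : Module.Finite (B ⧸ J) N := Module.Finite.of_restrictScalars_finite B _ _
  exact Module.Finite.trans (B ⧸ J) N

theorem charpolyOn_eq_mul [Module.Flat R F] [IsNoetherianRing R] {J : Ideal B}
    [Module.Finite R (B ⧸ J)] [hN₂ : Module.Finite B N₂] (hJ : J ≤ Module.annihilator B N₂)
    (f : N₁ →ₗ[B] N₂) (g : N₂ →ₗ[B] N₃) (hf : Function.Injective f) (hg : Function.Surjective g)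
    (h : Function.Exact f g) :
    charpolyOn R F y N₂ = charpolyOn R F y N₁ * charpolyOn R F y N₃ := by
  have : Module.Finite B (ScalarRestriction R B N₂) := hN₂
  have hJ' : J ≤ Module.annihilator B (ScalarRestriction R B N₂) := hJ
  have : Module.Finite R (ScalarRestriction R B N₂) := finite_of_annihilator R (J := J) hJ'
  let f' : ScalarRestriction R B N₁ →ₗ[B] ScalarRestriction R B N₂ := f
  let g' : ScalarRestriction R B N₂ →ₗ[B] ScalarRestriction R B N₃ := g
  exact genericCharpoly_eq_mul F (f'.restrictScalars R) (g'.restrictScalars R) hf hg h _ _ _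
    (LinearMap.ext fun v => f'.map_smul y v) (LinearMap.ext fun v => g'.map_smul y v)

end Multiplicative

/-! ### Characteristic polynomials and fundamental cycles -/

section Cycle

open TensorProduct

universe u

variable (R F : Type*) {B : Type u} [CommRing R] [IsDomain R] [IsNoetherianRing R] [Field F]
  [Algebra R F] [IsFractionRing R F] [CommRing B] [Algebra R B] [IsNoetherianRing B] (y : B)

omit [IsDomain R] [IsNoetherianRing R] [IsNoetherianRing B] in
theorem charpolyOn_quotient_eq_one (q : Ideal B) (r : R) (hr : r ≠ 0)
    (hrq : algebraMap R B r ∈ q) : charpolyOn R F y (B ⧸ q) = 1 := by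
  refine charpolyOn_eq_one R F y r ?_ fun v => ?_
  · rwa [Ne, map_eq_zero_iff _ (IsFractionRing.injective R F)]
  · obtain ⟨v, rfl⟩ := Ideal.Quotient.mk_surjective v
    exact Ideal.Quotient.eq_zero_iff_mem.mpr (q.mul_mem_right v hrq)

-- A nonzero ideal of the domain `B ⧸ P`, integral over `R`, contracts to a nonzero ideal of `R`.
omit [IsNoetherianRing R] [IsNoetherianRing B] in
theorem exists_algebraMap_mem_of_lt (P q : Ideal B) [P.IsPrime] (hPq : P < q)
    [Algebra.IsIntegral R (B ⧸ P)] : ∃ r : R, r ≠ 0 ∧ algebraMap R B r ∈ q := by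
  obtain ⟨hle, x, hx, hxP⟩ := SetLike.lt_iff_le_and_exists.mp hPq
  have h := Ideal.comap_ne_bot_of_integral_mem (R := R) (I := q.map (Ideal.Quotient.mk P))
    (x := Ideal.Quotient.mk P x) (by rwa [Ne, Ideal.Quotient.eq_zero_iff_mem])
    (Ideal.mem_map_of_mem _ hx) (Algebra.IsIntegral.isIntegral _)
  obtain ⟨r, hr, hr0⟩ := Submodule.exists_mem_ne_zero_of_ne_bot h
  refine ⟨r, hr0, ?_⟩
  rw [Ideal.mem_comap] at hr
  obtain ⟨z, hz, hzr⟩ := (Ideal.mem_map_iff_of_surjective _ Ideal.Quotient.mk_surjective).mp hr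
  have h1 : z - algebraMap R B r ∈ P := by
    rw [← Ideal.Quotient.mk_eq_mk_iff_sub_mem]
    exact hzr
  have h2 := q.sub_mem hz (hle h1)
  rwa [sub_sub_cancel] at h2

omit [IsDomain R] [IsNoetherianRing R] [IsNoetherianRing B] in
theorem finite_quotient_of_le {J P : Ideal B} (h : J ≤ P) [Module.Finite R (B ⧸ J)] :
    Module.Finite R (B ⧸ P) :=
  Module.Finite.of_surjective (Ideal.Quotient.factorₐ R h).toLinearMap
    (Ideal.Quotient.factor_surjective h)

/-- Dévissage applied to a multiplicative invariant. A prime over `J` that is not minimal meets `R`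
nontrivially, so it contributes `1`; embedded components leave no trace. -/
theorem charpolyOn_quotient_eq_prod (J : Ideal B) [Module.Finite R (B ⧸ J)] :
    charpolyOn R F y (B ⧸ J) =
      (fundamentalCycle J).prod fun P a => charpolyOn R F y (B ⧸ P.asIdeal) ^ a := by
  have : Module.Flat R F := IsLocalization.flat F (nonZeroDivisors R)
  refine multiplicative_eq_prod_fundamentalCycle (fun N _ _ => charpolyOn R F y N)
    (fun N _ _ _ => charpolyOn_eq_one_of_subsingleton R F y)
    (fun N₁ N₂ N₃ _ _ _ _ _ _ f g hf hg h _ hJ => charpolyOn_eq_mul R F y hJ f g hf hg h) ?_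
  intro P hJP hP
  obtain ⟨P₀, hP₀, hle⟩ := Ideal.exists_minimalPrimes_le hJP
  have := hP₀.1.1
  have := finite_quotient_of_le R hP₀.1.2
  obtain ⟨r, hr, hrP⟩ := exists_algebraMap_mem_of_lt R P₀ P.asIdeal
    (lt_of_le_of_ne hle fun h => hP (h ▸ hP₀))
  exact charpolyOn_quotient_eq_one R F y P.asIdeal r hr hrP

omit [IsNoetherianRing B] in
/-- The compatibility with a flat base change `B₀ → B`. -/
theorem charpolyOn_quotient_map_eq_prod {B₀ : Type u} [CommRing B₀] [IsNoetherianRing B₀]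
    [Algebra B₀ B] [Module.Flat B₀ B] (J : Ideal B₀)
    [Module.Finite R (B ⧸ J.map (algebraMap B₀ B))]
    (hcomap : ∀ (p : Ideal B₀) (P : Ideal B), p ∈ J.minimalPrimes →
      P ∈ (p.map (algebraMap B₀ B)).minimalPrimes → P.comap (algebraMap B₀ B) = p) :
    charpolyOn R F y (B ⧸ J.map (algebraMap B₀ B)) =
      (fundamentalCycle J).prod fun p a =>
        charpolyOn R F y (B ⧸ p.asIdeal.map (algebraMap B₀ B)) ^ a := by
  have : Module.Flat R F := IsLocalization.flat F (nonZeroDivisors R)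
  have hiso : ∀ I : Ideal B₀, charpolyOn R F y (B ⧸ I.map (algebraMap B₀ B)) =
      charpolyOn R F y (B ⊗[B₀] (B₀ ⧸ I)) := fun I =>
    charpolyOn_congr R F y (Ideal.qoutMapEquivTensorQout B)
  simp only [hiso]
  refine multiplicative_eq_prod_fundamentalCycle
    (fun (N : Type u) (_ : AddCommGroup N) (_ : Module B₀ N) => charpolyOn R F y (B ⊗[B₀] N))
    ?_ ?_ ?_
  · intro N _ _ _
    exact charpolyOn_eq_one_of_subsingleton R F y
  · intro N₁ N₂ N₃ _ _ _ _ _ _ f g hf hg h _ hJ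
    refine charpolyOn_eq_mul R F y (J := J.map (algebraMap B₀ B)) ?_
      (f.baseChange B) (g.baseChange B)
      (Module.Flat.lTensor_preserves_injective_linearMap f hf)
      (LinearMap.lTensor_surjective _ hg) (lTensor_exact _ h hg)
    rw [Ideal.map_le_iff_le_comap]
    intro a ha
    rw [Ideal.mem_comap, Module.mem_annihilator]
    intro w
    induction w with
    | zero => rw [smul_zero]
    | add v w hv hw => rw [smul_add, hv, hw, add_zero]
    | tmul b v =>
      rw [algebraMap_smul, ← TensorProduct.tmul_smul, Module.mem_annihilator.mp (hJ ha),
        TensorProduct.tmul_zero]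
  · intro p hJp hp
    change charpolyOn R F y (B ⊗[B₀] (B₀ ⧸ p.asIdeal)) = 1
    rw [← hiso]
    suffices ∃ r : R, r ≠ 0 ∧ algebraMap R B r ∈ p.asIdeal.map (algebraMap B₀ B) by
      obtain ⟨r, hr, hrp⟩ := this
      exact charpolyOn_quotient_eq_one R F y _ r hr hrp
    -- Otherwise a prime `P` of `B` over `p B` lies over `0` in `R`. It strictly contains a minimal
    -- prime `P₀` over `p₀ B`, because `P₀` contracts to `p₀ ≠ p`; integrality modulo `P₀` then puts
    -- a nonzero element of `R` in `P`.
    by_contra! hcon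
    have := finite_quotient_of_le R (Ideal.map_mono (f := algebraMap B₀ B) hJp)
    obtain ⟨P', -, hP', hcP⟩ := Ideal.exists_ideal_over_prime_of_isIntegral
      (S := B ⧸ p.asIdeal.map (algebraMap B₀ B)) (⊥ : Ideal R) ⊥ (by
        intro r hr
        by_contra hr0
        refine hcon r hr0 ?_
        rw [Ideal.mem_comap, Ideal.mem_bot] at hr
        exact Ideal.Quotient.eq_zero_iff_mem.mp hr)
    let P := P'.comap (Ideal.Quotient.mk (p.asIdeal.map (algebraMap B₀ B)))
    have hpP : p.asIdeal.map (algebraMap B₀ B) ≤ P := by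
      intro x hx
      rw [Ideal.mem_comap, Ideal.Quotient.eq_zero_iff_mem.mpr hx]
      exact P'.zero_mem
    obtain ⟨p₀, hp₀, hle⟩ := Ideal.exists_minimalPrimes_le hJp
    have : P.IsPrime := inferInstance
    obtain ⟨P₀, hP₀, hPle⟩ := Ideal.exists_minimalPrimes_le ((Ideal.map_mono hle).trans hpP)
    have := hP₀.1.1
    have := finite_quotient_of_le R ((Ideal.map_mono hp₀.1.2).trans hP₀.1.2)
    have hlt : P₀ < P := by
      refine lt_of_le_of_ne hPle fun h => hp ?_
      have h1 := hcomap p₀ P₀ hp₀ hP₀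
      have h2 : p.asIdeal ≤ p₀ := by
        rw [← h1, h, ← Ideal.map_le_iff_le_comap]
        exact hpP
      rwa [le_antisymm h2 hle]
    obtain ⟨r, hr, hrP⟩ := exists_algebraMap_mem_of_lt R P₀ P hlt
    have h3 : r ∈ P'.comap (algebraMap R _) := hrP
    rw [hcP] at h3
    exact hr h3

end Cycle

/-! ### The equation of a push-forward -/

section Pushforward

/-- The equation of the push-forward of a cycle that is finite over `Spec R` to the affine line
over `R`. -/
theorem exists_equation_pushforward {R C B : Type*} (F : Type*) [CommRing R] [IsDomain R]
    [IsIntegrallyClosed R] [Field F] [Algebra R F] [IsFractionRing R F] [CommRing C]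
    [CommRing B] [Algebra R C] [Algebra R B] (e : Polynomial R ≃ₐ[R] C) (ψ : C →ₐ[R] B)
    (Z : EffCycle B) (hfin : ∀ P ∈ Z.support, Module.Finite R (B ⧸ P.asIdeal))
    (hinj : ∀ P ∈ Z.support, Function.Injective (algebraMap R (B ⧸ P.asIdeal))) :
    ∃ q : Polynomial R, (Z.pushforward ψ.toRingHom).ideal = Ideal.span {e q} ∧
      q.map (algebraMap R F) =
        Z.prod fun P a => charpolyOn R F (ψ (e Polynomial.X)) (B ⧸ P.asIdeal) ^ a := by
  have h : ∀ P ∈ Z.support, ∃ p : Polynomial R,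
      (P.comap ψ.toRingHom).asIdeal = Ideal.span {e p} ∧
      charpolyOn R F (ψ (e Polynomial.X)) (B ⧸ P.asIdeal) =
        (p.map (algebraMap R F)) ^ residueDegree ψ.toRingHom P := by
    intro P hP
    have := hfin P hP
    obtain ⟨p, -, h1, h2⟩ := exists_equation_of_prime F e ψ P (hinj P hP)
    refine ⟨p, h1, ?_⟩
    rw [← h2]
    refine charpolyOn_eq R F _ _ fun v => ?_
    exact (Algebra.smul_def _ _).symm
  choose! p hp hχ using h
  refine ⟨∏ P ∈ Z.support, (p P ^ residueDegree ψ.toRingHom P) ^ Z P, ?_, ?_⟩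
  · rw [EffCycle.ideal, EffCycle.pushforward, Finsupp.prod_sum_index (by simp)
      (fun _ _ _ => pow_add _ _ _), map_prod, ← Ideal.prod_span_singleton, Finsupp.prod]
    refine Finset.prod_congr rfl fun P hP => ?_
    refine (Finsupp.prod_single_index (h := fun (p : PrimeSpectrum C) a => p.asIdeal ^ a)
      (pow_zero _)).trans ?_
    rw [hp P hP, Ideal.span_singleton_pow, map_pow, map_pow,
      ← pow_mul, mul_comm]
  · rw [Polynomial.map_prod, Finsupp.prod]
    refine Finset.prod_congr rfl fun P hP => ?_
    rw [hχ P hP, Polynomial.map_pow, Polynomial.map_pow]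

end Pushforward

/-! ### Families over the line and their central fibers -/

section Family

universe u

/-- The generic characteristic polynomial of the special fiber of a family annihilates it. -/
theorem aeval_charpolyOn_eq_zero {L : Type*} {d : ℕ} [Field L] (F : Type*) [Field F]
    [Algebra (MvPolynomial (Fin d) L) F] [IsFractionRing (MvPolynomial (Fin d) L) F] {A : Type u}
    [CommRing A] [Algebra L A] [Algebra.FiniteType L A]
    (hreg : HasRegularPolynomialSubring L (d + 1) A) (α : MvPolynomial (Fin d) L →ₐ[L] A) (t : A)
    {B : Type*} [CommRing B] [Algebra (MvPolynomial (Fin d) L) B] (J : Ideal B)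
    [Module.Finite (MvPolynomial (Fin d) L) (B ⧸ J)] (π : A →+* B ⧸ J)
    (hπ : Function.Surjective π) (hker : RingHom.ker π = Ideal.span {t})
    (hα : ∀ r, π (α r) = algebraMap (MvPolynomial (Fin d) L) (B ⧸ J) r) (y : B) :
    ∃ χ : Polynomial (MvPolynomial (Fin d) L),
      χ.map (algebraMap _ F) = charpolyOn (MvPolynomial (Fin d) L) F y (B ⧸ J) ∧
      Polynomial.aeval (Ideal.Quotient.mk J y) χ = 0 := by
  let _ : Algebra (MvPolynomial (Fin d) L) A := α.toRingHom.toAlgebra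
  have : IsScalarTower L (MvPolynomial (Fin d) L) A :=
    IsScalarTower.of_algebraMap_eq' α.comp_algebraMap.symm
  let _ : Algebra (Polynomial (MvPolynomial (Fin d) L)) A :=
    (Polynomial.eval₂RingHom α.toRingHom t).toAlgebra
  have hX : algebraMap (Polynomial (MvPolynomial (Fin d) L)) A Polynomial.X = t :=
    Polynomial.eval₂_X _ _
  have : IsScalarTower (MvPolynomial (Fin d) L) (Polynomial (MvPolynomial (Fin d) L)) A :=
    IsScalarTower.of_algebraMap_eq fun r => (Polynomial.eval₂_C α.toRingHom t).symm
  have : IsScalarTower L (Polynomial (MvPolynomial (Fin d) L)) A :=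
    IsScalarTower.of_algebraMap_eq fun r => by
      rw [IsScalarTower.algebraMap_apply L (MvPolynomial (Fin d) L)
        (Polynomial (MvPolynomial (Fin d) L)), ← IsScalarTower.algebraMap_apply
        (MvPolynomial (Fin d) L) (Polynomial (MvPolynomial (Fin d) L)) A,
        ← IsScalarTower.algebraMap_apply]
  have : Algebra.FiniteType (Polynomial (MvPolynomial (Fin d) L)) A :=
    Algebra.FiniteType.of_restrictScalars_finiteType L _ _
  obtain ⟨χ, -, h1, h2⟩ := aeval_charpoly_eq_zero_of_family F hreg (A₀ := B ⧸ J)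
    { π with commutes' := hα } hπ (by rw [hX]; exact hker) (Ideal.Quotient.mk J y)
  refine ⟨χ, ?_, h2⟩
  rw [h1, ← genericCharpoly_eq]
  exact (charpolyOn_eq _ F y (Algebra.lmul _ (B ⧸ J) (Ideal.Quotient.mk J y))
    fun v => (Algebra.smul_def _ _).symm).symm

variable {L : Type*} [Field L] {n : ℕ}

theorem centralFiber_hom_surjective (a : MvPolynomial (Fin n) L) :
    aeval (R := L) (Fin.snoc (α := fun _ => MvPolynomial (Fin n) L) X 0)
      (rename Fin.castSucc a : MvPolynomial (Fin (n + 1)) L) = a := by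
  rw [aeval_rename]
  have : (Fin.snoc (α := fun _ => MvPolynomial (Fin n) L) X 0) ∘ Fin.castSucc = X := by
    ext1 i
    simp
  rw [this, aeval_X_left_apply]

theorem sub_rename_mem_span (a : MvPolynomial (Fin (n + 1)) L) :
    a - rename Fin.castSucc (aeval (R := L) (Fin.snoc (α := fun _ => MvPolynomial (Fin n) L) X 0) a)
      ∈ Ideal.span {(X (Fin.last n) : MvPolynomial (Fin (n + 1)) L)} := by
  rw [← Ideal.Quotient.mk_eq_mk_iff_sub_mem]
  have : Ideal.Quotient.mkₐ L (Ideal.span {(X (Fin.last n) : MvPolynomial (Fin (n + 1)) L)}) =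
      ((Ideal.Quotient.mkₐ L _).comp (rename Fin.castSucc)).comp
        (aeval (R := L) (Fin.snoc (α := fun _ => MvPolynomial (Fin n) L) X 0)) := by
    refine MvPolynomial.algHom_ext fun i => ?_
    refine Fin.lastCases ?_ (fun i => ?_) i
    · simp
    · simp
  exact DFunLike.congr_fun this a

/-- The coordinate ring of the central fiber is the quotient by the last coordinate. -/
theorem exists_specialization (I : Ideal (MvPolynomial (Fin (n + 1)) L)) :
    ∃ π : (MvPolynomial (Fin (n + 1)) L ⧸ I) →+* MvPolynomial (Fin n) L ⧸ centralFiber I,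
      Function.Surjective π ∧
      RingHom.ker π = Ideal.span {Ideal.Quotient.mk I (X (Fin.last n))} ∧
      ∀ b, π (Ideal.Quotient.mk I (rename Fin.castSucc b)) =
        Ideal.Quotient.mk (centralFiber I) b := by
  let ρ : MvPolynomial (Fin (n + 1)) L →ₐ[L] MvPolynomial (Fin n) L :=
    aeval (R := L) (Fin.snoc (α := fun _ => MvPolynomial (Fin n) L) X 0)
  have hρ : Function.Surjective ρ := fun a => ⟨_, centralFiber_hom_surjective a⟩
  let π := Ideal.quotientMap (centralFiber I) ρ.toRingHom (Ideal.le_comap_map (I := I))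
  have hπ : ∀ a, π (Ideal.Quotient.mk I a) = Ideal.Quotient.mk (centralFiber I) (ρ a) :=
    fun a => Ideal.quotientMap_mk
  refine ⟨π, ?_, ?_, fun b => ?_⟩
  · exact Ideal.quotientMap_surjective hρ
  · ext a
    obtain ⟨a, rfl⟩ := Ideal.Quotient.mk_surjective a
    rw [RingHom.mem_ker, hπ, Ideal.Quotient.eq_zero_iff_mem]
    constructor
    · intro h
      obtain ⟨i, hi, hia⟩ := (Ideal.mem_map_iff_of_surjective ρ.toRingHom hρ).mp h
      have h1 : a - i ∈ Ideal.span {(X (Fin.last n) : MvPolynomial (Fin (n + 1)) L)} := by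
        have h2 := sub_rename_mem_span (a - i)
        have h3 : ρ (a - i) = 0 := by
          rw [map_sub, sub_eq_zero]
          exact hia.symm
        change a - i - rename Fin.castSucc (ρ (a - i)) ∈ _ at h2
        rwa [h3, map_zero, sub_zero] at h2
      have h4 : Ideal.Quotient.mk I a = Ideal.Quotient.mk I (a - i) := by
        rw [map_sub, Ideal.Quotient.eq_zero_iff_mem.mpr hi, sub_zero]
      rw [h4, ← Set.image_singleton, ← Ideal.map_span]
      exact Ideal.mem_map_of_mem _ h1
    · intro h
      obtain ⟨c, hc⟩ := Ideal.mem_span_singleton.mp h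
      obtain ⟨c, rfl⟩ := Ideal.Quotient.mk_surjective c
      rw [← Ideal.Quotient.eq_zero_iff_mem, ← hπ, hc, ← map_mul, hπ, map_mul]
      have : ρ (X (Fin.last n)) = 0 := by simp [ρ]
      rw [this, zero_mul, map_zero]
  · rw [hπ]
    congr 1
    exact centralFiber_hom_surjective b

end Family

/-! ### Coordinates in which the central fiber is finite over `𝔸^d` -/

section Finite

/-- A ring homomorphism that is integral modulo all minimal primes is integral. -/
theorem isIntegral_of_minimalPrimes {C B : Type*} [CommRing C] [CommRing B] [IsNoetherianRing B]
    (ψ : C →+* B) (J : Ideal B)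
    (h : ∀ P ∈ J.minimalPrimes, ((Ideal.Quotient.mk P).comp ψ).IsIntegral) :
    ((Ideal.Quotient.mk J).comp ψ).IsIntegral := by
  intro b
  obtain ⟨b, rfl⟩ := Ideal.Quotient.mk_surjective b
  have hfin := J.finite_minimalPrimes_of_isNoetherianRing
  have h1 : ∀ P ∈ J.minimalPrimes, ∃ p : Polynomial C, p.Monic ∧ p.eval₂ ψ b ∈ P := by
    intro P hP
    obtain ⟨p, hp, hpb⟩ := h P hP (Ideal.Quotient.mk P b)
    refine ⟨p, hp, ?_⟩
    rwa [← Polynomial.hom_eval₂, Ideal.Quotient.eq_zero_iff_mem] at hpb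
  choose! p hp hpP using h1
  let q := ∏ P ∈ hfin.toFinset, p P
  have hq : q.Monic := Polynomial.monic_prod_of_monic _ _ fun P hP => hp P (by simpa using hP)
  have hrad : q.eval₂ ψ b ∈ J.radical := by
    rw [← J.sInf_minimalPrimes, Ideal.mem_sInf]
    intro P hP
    rw [Polynomial.eval₂_finsetProd]
    have := hP.1.1
    exact Ideal.mem_of_dvd _ (Finset.dvd_prod_of_mem _ (hfin.mem_toFinset.mpr hP)) (hpP P hP)
  obtain ⟨k, hk⟩ := hrad
  refine ⟨q ^ k, hq.pow k, ?_⟩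
  rw [← Polynomial.hom_eval₂, Polynomial.eval₂_pow, Ideal.Quotient.eq_zero_iff_mem]
  exact hk

theorem isIntegral_comp_C_of_monic {R D : Type*} [CommRing R] [CommRing D]
    (φ : Polynomial R →+* D) (hφ : φ.IsIntegral) {p : Polynomial R} (hp : p.Monic)
    (h : φ p = 0) : (φ.comp Polynomial.C).IsIntegral := by
  have h1 : (Ideal.Quotient.lift (Ideal.span {p}) φ fun a ha => by
      obtain ⟨b, rfl⟩ := Ideal.mem_span_singleton.mp ha
      rw [map_mul, h, zero_mul]).IsIntegral :=
    RingHom.IsIntegral.tower_top (Ideal.Quotient.mk (Ideal.span {p})) _ hφ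
  have h2 : ((Ideal.Quotient.mk (Ideal.span {p})).comp Polynomial.C).IsIntegral := by
    have : Module.Finite R (Polynomial R ⧸ Ideal.span {p}) := hp.finite_quotient
    exact fun x => Algebra.IsIntegral.isIntegral (R := R) x
  exact h2.trans _ _ h1

/-- In suitable coordinates, a scheme of dimension `d` that is finite over `𝔸^{d+1}` is finite
over `𝔸^d`. -/
theorem exists_coordinates_finite_quotient {L B : Type*} [Field L] {d : ℕ} [CommRing B]
    [Algebra L B] [Algebra.FiniteType L B] (ψ : MvPolynomial (Fin (d + 1)) L →ₐ[L] B) (J : Ideal B)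
    (hint : ∀ P ∈ J.minimalPrimes, ((Ideal.Quotient.mk P).comp ψ.toRingHom).IsIntegral)
    (hdim : ∀ P ∈ J.minimalPrimes, ringKrullDim (B ⧸ P) = d) :
    ∃ e : Polynomial (MvPolynomial (Fin d) L) ≃ₐ[L] MvPolynomial (Fin (d + 1)) L,
      ((Ideal.Quotient.mk J).comp
        ((ψ.toRingHom.comp
          (e : Polynomial (MvPolynomial (Fin d) L) →+* MvPolynomial (Fin (d + 1)) L)).comp
            Polynomial.C)).Finite := by
  have : IsNoetherianRing B := Algebra.FiniteType.isNoetherianRing L B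
  have hfin := J.finite_minimalPrimes_of_isNoetherianRing
  have h1 : ∀ P ∈ J.minimalPrimes, ∃ c : MvPolynomial (Fin (d + 1)) L, c ≠ 0 ∧ ψ c ∈ P := by
    intro P hP
    -- Otherwise `B ⧸ P` would be an integral extension of the polynomial ring in `d + 1` variables,
    -- of dimension `d + 1`.
    by_contra! hcon
    have h2 := ringKrullDim_eq_of_isIntegral_of_injective _ (hint P hP) (by
      rw [injective_iff_map_eq_zero]
      intro c hc
      by_contra hc0
      exact hcon c hc0 (Ideal.Quotient.eq_zero_iff_mem.mp hc))
    rw [hdim P hP, ringKrullDim_mvPolynomial_fin] at h2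
    have : d = d + 1 := by exact_mod_cast h2
    omega
  choose! c hc hcP using h1
  -- A power of the product of the `c P` maps into `J`. In Nagata coordinates for it, the last
  -- coordinate satisfies a monic equation over `R` modulo `J`.
  have hrad : ψ (∏ P ∈ hfin.toFinset, c P) ∈ J.radical := by
    rw [← J.sInf_minimalPrimes, Ideal.mem_sInf]
    intro P hP
    rw [map_prod]
    exact Ideal.mem_of_dvd _ (Finset.dvd_prod_of_mem _ (hfin.mem_toFinset.mpr hP)) (hcP P hP)
  obtain ⟨k, hk⟩ := hrad
  rw [← map_pow] at hk
  obtain ⟨e, p, hp, hpe⟩ := exists_coordinates_finite ((∏ P ∈ hfin.toFinset, c P) ^ k)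
    (pow_ne_zero k (Finset.prod_ne_zero_iff.mpr fun P hP => hc P (hfin.mem_toFinset.mp hP)))
  refine ⟨e.symm, RingHom.IsIntegral.to_finite ?_ ?_⟩
  · let φ := (Ideal.Quotient.mk J).comp
      (ψ.toRingHom.comp
        (e.symm : Polynomial (MvPolynomial (Fin d) L) →+* MvPolynomial (Fin (d + 1)) L))
    have hφ : φ.IsIntegral := by
      have h2 :
          (e.symm : Polynomial (MvPolynomial (Fin d) L) →+* MvPolynomial (Fin (d + 1)) L).IsIntegral :=
        RingHom.isIntegral_of_surjective _ e.symm.surjective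
      exact h2.trans _ _ (isIntegral_of_minimalPrimes ψ.toRingHom J hint)
    have hφp : φ p = 0 := by
      obtain ⟨a, ha⟩ := Ideal.mem_span_singleton.mp hpe
      have h3 : e.symm p = (∏ P ∈ hfin.toFinset, c P) ^ k * e.symm a := by
        rw [ha, map_mul, AlgEquiv.symm_apply_apply]
      refine Ideal.Quotient.eq_zero_iff_mem.mpr ?_
      change ψ (e.symm p) ∈ J
      rw [h3, map_mul]
      exact J.mul_mem_right _ hk
    exact isIntegral_comp_C_of_monic φ hφ hp hφp
  · have h2 : (algebraMap L (B ⧸ J)).FiniteType :=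
      RingHom.finiteType_algebraMap.mpr inferInstance
    refine RingHom.FiniteType.of_comp_finiteType (f := (C : L →+* MvPolynomial (Fin d) L)) ?_
    convert h2 using 1
    refine RingHom.ext fun r => ?_
    have h3 : e.symm (Polynomial.C (C r)) = algebraMap L _ r := e.symm.commutes r
    change Ideal.Quotient.mk J (ψ (e.symm (Polynomial.C (C r)))) = _
    rw [h3, ψ.commutes]
    rfl

end Finite

/-! ### Chow equations vanish on the central fiber -/

section Main

universe u

variable {L : Type u} [Field L] {n d : ℕ}

/-- The fundamental cycle of `J` is `Z`, as far as characteristic polynomials are concerned. -/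
def HasCycle {B : Type*} [CommRing B] [Algebra L B] (d : ℕ) (J : Ideal B) (Z : EffCycle B) : Prop :=
  ∀ (_ : Algebra (MvPolynomial (Fin d) L) B) (_ : Module.Finite (MvPolynomial (Fin d) L) (B ⧸ J))
    (y : B), charpolyOn (MvPolynomial (Fin d) L) (FractionRing (MvPolynomial (Fin d) L)) y (B ⧸ J) =
      Z.prod fun P a => charpolyOn (MvPolynomial (Fin d) L)
        (FractionRing (MvPolynomial (Fin d) L)) y (B ⧸ P.asIdeal) ^ a

/-- The equation of the push-forward is the generic characteristic polynomial of the last coordinate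
on the central fiber, which annihilates that fiber by the deformation argument. The hypotheses are
phrased by a regular polynomial subring and `HasCycle`, so that they can be checked after extension
of the ground field. -/
theorem mem_centralFiber_of_isChowEquation (I : Ideal (MvPolynomial (Fin (n + 1)) L))
    (hreg : HasRegularPolynomialSubring L (d + 1) (MvPolynomial (Fin (n + 1)) L ⧸ I))
    (Z : EffCycle (MvPolynomial (Fin n) L)) (hZd : Z.IsPure d)
    (hsupp : ∀ P ∈ Z.support, centralFiber I ≤ P.asIdeal)
    (hmin : ∀ P : PrimeSpectrum (MvPolynomial (Fin n) L),
      P.asIdeal ∈ (centralFiber I).minimalPrimes → P ∈ Z.support)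
    (hZ : HasCycle (L := L) d (centralFiber I) Z) (M : Matrix (Fin (d + 1)) (Fin n) L)
    (hM : IsAllowable Z M) (f : MvPolynomial (Fin n) L) (hf : IsChowEquation Z M f) :
    f ∈ centralFiber I := by
  obtain ⟨g, hg, rfl⟩ := hf
  set J := centralFiber I with hJ
  let R := MvPolynomial (Fin d) L
  obtain ⟨e, he⟩ := exists_coordinates_finite_quotient (linearPullback M) J
    (fun P hP => (hM.finite ⟨P, hP.1.1⟩ (hmin ⟨P, hP.1.1⟩ hP)).to_isIntegral)
    (fun P hP => hZd ⟨P, hP.1.1⟩ (hmin ⟨P, hP.1.1⟩ hP))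
  let γ : R →+* MvPolynomial (Fin (d + 1)) L :=
    (e : Polynomial (MvPolynomial (Fin d) L) →+* MvPolynomial (Fin (d + 1)) L).comp Polynomial.C
  let _ : Algebra R (MvPolynomial (Fin (d + 1)) L) := γ.toAlgebra
  let _ : Algebra R (MvPolynomial (Fin n) L) := ((linearPullback M).toRingHom.comp γ).toAlgebra
  have hfin : Module.Finite R (MvPolynomial (Fin n) L ⧸ J) := he
  let e' : Polynomial R ≃ₐ[R] MvPolynomial (Fin (d + 1)) L :=
    AlgEquiv.ofRingEquiv (f := e.toRingEquiv) fun r => rfl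
  let ψ : MvPolynomial (Fin (d + 1)) L →ₐ[R] MvPolynomial (Fin n) L :=
    { (linearPullback M).toRingHom with commutes' := fun r => rfl }
  have hfinP : ∀ P ∈ Z.support, Module.Finite R (MvPolynomial (Fin n) L ⧸ P.asIdeal) :=
    fun P hP => finite_quotient_of_le R (hsupp P hP)
  obtain ⟨q, hq, hqχ⟩ := exists_equation_pushforward (FractionRing R) e' ψ Z hfinP
    (fun P hP => by
      have := hfinP P hP
      exact injective_of_isIntegral_of_ringKrullDim _
        (fun x => Algebra.IsIntegral.isIntegral (R := R) x) (hZd P hP))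
  obtain ⟨π, hπ, hker, hπr⟩ := exists_specialization I
  let δ : R →ₐ[L] Polynomial R := Algebra.ofId R (Polynomial R) |>.restrictScalars L
  let α : R →ₐ[L] MvPolynomial (Fin (n + 1)) L ⧸ I :=
    (Ideal.Quotient.mkₐ L I).comp ((rename Fin.castSucc).comp
      ((linearPullback M).comp (e.toAlgHom.comp δ)))
  obtain ⟨χ, hχ, hχ0⟩ := aeval_charpolyOn_eq_zero (FractionRing R) hreg α _ J π hπ hker
    (fun r => hπr _) (ψ (e' Polynomial.X))
  -- Both have the same image in `F[X]`, namely the product over the components of `Z`, and `R`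
  -- embeds in `F`.
  have h1 : χ = q := by
    refine Polynomial.map_injective _ (IsFractionRing.injective R (FractionRing R)) ?_
    rw [hχ, hqχ]
    exact hZ _ hfin _
  have h2 : ψ (e' q) ∈ J := by
    rw [← Ideal.Quotient.eq_zero_iff_mem, ← hχ0, h1]
    have h3 : ((Ideal.Quotient.mkₐ R J).comp ψ).comp e'.toAlgHom =
        Polynomial.aeval (Ideal.Quotient.mk J (ψ (e' Polynomial.X))) :=
      Polynomial.algHom_ext (by simp)
    exact DFunLike.congr_fun h3 q
  have h4 : g ∈ Ideal.span {e' q} := by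
    rw [← hq]
    have h5 : ψ.toRingHom = (linearPullback M).toRingHom := rfl
    rw [h5, ← hg]
    exact Ideal.mem_span_singleton_self g
  obtain ⟨u, rfl⟩ := Ideal.mem_span_singleton.mp h4
  rw [map_mul]
  exact J.mul_mem_right _ h2

end Main

/-! ### Base change of the fundamental cycle -/

section BaseChangeCycle

universe u

variable {K : Type u} [Field K] (L : Type u) [Field L] [Algebra K L] {n d : ℕ}

theorem mem_support_baseChange (W : EffCycle (MvPolynomial (Fin n) K))
    (P : PrimeSpectrum (MvPolynomial (Fin n) L)) :
    P ∈ (W.baseChange L).support ↔ ∃ p ∈ W.support,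
      P.asIdeal ∈ (p.asIdeal.map (MvPolynomial.map (algebraMap K L))).minimalPrimes := by
  rw [Finsupp.mem_support_iff, EffCycle.baseChange, Finsupp.sum_apply, Finsupp.sum, Ne,
    Finset.sum_eq_zero_iff]
  push Not
  refine exists_congr fun p => and_congr_right fun hp => ?_
  rw [Finsupp.smul_apply, smul_eq_mul, mul_ne_zero_iff,
    and_iff_right (Finsupp.mem_support_iff.mp hp), ← Finsupp.mem_support_iff,
    mem_support_fundamentalCycle]

theorem isPure_baseChange (W : EffCycle (MvPolynomial (Fin n) K)) (hW : W.IsPure d) :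
    (W.baseChange L).IsPure d := by
  intro P hP
  obtain ⟨p, hp, hpP⟩ := (mem_support_baseChange L W P).mp hP
  exact ringKrullDim_baseChange L p.asIdeal (hW p hp) P.asIdeal hpP

variable (J : Ideal (MvPolynomial (Fin n) K))

theorem le_of_mem_support_baseChange (P : PrimeSpectrum (MvPolynomial (Fin n) L))
    (hP : P ∈ ((fundamentalCycle J).baseChange L).support) :
    J.map (MvPolynomial.map (algebraMap K L)) ≤ P.asIdeal := by
  obtain ⟨p, hp, hpP⟩ := (mem_support_baseChange L _ P).mp hP
  exact (Ideal.map_mono ((mem_support_fundamentalCycle p).mp hp).1.2).trans hpP.1.2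

theorem mem_support_baseChange_of_mem_minimalPrimes (P : PrimeSpectrum (MvPolynomial (Fin n) L))
    (hP : P.asIdeal ∈ (J.map (MvPolynomial.map (algebraMap K L))).minimalPrimes) :
    P ∈ ((fundamentalCycle J).baseChange L).support := by
  obtain ⟨p, hp, hpP⟩ := Ideal.exists_minimalPrimes_le (Ideal.map_le_iff_le_comap.mp hP.1.2)
  refine (mem_support_baseChange L _ P).mpr ⟨⟨p, hp.1.1⟩, (mem_support_fundamentalCycle _).mpr hp,
    ⟨P.2, Ideal.map_le_iff_le_comap.mpr hpP⟩, fun P' hP' hle => ?_⟩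
  exact hP.2 ⟨hP'.1, (Ideal.map_mono hp.1.2).trans hP'.2⟩ hle

-- Two dévissages are composed: one along the flat map `K[x] → L[x]` reduces to the extensions of
-- the minimal primes of `J`, the other splits each of these into its components over `L`. Local
-- lengths over `K` and `L` need not be compared directly.
attribute [local instance] MvPolynomial.algebraMvPolynomial in
theorem hasCycle_baseChange :
    HasCycle (L := L) d (J.map (MvPolynomial.map (algebraMap K L)))
      ((fundamentalCycle J).baseChange L) := by
  intro _ hfin y
  have : Module.Flat (MvPolynomial (Fin n) K) (MvPolynomial (Fin n) L) :=
    Module.Flat.isBaseChange K (MvPolynomial (Fin n) K) L (MvPolynomial (Fin n) L)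
      (Algebra.IsPushout.out (R := K) (S := MvPolynomial (Fin n) K) (R' := L)
        (S' := MvPolynomial (Fin n) L))
  have : Module.Finite (MvPolynomial (Fin d) L) (MvPolynomial (Fin n) L ⧸
      J.map (algebraMap (MvPolynomial (Fin n) K) (MvPolynomial (Fin n) L))) := hfin
  have h1 := charpolyOn_quotient_map_eq_prod (MvPolynomial (Fin d) L)
    (FractionRing (MvPolynomial (Fin d) L)) y J (fun p P hp hP => by
      have := hp.1.1
      exact comap_eq_of_mem_minimalPrimes_baseChange L p P hP)
  refine h1.trans ?_
  rw [EffCycle.baseChange, Finsupp.prod_sum_index (by simp) (fun _ _ _ => pow_add _ _ _)]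
  refine Finset.prod_congr rfl fun p hp => ?_
  have := finite_quotient_of_le (MvPolynomial (Fin d) L)
    (Ideal.map_mono (f := MvPolynomial.map (algebraMap K L))
      ((mem_support_fundamentalCycle p).mp hp).1.2)
  refine (congrArg (· ^ _) (charpolyOn_quotient_eq_prod (MvPolynomial (Fin d) L)
    (FractionRing (MvPolynomial (Fin d) L)) y
    (p.asIdeal.map (MvPolynomial.map (algebraMap K L))))).trans ?_
  beta_reduce
  rw [Finsupp.prod_of_support_subset _ Finsupp.support_smul _ (by simp), Finsupp.prod,
    ← Finset.prod_pow]
  refine Finset.prod_congr rfl fun P _ => ?_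
  rw [Finsupp.smul_apply, smul_eq_mul, ← pow_mul, mul_comm]

end BaseChangeCycle

end ChowEquations

theorem mainTheorem10 {K : Type*} [Field K] (n d : ℕ)
    (I : Ideal (MvPolynomial (Fin (n + 1)) K))
    (hpure : ChowEquations.IsPureDimensional I (d + 1))
    (hemb : ChowEquations.NoEmbeddedPoints I)
    (hflat : ChowEquations.IsFlatOverLine I)
    (W : ChowEquations.EffCycle (MvPolynomial (Fin n) K))
    (hWd : W.IsPure d)
    (hW : ChowEquations.fundamentalCycle (ChowEquations.centralFiber I) = W) :
    ChowEquations.chowIdeal d W ≤ ChowEquations.centralFiber I := by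
  subst hW
  rw [ChowEquations.chowIdeal]
  split_ifs with hK
  · refine Ideal.span_le.mpr ?_
    rintro f ⟨M, hM, hf⟩
    obtain ⟨φ, -, hφ⟩ := ChowEquations.exists_finite_regular_of_pure I hpure hemb
    exact ChowEquations.mem_centralFiber_of_isChowEquation I ⟨φ, hφ⟩ _ hWd
      (fun P hP => ((ChowEquations.mem_support_fundamentalCycle P).mp hP).1.2)
      (fun P hP => (ChowEquations.mem_support_fundamentalCycle P).mpr hP)
      (fun _ _ y => ChowEquations.charpolyOn_quotient_eq_prod _ _ y _) M hM f hf
  -- For finite `K` it suffices to prove the inclusion over `K(t)`, because the extension of the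
  -- central fiber ideal contracts back to itself.
  · refine (Ideal.comap_mono (Ideal.span_le.mpr ?_)).trans
      (ChowEquations.comap_map_baseChange (RatFunc K) (ChowEquations.centralFiber I)).le
    rintro f ⟨M, hM, hf⟩
    have hC := ChowEquations.map_centralFiber (RatFunc K) I
    rw [hC]
    refine ChowEquations.mem_centralFiber_of_isChowEquation _
      (ChowEquations.hasRegularPolynomialSubring_baseChange (RatFunc K) I hpure hemb) _
      (ChowEquations.isPure_baseChange (RatFunc K) _ hWd) (fun P hP => ?_) (fun P hP => ?_) ?_
      M hM f hf
    · rw [← hC]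
      exact ChowEquations.le_of_mem_support_baseChange (RatFunc K) _ P hP
    · rw [← hC] at hP
      exact ChowEquations.mem_support_baseChange_of_mem_minimalPrimes (RatFunc K) _ P hP
    · rw [← hC]
      exact ChowEquations.hasCycle_baseChange (RatFunc K) _
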